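/- Let $D\subset\mathbb R^2$ be a bounded Lipschitz domain and write $D_{R,t}:=D+B_{R\sqrt t}(0)$. A Leray--Hopf weak solution with patch data is a pair $(\rho,u)$ with $0\le\rho\in L^\infty((0,\infty)\times\mathbb R^2)$, $\sqrt\rho\,u\in L^\infty((0,\infty);L^2(\mathbb R^2))$, $\nabla u\in L^2((0,\infty)\times\mathbb R^2)$, that solves $$\partial_t(\rho u)+\operatorname{div}(\rho u\otimes u)-\Delta u+\nabla P=0,\qquad \partial_t\rho+\operatorname{div}(\rho u)=0,\qquad \operatorname{div}u=0$$ in the sense of distributions (the momentum equation being tested against divergence-free fields) with initial data $\rho_0=\mathbf 1_D$ and $u_0\in L^2(\mathbb R^2;\mathbb R^2)$ weakly divergence free, and that satisfies, for every $t\ge 0$, the energy inequality $$\tfrac12\int\rho(t)|u(t)|^2\,dx+\int_0^t\!\!\int|\nabla u|^2\,dx\,ds\le\tfrac12\int\rho_0|u_0|^2\,dx .$$ For every $T>0$ there are functions $C_1=C_1(R,M)$, $C_2=C_2(R,M)$, nondecreasing in $R$ and in $M$, and constants $K_1(p)$, $K_2(q)$, all of them depending otherwise only on $T$ and $D$, such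 that the following holds for every $R>0$ and every Leray--Hopf weak solution $(\rho,u)$ with patch data, with $M:=\|\rho_0u_0\|_{L^2(\mathbb R^2)}$. For almost every $t\in(0,T)$ (and for every $t\in(0,T)$ if $t\mapsto\rho(t)$ is the representative that is weakly-$*$ continuous on $(0,\infty)$ with values in $L^\infty(\mathbb R^2)$), and for every measurable $v:\mathbb R^2\to\mathbb R^m$, $m\in\mathbb N$: (i) for every $p\in[2,\infty)$, $$t^{\frac12-\frac1p}\|v\|_{L^p(D_{R,t})}\le K_1(p)\,C_1(R,M)\Big(t^{\frac12}\|\nabla v\|_{L^2(\mathbb R^2)}+\|\rho(t)v\|_{L^2(\mathbb R^2)}\Big);$$ (ii) for every $q\in(2,\infty]$, $$t^{\frac12}\|v\|_{L^\infty(D_{R,t})}\le K_2(q)\,C_2(R,M)\Big(t^{1-\frac1q}\|\nabla v\|_{L^q(\mathbb R^2)}+\|\rho(t)v\|_{L^2(\mathbb R^2)}\Big).$$ Here $\nabla v$ is the weak gradient, and $\|\nabla v\|_{L^q}:=\infty$ if $v$ has no locally integrable weak gradient. The exceptional null set of times does not depend on $v$, $p$, $q$. -/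

import Mathlib

open MeasureTheory Set Topology
open scoped ENNReal NNReal ContDiff Pointwise

/-- The Euclidean plane `ℝ²`. -/
abbrev Plane : Type := EuclideanSpace ℝ (Fin 2)

/-- The `i`-th standard basis vector of the plane. -/
noncomputable def basisVec (i : Fin 2) : Plane := EuclideanSpace.single i (1 : ℝ)

/-- Values of gradients of `F`-valued functions on the plane: a pair `(∂₁ v, ∂₂ v)`, with the
Euclidean (Frobenius) norm. -/
abbrev GradVal (F : Type) : Type := PiLp 2 (fun _ : Fin 2 => F)

/-- A bounded open set in the plane with Lipschitz boundary: near every boundary point the set is,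
in a suitable orthonormal coordinate system, the region above the graph of a Lipschitz function. -/
def IsBoundedLipschitzDomain (D : Set Plane) : Prop :=
  IsOpen D ∧ Bornology.IsBounded D ∧
    ∀ x ∈ frontier D, ∃ (e : Plane ≃ₗᵢ[ℝ] Plane) (γ : ℝ → ℝ) (K : ℝ≥0) (r : ℝ),
      0 < r ∧ LipschitzWith K γ ∧
        ∀ y ∈ Metric.ball x r, (y ∈ D ↔ γ (e y 0) < e y 1)

/-- `G` is the weak (distributional) gradient of the locally integrable function `v`. -/
def HasWeakGradient {F : Type} [NormedAddCommGroup F] [NormedSpace ℝ F]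
    (v : Plane → F) (G : Plane → GradVal F) : Prop :=
  LocallyIntegrable v volume ∧ LocallyIntegrable G volume ∧
    ∀ φ : Plane → ℝ, ContDiff ℝ ∞ φ → HasCompactSupport φ → ∀ i : Fin 2,
      ∫ x, (fderiv ℝ φ x (basisVec i)) • v x = - ∫ x, φ x • G x i

/-- `‖∇v‖_{L^q(ℝ²)}`, with value `∞` if `v` has no locally integrable weak gradient. The weak
gradient is unique almost everywhere, so the infimum ranges over at most one value. -/
noncomputable def weakGradNorm {F : Type} [NormedAddCommGroup F] [NormedSpace ℝ F]
    (v : Plane → F) (q : ℝ≥0∞) : ℝ≥0∞ :=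
  ⨅ (G : Plane → GradVal F) (_ : HasWeakGradient v G), eLpNorm G q volume

/-- Weakly divergence-free vector fields. -/
def IsWeaklyDivFree (w : Plane → Plane) : Prop :=
  ∀ φ : Plane → ℝ, ContDiff ℝ ∞ φ → HasCompactSupport φ →
    ∫ x, ∑ i : Fin 2, w x i * fderiv ℝ φ x (basisVec i) = 0

/-- The space `L²_σ(ℝ²)`. -/
def IsL2Sigma (w : Plane → Plane) : Prop :=
  MemLp w 2 volume ∧ IsWeaklyDivFree w

/-- The measure `dt ⊗ dx` on `(0,∞) × ℝ²`. -/
noncomputable def spaceTime : Measure (ℝ × Plane) :=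
  (volume.restrict (Ioi (0 : ℝ))).prod volume

/-- Time derivative of a function of `(t,x)`. -/
noncomputable def timeDeriv {F : Type} [NormedAddCommGroup F] [NormedSpace ℝ F]
    (φ : ℝ × Plane → F) (t : ℝ) (x : Plane) : F :=
  fderiv ℝ φ (t, x) ((1 : ℝ), (0 : Plane))

/-- Spatial partial derivative `∂ᵢ` of a function of `(t,x)`. -/
noncomputable def spaceDeriv {F : Type} [NormedAddCommGroup F] [NormedSpace ℝ F]
    (i : Fin 2) (φ : ℝ × Plane → F) (t : ℝ) (x : Plane) : F :=
  fderiv ℝ φ (t, x) ((0 : ℝ), basisVec i)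

/-- Leray--Hopf weak solution `(ρ,u)`, with weak spatial gradient `∇u = G`, of the inhomogeneous
incompressible Navier--Stokes system with unit viscosity and initial data `(ρ₀,u₀)`.
Test functions on `[0,∞) × ℝ²` are restrictions of test functions on `ℝ × ℝ²`. -/
structure IsWeakSolutionWithGrad (ρ₀ : Plane → ℝ) (u₀ : Plane → Plane)
    (ρ : ℝ → Plane → ℝ) (u : ℝ → Plane → Plane) (G : ℝ → Plane → GradVal Plane) : Prop where
  /-- `ρ ∈ L^∞((0,∞) × ℝ²)` -/
  density_bounded : MemLp (Function.uncurry ρ) ⊤ spaceTime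
  /-- `ρ ≥ 0` -/
  density_nonneg : ∀ᵐ z ∂spaceTime, 0 ≤ ρ z.1 z.2
  velocity_measurable : AEStronglyMeasurable (Function.uncurry u) spaceTime
  /-- `√ρ u ∈ L^∞((0,∞); L²(ℝ²))` -/
  momentum_bounded : ∃ K : ℝ≥0, ∀ᵐ t ∂(volume.restrict (Ioi (0 : ℝ))),
    eLpNorm (fun x => √(ρ t x) • u t x) 2 volume ≤ K
  /-- `G(t) = ∇u(t)` for almost every `t > 0` -/
  gradient : ∀ᵐ t ∂(volume.restrict (Ioi (0 : ℝ))), HasWeakGradient (u t) (G t)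
  /-- `∇u ∈ L²((0,∞) × ℝ²)` -/
  gradient_memLp : MemLp (Function.uncurry G) 2 spaceTime
  /-- `∂ₜρ + div(ρu) = 0` with initial datum `ρ₀` -/
  continuity_eq : ∀ φ : ℝ × Plane → ℝ, ContDiff ℝ ∞ φ → HasCompactSupport φ →
    (∫ t in Ioi (0 : ℝ), ∫ x, ρ t x * timeDeriv φ t x)
      + (∫ t in Ioi (0 : ℝ), ∫ x, ρ t x * ∑ i : Fin 2, u t x i * spaceDeriv i φ t x)
      = - ∫ x, ρ₀ x * φ (0, x)
  /-- `∂ₜ(ρu) + div(ρu ⊗ u) - Δu + ∇P = 0` with initial datum `ρ₀u₀`, tested against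
  divergence-free fields -/
  momentum_eq : ∀ φ : ℝ × Plane → Plane, ContDiff ℝ ∞ φ → HasCompactSupport φ →
    (∀ t : ℝ, 0 ≤ t → ∀ x : Plane, ∑ i : Fin 2, (spaceDeriv i φ t x) i = 0) →
    (∫ t in Ioi (0 : ℝ), ∫ x, (ρ t x * inner ℝ (timeDeriv φ t x) (u t x)
        + ρ t x * ∑ i : Fin 2, u t x i * inner ℝ (u t x) (spaceDeriv i φ t x)))
      - (∫ t in Ioi (0 : ℝ), ∫ x, ∑ i : Fin 2, inner ℝ (G t x i) (spaceDeriv i φ t x))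
      = - ∫ x, ρ₀ x * inner ℝ (u₀ x) (φ (0, x))
  /-- `div u(t) = 0` for almost every `t > 0` -/
  div_free : ∀ᵐ t ∂(volume.restrict (Ioi (0 : ℝ))), IsWeaklyDivFree (u t)
  /-- the energy inequality -/
  energy : ∀ t : ℝ, 0 ≤ t →
    2⁻¹ * (∫⁻ x, ENNReal.ofReal (ρ t x) * ‖u t x‖ₑ ^ 2)
      + (∫⁻ s in Ioo 0 t, ∫⁻ x, ‖G s x‖ₑ ^ 2)
      ≤ 2⁻¹ * (∫⁻ x, ENNReal.ofReal (ρ₀ x) * ‖u₀ x‖ₑ ^ 2)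

/-- Leray--Hopf weak solution of the inhomogeneous incompressible Navier--Stokes system with unit
viscosity and initial data `(ρ₀,u₀)`. -/
def IsLerayHopfSolution (ρ₀ : Plane → ℝ) (u₀ : Plane → Plane)
    (ρ : ℝ → Plane → ℝ) (u : ℝ → Plane → Plane) : Prop :=
  ∃ G : ℝ → Plane → GradVal Plane, IsWeakSolutionWithGrad ρ₀ u₀ ρ u G

/-- `t ↦ ρ(t)` is weakly-* continuous on `(0,∞)` with values in `L^∞(ℝ²)`. -/
def IsWeakStarContinuous (ρ : ℝ → Plane → ℝ) : Prop :=
  (∀ t : ℝ, 0 < t → MemLp (ρ t) ⊤ volume) ∧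
    ∀ g : Plane → ℝ, Integrable g volume →
      ContinuousOn (fun t => ∫ x, ρ t x * g x) (Ioi (0 : ℝ))

/-- The strip `D_{R,t} = D + B_{R√t}(0)`. -/
noncomputable def strip (D : Set Plane) (R t : ℝ) : Set Plane :=
  D + Metric.ball (0 : Plane) (R * √t)

/-- The initial density `1_D` of a patch. -/
noncomputable def patchDensity (D : Set Plane) : Plane → ℝ :=
  D.indicator (fun _ => (1 : ℝ))

/-- `‖ρ₀ u₀‖_{L²(ℝ²)}`; finite for `ρ₀ = 1_D` and `u₀ ∈ L²`. -/
noncomputable def momentumNorm (ρ₀ : Plane → ℝ) (u₀ : Plane → Plane) : ℝ≥0 :=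
  (eLpNorm (fun x => ρ₀ x • u₀ x) 2 volume).toNNReal

/-! ### Translations -/

/-! The estimates are Poincaré-type inequalities with the density as weight. Fix a time t, put f =
ρ(t), and suppose that 0 ≤ f ≤ 1 and that f has mass at least μ in the ball of radius ℓ about x.
Integrating f(x+h)|v(x)| over |h| < ℓ and comparing v(x) with v(x+h) gives μ|v(x)| ≤ ∫_{|h|<ℓ}
|v(x+h) - v(x)| dh + ∫_{|h|<ℓ} |f v|(x+h) dh (`HasWeakGradient.ae_weighted_le`). The difference is
an integral of ∇v along a segment (`HasWeakGradient.sub_shift_eq`), so the first term is at most ℓ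
∫₀¹∫ |∇v(x+sh)| dh ds. This operator maps L² to L^p for 2 ≤ p < ∞ and L^q to L^∞ for q > 2
(`lintegral_segOp_rpow_le`, `segOp_le_eLpNorm`). If ℓ is of order √t and μ of order t, the powers of
t are the asserted ones (`scaled_le`, `scaled_top_le`).

What remains is to prove two facts about ρ(t), with constants that do not involve the unknown bound
of ρ in L^∞.

Lower bound for the mass. A point x of the strip is within R√t of some y in D, and a Lipschitz
domain occupies a fixed fraction of small balls about y, so the initial mass near y is of order t.
For a cutoff χ at scale r the continuity equation and Cauchy–Schwarz bound the rate of change of m =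
∫ρχ² by a multiple of (M/r)√m; hence √m changes by at most a multiple of Mt/r up to time t
(`BoundedTransport.mass_bounds`). With r = L√t and L large in terms of M this is a small part of the
initial √m (`IsAdmissibleDensity.ofReal_le_lintegral_ball`).

Upper bound ρ ≤ 1. This is the DiPerna–Lions renormalization: mollify the continuity equation, apply
a function β which vanishes exactly for arguments at most one, and let the mollification scale tend
to zero. The commutator vanishes in the limit because ∇u is in L² and ρ is bounded
(`IsMollifier.lintegral_comm_le`). The flux through a large cutoff vanishes because ρu is integrable
on bounded time intervals (`BoundedTransport.ae_density_le_one`).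

Both facts hold off a null set of times that depends on countably many cutoffs only, not on v, p or
q. They consist of inequalities between integrals that are continuous in time for the weakly-*
continuous representative, so then no time is exceptional. -/

theorem measurePreserving_shift {Y : Type*} [MeasurableSpace Y] (ν : Measure Y) [SFinite ν]
    {a : Y → Plane} (ha : Measurable a) :
    MeasurePreserving (fun z : Y × Plane => (z.1, z.2 + a z.1)) (ν.prod volume)
      (ν.prod volume) := by
  refine MeasurePreserving.skew_product (g := fun y x => x + a y) (MeasurePreserving.id ν)
    (by fun_prop) (Filter.Eventually.of_forall fun y => ?_)
  exact (measurePreserving_add_right volume (a y)).map_eq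

theorem quasiMeasurePreserving_shift {Y : Type*} [MeasurableSpace Y] (ν : Measure Y) [SFinite ν]
    {a : Y → Plane} (ha : Measurable a) :
    Measure.QuasiMeasurePreserving (fun z : Y × Plane => z.2 + a z.1) (ν.prod volume) volume :=
  Measure.quasiMeasurePreserving_snd.comp (measurePreserving_shift ν ha).quasiMeasurePreserving

theorem lintegral_ball_shift_le (f : Plane → ℝ≥0∞) (a : Plane) (R R' : ℝ) (h : R + ‖a‖ ≤ R') :
    ∫⁻ x in Metric.closedBall 0 R, f (x + a) ≤ ∫⁻ x in Metric.closedBall 0 R', f x := by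
  rw [← lintegral_indicator Metric.isClosed_closedBall.measurableSet,
    ← lintegral_indicator Metric.isClosed_closedBall.measurableSet]
  rw [← lintegral_add_right_eq_self (μ := volume)
    (fun x => (Metric.closedBall 0 R').indicator f x) a]
  refine lintegral_mono fun x => ?_
  by_cases hx : x ∈ Metric.closedBall (0 : Plane) R
  · have : x + a ∈ Metric.closedBall (0 : Plane) R' := by
      simp only [mem_closedBall_zero_iff] at hx ⊢
      exact (norm_add_le _ _).trans (by linarith)
    simp [hx, this]
  · simp [hx]

theorem integrable_shift_of_locallyIntegrable {F : Type} [NormedAddCommGroup F]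
    {g : Plane → F} (hg : LocallyIntegrable g volume) (h : Plane) (R : ℝ) :
    Integrable (fun z : ℝ × Plane => g (z.2 + z.1 • h))
      ((volume.restrict (Icc (0 : ℝ) 1)).prod (volume.restrict (Metric.closedBall 0 R))) := by
  have hm : AEStronglyMeasurable (fun z : ℝ × Plane => g (z.2 + z.1 • h))
      ((volume.restrict (Icc (0 : ℝ) 1)).prod (volume.restrict (Metric.closedBall 0 R))) := by
    have := hg.aestronglyMeasurable.comp_quasiMeasurePreserving
      (quasiMeasurePreserving_shift (volume.restrict (Icc (0 : ℝ) 1))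
        (a := fun s : ℝ => s • h) (by fun_prop))
    refine this.mono_ac ?_
    exact Measure.AbsolutelyContinuous.prod (le_refl _).absolutelyContinuous
      Measure.restrict_le_self.absolutelyContinuous
  refine ⟨hm, ?_⟩
  rw [hasFiniteIntegral_iff_enorm, lintegral_prod _ hm.enorm]
  have hfin : ∫⁻ x in Metric.closedBall (0 : Plane) (R + ‖h‖), ‖g x‖ₑ < ⊤ :=
    (hg.integrableOn_isCompact (isCompact_closedBall _ _)).2
  have hb : ∀ s ∈ Icc (0 : ℝ) 1, ∫⁻ x in Metric.closedBall 0 R, ‖g (x + s • h)‖ₑ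
      ≤ ∫⁻ x in Metric.closedBall (0 : Plane) (R + ‖h‖), ‖g x‖ₑ := by
    intro s hs
    refine lintegral_ball_shift_le (fun x => ‖g x‖ₑ) (s • h) R _ ?_
    rw [norm_smul, Real.norm_of_nonneg hs.1]
    nlinarith [norm_nonneg h, hs.2]
  calc _ ≤ ∫⁻ s in Icc (0 : ℝ) 1, ∫⁻ x in Metric.closedBall (0 : Plane) (R + ‖h‖), ‖g x‖ₑ :=
        setLIntegral_mono' measurableSet_Icc hb
    _ = ∫⁻ x in Metric.closedBall (0 : Plane) (R + ‖h‖), ‖g x‖ₑ := by simp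
    _ < ⊤ := hfin

theorem locallyIntegrable_iff_closedBall {F : Type} [NormedAddCommGroup F] {g : Plane → F} :
    LocallyIntegrable g volume ↔ ∀ R : ℝ, IntegrableOn g (Metric.closedBall 0 R) volume := by
  refine ⟨fun h R => h.integrableOn_isCompact (isCompact_closedBall _ _), fun h => ?_⟩
  rw [locallyIntegrable_iff]
  intro k hk
  obtain ⟨R, hR⟩ := hk.isBounded.subset_closedBall (0 : Plane)
  exact (h R).mono_set hR

theorem locallyIntegrable_integral_shift {F : Type} [NormedAddCommGroup F] [NormedSpace ℝ F]
    {g : Plane → F} (hg : LocallyIntegrable g volume) (h : Plane) :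
    LocallyIntegrable (fun x => ∫ s in Icc (0 : ℝ) 1, g (x + s • h)) volume := by
  rw [locallyIntegrable_iff_closedBall]
  intro R
  exact (integrable_shift_of_locallyIntegrable hg h R).integral_prod_right

theorem tsupport_subset_closedBall {F : Type} [NormedAddCommGroup F] {φ : Plane → F}
    (hφ : HasCompactSupport φ) : ∃ R : ℝ, 0 ≤ R ∧ ∀ x, R < ‖x‖ → φ x = 0 := by
  obtain ⟨R, hR⟩ := hφ.isCompact.isBounded.subset_closedBall (0 : Plane)
  refine ⟨max R 0, le_max_right _ _, fun x hx => ?_⟩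
  by_contra hne
  have := hR (subset_tsupport _ hne)
  simp only [mem_closedBall_zero_iff] at this
  exact absurd ((le_max_left R 0).trans_lt hx) (not_lt.2 this)

/-! ### Difference quotients of weakly differentiable functions -/

section
variable {F : Type} [NormedAddCommGroup F] [NormedSpace ℝ F]

theorem HasWeakGradient.congr {v v' : Plane → F} {G G' : Plane → GradVal F}
    (H : HasWeakGradient v G) (hv : v =ᵐ[volume] v') (hG : G =ᵐ[volume] G') :
    HasWeakGradient v' G' := by
  refine ⟨H.1.congr hv, H.2.1.congr hG, fun φ hφ hc i => ?_⟩
  calc _ = ∫ x, (fderiv ℝ φ x (basisVec i)) • v x :=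
        integral_congr_ae (hv.mono fun x hx => by simp only [hx])
    _ = - ∫ x, φ x • G x i := H.2.2 φ hφ hc i
    _ = _ := congrArg Neg.neg (integral_congr_ae (hG.mono fun x hx => by simp only [hx]))

theorem locallyIntegrable_gradVal_apply {G : Plane → GradVal F}
    (hG : LocallyIntegrable G volume) (i : Fin 2) : LocallyIntegrable (fun x => G x i) volume := by
  rw [locallyIntegrable_iff_closedBall] at hG ⊢
  intro R
  exact ((PiLp.proj (𝕜 := ℝ) 2 (fun _ : Fin 2 => F) i).integrable_comp (hG R))

/-- The derivative of a vector-valued function with gradient value `A` in direction `h`. -/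
def GradVal.dir (h : Plane) (A : GradVal F) : F := ∑ i : Fin 2, h i • A i

theorem GradVal.norm_dir_le (h : Plane) (A : GradVal F) : ‖GradVal.dir h A‖ ≤ ‖h‖ * ‖A‖ := by
  have h1 : ‖GradVal.dir h A‖ ≤ ∑ i : Fin 2, ‖h i‖ * ‖A i‖ :=
    (norm_sum_le _ _).trans (le_of_eq (by simp [norm_smul]))
  refine h1.trans ?_
  rw [EuclideanSpace.norm_eq, PiLp.norm_eq_of_L2]
  exact Real.sum_mul_le_sqrt_mul_sqrt _ _ _

theorem locallyIntegrable_dir {G : Plane → GradVal F}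
    (hG : LocallyIntegrable G volume) (h : Plane) :
    LocallyIntegrable (fun x => GradVal.dir h (G x)) volume := by
  unfold GradVal.dir
  simp only [Fin.sum_univ_two]
  exact ((locallyIntegrable_gradVal_apply hG 0).smul (h 0)).add
    ((locallyIntegrable_gradVal_apply hG 1).smul (h 1))

theorem plane_eq_sum (h : Plane) : h = ∑ i : Fin 2, h i • basisVec i := by
  ext j
  fin_cases j <;> simp [basisVec]

theorem HasWeakGradient.integral_dir {v : Plane → F} {G : Plane → GradVal F}
    (H : HasWeakGradient v G) {φ : Plane → ℝ} (hφ : ContDiff ℝ ∞ φ) (hc : HasCompactSupport φ)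
    (h : Plane) : ∫ x, (fderiv ℝ φ x h) • v x = - ∫ x, φ x • GradVal.dir h (G x) := by
  have e : ∀ x, (fderiv ℝ φ x h) • v x = ∑ i : Fin 2, h i • (fderiv ℝ φ x (basisVec i)) • v x := by
    intro x
    conv_lhs => rw [plane_eq_sum h]
    simp [add_smul, mul_smul]
  have hI : ∀ i : Fin 2, Integrable (fun x => (fderiv ℝ φ x (basisVec i)) • v x) := fun i =>
    H.1.integrable_smul_left_of_hasCompactSupport
      ((hφ.continuous_fderiv (by simp)).clm_apply continuous_const)
      (hc.fderiv_apply (𝕜 := ℝ) (basisVec i))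
  have hJ : ∀ i : Fin 2, Integrable (fun x => φ x • G x i) := fun i =>
    (locallyIntegrable_gradVal_apply H.2.1 i).integrable_smul_left_of_hasCompactSupport
      hφ.continuous hc
  simp_rw [e, GradVal.dir, Finset.smul_sum]
  have hI' : ∀ i : Fin 2, Integrable
      (fun x => h i • (fderiv ℝ φ x (basisVec i)) • v x) := fun i => (hI i).smul (h i)
  have hJ' : ∀ i : Fin 2, Integrable (fun x => φ x • h i • G x i) := fun i => by
    simpa only [smul_comm (φ _) (h i)] using (hJ i).fun_smul (h i)
  rw [integral_finsetSum _ (fun i _ => hI' i),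
    integral_finsetSum _ (fun i _ => hJ' i), ← Finset.sum_neg_distrib]
  refine Finset.sum_congr rfl fun i _ => ?_
  rw [integral_smul, H.2.2 φ hφ hc i]
  simp only [smul_comm (φ _) (h i), integral_smul, smul_neg]

/-- Both sides are tested against a smooth φ. Translating moves the shift onto φ, where the
fundamental theorem of calculus applies along the segment; the definition of the weak gradient is
then used with the test function φ(· - sh) for each s, and translating back yields the right-hand
side. -/
theorem HasWeakGradient.sub_shift_eq [CompleteSpace F] {v : Plane → F} {G : Plane → GradVal F}
    (H : HasWeakGradient v G) (h : Plane) :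
    ∀ᵐ x, v (x + h) - v x = ∫ s in Icc (0 : ℝ) 1, GradVal.dir h (G (x + s • h)) := by
  have hg := locallyIntegrable_dir H.2.1 h
  have hvs : LocallyIntegrable (fun x => v (x + h)) volume := by
    rw [locallyIntegrable_iff_closedBall]
    intro R
    have h1 : IntegrableOn v (Metric.closedBall 0 (R + ‖h‖)) :=
      H.1.integrableOn_isCompact (isCompact_closedBall _ _)
    refine ⟨(H.1.aestronglyMeasurable.comp_quasiMeasurePreserving
      (measurePreserving_add_right volume h).quasiMeasurePreserving).restrict, ?_⟩
    rw [hasFiniteIntegral_iff_enorm]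
    exact (lintegral_ball_shift_le (fun x => ‖v x‖ₑ) h R _ le_rfl).trans_lt h1.2
  refine ae_eq_of_integral_contDiff_smul_eq (f := fun x => v (x + h) - v x) (hvs.sub H.1)
    (locallyIntegrable_integral_shift hg h) fun φ hφ hc => ?_
  obtain ⟨R, hR0, hR⟩ := tsupport_subset_closedBall hc
  -- left-hand side
  have hI1 : Integrable (fun x => φ x • v (x + h)) :=
    hvs.integrable_smul_left_of_hasCompactSupport hφ.continuous hc
  have hI2 : Integrable (fun x => φ x • v x) :=
    H.1.integrable_smul_left_of_hasCompactSupport hφ.continuous hc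
  have hφs : ∀ s : ℝ, ContDiff ℝ ∞ (fun x => φ (x - s • h)) := fun s => by fun_prop
  have hcs : ∀ a : Plane, HasCompactSupport (fun x => φ (x - a)) := fun a =>
    hc.comp_homeomorph (Homeomorph.subRight a)
  have hsh : ∫ x, φ x • v (x + h) = ∫ x, φ (x - h) • v x := by
    rw [← integral_add_right_eq_self (fun x => φ (x - h) • v x) h]
    simp
  have hI3 : Integrable (fun x => φ (x - h) • v x) :=
    H.1.integrable_smul_left_of_hasCompactSupport (hφ.continuous.comp (by fun_prop)) (hcs h)
  have hder : ∀ x (s : ℝ), HasDerivAt (fun s : ℝ => φ (x - s • h))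
      (- fderiv ℝ φ (x - s • h) h) s := by
    intro x s
    have h1 : HasFDerivAt φ (fderiv ℝ φ (x - s • h)) (x - s • h) :=
      (hφ.differentiable (by simp) _).hasFDerivAt
    have h2 : HasDerivAt (fun s : ℝ => x - s • h) (-h) s := by
      simpa using ((hasDerivAt_id s).smul_const h).const_sub x
    simpa [Function.comp_def] using h1.comp_hasDerivAt s h2
  have hftc : ∀ x, φ (x - h) - φ x = ∫ s in Icc (0 : ℝ) 1, - fderiv ℝ φ (x - s • h) h := by
    intro x
    rw [integral_Icc_eq_integral_Ioc, ← intervalIntegral.integral_of_le zero_le_one,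
      intervalIntegral.integral_eq_sub_of_hasDerivAt (fun s _ => hder x s)]
    · simp
    · refine Continuous.intervalIntegrable ?_ _ _
      exact (((hφ.continuous_fderiv (by simp)).comp (by fun_prop)).clm_apply
        continuous_const).neg
  have hL : ∫ x, φ x • (v (x + h) - v x)
      = ∫ x, ∫ s in Icc (0 : ℝ) 1, (- fderiv ℝ φ (x - s • h) h) • v x := by
    simp_rw [smul_sub]
    rw [integral_sub hI1 hI2, hsh, ← integral_sub hI3 hI2]
    refine integral_congr_ae (Filter.Eventually.of_forall fun x => ?_)
    simp only
    rw [← sub_smul, hftc, integral_smul_const]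
  -- For s in [0,1] all translates φ(· - sh) are supported in one ball; v restricted to that ball
  -- gives the majorant needed for Fubini.
  have hR1 : ∀ s ∈ Icc (0 : ℝ) 1, ∀ x, R + ‖h‖ < ‖x‖ → fderiv ℝ φ (x - s • h) = 0 := by
    intro s hs x hx
    have : ∀ᶠ y in 𝓝 (x - s • h), φ y = (fun _ => (0 : ℝ)) y := by
      have : R < ‖x - s • h‖ := by
        have h1 : ‖x‖ - ‖s • h‖ ≤ ‖x - s • h‖ := norm_sub_norm_le _ _
        rw [norm_smul, Real.norm_of_nonneg hs.1] at h1
        nlinarith [norm_nonneg h, hs.2]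
      filter_upwards [(isOpen_lt continuous_const continuous_norm).mem_nhds this] with y hy
      exact hR y hy
    rw [Filter.EventuallyEq.fderiv_eq this]
    simp
  obtain ⟨C, hC⟩ := (hφ.continuous_fderiv (by simp)).bounded_above_of_compact_support
    (hc.fderiv (𝕜 := ℝ))
  have hint1 : Integrable (fun z : ℝ × Plane => (- fderiv ℝ φ (z.2 - z.1 • h) h) • v z.2)
      ((volume.restrict (Icc (0 : ℝ) 1)).prod volume) := by
    have hB : IntegrableOn v (Metric.closedBall 0 (R + ‖h‖)) :=
      H.1.integrableOn_isCompact (isCompact_closedBall _ _)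
    have hB' : Integrable ((Metric.closedBall (0 : Plane) (R + ‖h‖)).indicator v) :=
      hB.integrable_indicator Metric.isClosed_closedBall.measurableSet
    have hdom : Integrable (fun z : ℝ × Plane =>
        (Metric.closedBall (0 : Plane) (R + ‖h‖)).indicator v z.2)
        ((volume.restrict (Icc (0 : ℝ) 1)).prod volume) := hB'.comp_snd _
    refine (hdom.norm.const_mul (C * ‖h‖)).mono' ?_ ?_
    · refine AEStronglyMeasurable.smul ?_ ?_
      · exact ((((hφ.continuous_fderiv (by simp)).comp (by fun_prop)).clm_apply
          continuous_const).neg).aestronglyMeasurable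
      · exact H.1.aestronglyMeasurable.comp_snd
    · have : ∀ᵐ z : ℝ × Plane ∂((volume.restrict (Icc (0 : ℝ) 1)).prod volume),
          z.1 ∈ Icc (0 : ℝ) 1 :=
        Measure.quasiMeasurePreserving_fst.ae (ae_restrict_mem measurableSet_Icc)
      filter_upwards [this] with z hz
      rw [norm_smul, norm_neg]
      by_cases hx : z.2 ∈ Metric.closedBall (0 : Plane) (R + ‖h‖)
      · rw [indicator_of_mem hx]
        gcongr
        exact ((fderiv ℝ φ _).le_opNorm h).trans (by gcongr; exact hC _)
      · rw [hR1 z.1 hz z.2 (by simpa using hx)]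
        simp only [zero_apply, norm_zero, zero_mul]
        have : 0 ≤ C := (norm_nonneg _).trans (hC 0)
        positivity
  have hint2 : Integrable (fun z : ℝ × Plane => φ z.2 • GradVal.dir h (G (z.2 + z.1 • h)))
      ((volume.restrict (Icc (0 : ℝ) 1)).prod volume) := by
    obtain ⟨C', hC'⟩ := hφ.continuous.bounded_above_of_compact_support hc
    have h1 := (integrable_shift_of_locallyIntegrable hg h R)
    have h2 : Integrable ((Icc (0 : ℝ) 1 ×ˢ Metric.closedBall (0 : Plane) R).indicator
        (fun z : ℝ × Plane => GradVal.dir h (G (z.2 + z.1 • h)))) (volume.prod volume) := by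
      rw [integrable_indicator_iff
        (measurableSet_Icc.prod Metric.isClosed_closedBall.measurableSet),
        IntegrableOn, ← Measure.prod_restrict]
      exact h1
    have h3 := (h2.mono_measure (Measure.restrict_le_self (s := Icc (0 : ℝ) 1 ×ˢ univ)))
    rw [← Measure.prod_restrict, Measure.restrict_univ] at h3
    have h4 := Integrable.bdd_smul (φ := fun z : ℝ × Plane => φ z.2) h3 C'
      (hφ.continuous.comp continuous_snd).aestronglyMeasurable
      (Filter.Eventually.of_forall fun z => hC' z.2)
    refine h4.congr ?_
    have : ∀ᵐ z : ℝ × Plane ∂((volume.restrict (Icc (0 : ℝ) 1)).prod volume),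
          z.1 ∈ Icc (0 : ℝ) 1 :=
        Measure.quasiMeasurePreserving_fst.ae (ae_restrict_mem measurableSet_Icc)
    filter_upwards [this] with z hz
    by_cases hx : z.2 ∈ Metric.closedBall (0 : Plane) R
    · have : z ∈ Icc (0 : ℝ) 1 ×ˢ Metric.closedBall (0 : Plane) R := ⟨hz, hx⟩
      rw [Pi.smul_apply', indicator_of_mem this]
    · have : φ z.2 = 0 := hR _ (by simpa using hx)
      simp [this]
  -- After Fubini on both sides it suffices to compare the integrands at each s.
  rw [hL, integral_integral_swap (f := fun (x : Plane) (s : ℝ) => (- fderiv ℝ φ (x - s • h) h) • v x)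
    hint1.swap]
  simp_rw [← integral_smul]
  rw [integral_integral_swap (f := fun (x : Plane) (s : ℝ) => φ x • GradVal.dir h (G (x + s • h)))
    hint2.swap]
  refine setIntegral_congr_fun measurableSet_Icc fun s _ => ?_
  simp only [neg_smul, integral_neg]
  have e1 : ∀ x, fderiv ℝ φ (x - s • h) h = fderiv ℝ (fun y => φ (y - s • h)) x h := by
    intro x
    simp [sub_eq_add_neg, fderiv_comp_add_right]
  simp_rw [e1]
  rw [H.integral_dir (hφs s) (hcs _) h, neg_neg,
    ← integral_add_right_eq_self (fun x => φ (x - s • h) • GradVal.dir h (G x)) (s • h)]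
  simp

theorem HasWeakGradient.enorm_sub_shift_le [CompleteSpace F] {v : Plane → F}
    {G : Plane → GradVal F} (H : HasWeakGradient v G) (h : Plane) :
    ∀ᵐ x, ‖v (x + h) - v x‖ₑ ≤ ‖h‖ₑ * ∫⁻ s in Icc (0 : ℝ) 1, ‖G (x + s • h)‖ₑ := by
  filter_upwards [H.sub_shift_eq h] with x hx
  rw [hx]
  refine (enorm_integral_le_lintegral_enorm _).trans ?_
  rw [← lintegral_const_mul' _ _ enorm_ne_top]
  refine lintegral_mono fun s => ?_
  rw [← enorm_norm h, ← enorm_norm (G _), ← enorm_mul]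
  exact enorm_le_iff_norm_le.2 ((GradVal.norm_dir_le _ _).trans (le_abs_self _))

end

/-! ### Averaging operators -/

theorem sq_lintegral_mul_le {α : Type*} [MeasurableSpace α] {μ : Measure α} {f g : α → ℝ≥0∞}
    (hf : AEMeasurable f μ) (hg : AEMeasurable g μ) :
    (∫⁻ a, f a * g a ∂μ) ^ 2 ≤ (∫⁻ a, f a ^ 2 ∂μ) * ∫⁻ a, g a ^ 2 ∂μ := by
  have h := ENNReal.lintegral_mul_le_Lp_mul_Lq μ Real.HolderConjugate.two_two hf hg
  simp only [Pi.mul_apply, ENNReal.rpow_ofNat] at h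
  calc _ ≤ ((∫⁻ a, f a ^ 2 ∂μ) ^ (1 / 2 : ℝ) * (∫⁻ a, g a ^ 2 ∂μ) ^ (1 / 2 : ℝ)) ^ 2 := by gcongr
    _ = _ := by
      rw [mul_pow, ← ENNReal.rpow_natCast, ← ENNReal.rpow_natCast, ← ENNReal.rpow_mul,
        ← ENNReal.rpow_mul]
      norm_num

theorem sq_lintegral_le {α : Type*} [MeasurableSpace α] {μ : Measure α} {f : α → ℝ≥0∞}
    (hf : AEMeasurable f μ) : (∫⁻ a, f a ∂μ) ^ 2 ≤ μ univ * ∫⁻ a, f a ^ 2 ∂μ := by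
  simpa using sq_lintegral_mul_le (f := fun _ => (1 : ℝ≥0∞)) aemeasurable_const hf

theorem eLpNorm_two_sq {α E : Type*} [MeasurableSpace α] [NormedAddCommGroup E] {μ : Measure α}
    (f : α → E) : eLpNorm f 2 μ ^ 2 = ∫⁻ a, ‖f a‖ₑ ^ 2 ∂μ := by
  rw [eLpNorm_eq_lintegral_rpow_enorm_toReal (by simp) (by simp), ← ENNReal.rpow_natCast,
    ← ENNReal.rpow_mul]
  norm_num

section
variable {F : Type} [NormedAddCommGroup F]

/-- The integral of `‖G‖` over the rescaled ball: `∫_{|h| < r} ‖G (x + s h)‖ dh`. -/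
noncomputable def avgOp (r s : ℝ) (G : Plane → F) (x : Plane) : ℝ≥0∞ :=
  ∫⁻ h in Metric.ball (0 : Plane) r, ‖G (x + s • h)‖ₑ

theorem measurable_avgOp {G : Plane → F} (hG : StronglyMeasurable G) (r : ℝ) :
    Measurable (fun z : ℝ × Plane => avgOp r z.1 G z.2) := by
  refine Measurable.lintegral_prod_right' (f := fun w : (ℝ × Plane) × Plane =>
    ‖G (w.1.2 + w.1.1 • w.2)‖ₑ) ?_
  exact (hG.comp_measurable (by fun_prop)).enorm

/-- Dilation by s in dimension two divides Lebesgue measure by s², whence the factor s^(-2/q). -/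
theorem eLpNorm_comp_add_smul {G : Plane → F} (hG : StronglyMeasurable G) {s : ℝ} (hs : 0 < s)
    (q : ℝ≥0∞) (x : Plane) : eLpNorm (fun h => G (x + s • h)) q volume
      = ENNReal.ofReal (s ^ 2)⁻¹ ^ (1 / q).toReal * eLpNorm G q volume := by
  have hm : Measure.map (fun h : Plane => x + s • h) volume
      = ENNReal.ofReal (s ^ 2)⁻¹ • (volume : Measure Plane) := by
    rw [show (fun h : Plane => x + s • h) = (fun y => x + y) ∘ (fun h => s • h) from rfl,
      ← Measure.map_map (by fun_prop) (by fun_prop), Measure.map_addHaar_smul _ hs.ne',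
      Measure.map_smul, map_add_left_eq_self]
    simp
  have := eLpNorm_map_measure (f := fun h : Plane => x + s • h) (g := G) (p := q)
    (μ := volume) hG.aestronglyMeasurable (by fun_prop)
  rw [show (fun h => G (x + s • h)) = G ∘ (fun h : Plane => x + s • h) from rfl, ← this, hm,
    eLpNorm_smul_measure_of_ne_zero (by simp; positivity), smul_eq_mul]

/-- Hölder's inequality on the ball, then the scaling of the L^q norm. -/
theorem avgOp_le_eLpNorm {G : Plane → F} (hG : StronglyMeasurable G) (r : ℝ) {s : ℝ} (hs : 0 < s)
    {q : ℝ≥0∞} (hq : 1 ≤ q) (x : Plane) :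
    avgOp r s G x ≤ ENNReal.ofReal (s ^ 2)⁻¹ ^ (1 / q).toReal * eLpNorm G q volume
      * volume (Metric.ball (0 : Plane) r) ^ (1 - (1 / q).toReal) := by
  rw [avgOp, ← eLpNorm_one_eq_lintegral_enorm]
  refine (eLpNorm_le_eLpNorm_mul_rpow_measure_univ hq
    (hG.comp_measurable (by fun_prop)).aestronglyMeasurable).trans ?_
  rw [← eLpNorm_comp_add_smul hG hs q x]
  simp only [ENNReal.toReal_one, div_one, Measure.restrict_apply_univ, one_div, ENNReal.toReal_inv]
  gcongr
  exact eLpNorm_mono_measure _ Measure.restrict_le_self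

/-- Cauchy–Schwarz in h, then Tonelli: for fixed h the shift by sh preserves the L² norm, so the
bound is uniform in s. -/
theorem lintegral_avgOp_sq_le {G : Plane → F} (hG : StronglyMeasurable G) (r s : ℝ) :
    ∫⁻ x, avgOp r s G x ^ 2
      ≤ volume (Metric.ball (0 : Plane) r) ^ 2 * eLpNorm G 2 volume ^ 2 := by
  have h1 : ∀ x, avgOp r s G x ^ 2 ≤ volume (Metric.ball (0 : Plane) r)
      * ∫⁻ h in Metric.ball (0 : Plane) r, ‖G (x + s • h)‖ₑ ^ 2 := by
    intro x
    refine (sq_lintegral_le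
      (hG.comp_measurable (by fun_prop)).enorm.aemeasurable).trans ?_
    simp
  refine (lintegral_mono h1).trans ?_
  rw [lintegral_const_mul' _ _ measure_ball_lt_top.ne, pow_two, mul_assoc]
  gcongr
  rw [lintegral_lintegral_swap]
  · have : ∀ h : Plane, ∫⁻ x, ‖G (x + s • h)‖ₑ ^ 2 = eLpNorm G 2 volume ^ 2 := by
      intro h
      rw [eLpNorm_two_sq]
      exact lintegral_add_right_eq_self (fun x => ‖G x‖ₑ ^ 2) (s • h)
    simp [this, mul_comm]
  · exact ((hG.comp_measurable (by fun_prop)).enorm.pow_const 2).aemeasurable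

/-- Interpolation between L^∞ and L²: in avgOp^p = avgOp^(p-2) · avgOp² the first factor is bounded
by Hölder, at the price of s^(-1) per power, and the second is integrated uniformly in s. -/
theorem lintegral_avgOp_rpow_le {G : Plane → F} (hG : StronglyMeasurable G) (r : ℝ) {s : ℝ}
    (hs : 0 < s) {p : ℝ} (hp : 2 ≤ p) (hN : eLpNorm G 2 volume ≠ ⊤) :
    ∫⁻ x, avgOp r s G x ^ p ≤ ENNReal.ofReal (s ^ (2 - p))
      * (volume (Metric.ball (0 : Plane) r) ^ (1 / 2 + 1 / p) * eLpNorm G 2 volume) ^ p := by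
  set B := volume (Metric.ball (0 : Plane) r) with hB
  set N := eLpNorm G 2 volume with hNdef
  have hBt : B ≠ ⊤ := measure_ball_lt_top.ne
  have hA : ∀ x, avgOp r s G x ≤ ENNReal.ofReal s⁻¹ * N * B ^ (1 / 2 : ℝ) := by
    intro x
    have := avgOp_le_eLpNorm hG r hs (q := 2) (by norm_num) x
    have e : (1 / (2 : ℝ≥0∞)).toReal = 1 / 2 := by simp
    rw [e, ENNReal.ofReal_rpow_of_nonneg (by positivity) (by norm_num), Real.inv_rpow (by positivity),
      ← Real.sqrt_eq_rpow, Real.sqrt_sq hs.le] at this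
    rwa [show (1 : ℝ) - 1 / 2 = 1 / 2 by norm_num] at this
  have hpt : ∀ x, avgOp r s G x ^ p
      ≤ (ENNReal.ofReal s⁻¹ * N * B ^ (1 / 2 : ℝ)) ^ (p - 2) * avgOp r s G x ^ 2 := by
    intro x
    calc avgOp r s G x ^ p = avgOp r s G x ^ (p - 2) * avgOp r s G x ^ (2 : ℝ) := by
          rw [← ENNReal.rpow_add_of_nonneg _ _ (by linarith) (by norm_num)]; simp
      _ ≤ _ := by
          rw [ENNReal.rpow_ofNat]
          gcongr
          exact hA x
  have hC : (ENNReal.ofReal s⁻¹ * N * B ^ (1 / 2 : ℝ)) ^ (p - 2) ≠ ⊤ := by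
    refine ENNReal.rpow_ne_top_of_nonneg (by linarith) ?_
    exact ENNReal.mul_ne_top (ENNReal.mul_ne_top (by simp) hN)
      (ENNReal.rpow_ne_top_of_nonneg (by norm_num) hBt)
  calc ∫⁻ x, avgOp r s G x ^ p
      ≤ ∫⁻ x, (ENNReal.ofReal s⁻¹ * N * B ^ (1 / 2 : ℝ)) ^ (p - 2) * avgOp r s G x ^ 2 :=
        lintegral_mono hpt
    _ = (ENNReal.ofReal s⁻¹ * N * B ^ (1 / 2 : ℝ)) ^ (p - 2) * ∫⁻ x, avgOp r s G x ^ 2 :=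
        lintegral_const_mul' _ _ hC
    _ ≤ (ENNReal.ofReal s⁻¹ * N * B ^ (1 / 2 : ℝ)) ^ (p - 2) * (B ^ 2 * N ^ 2) := by
        gcongr
        exact lintegral_avgOp_sq_le hG r s
    _ = _ := by
        rw [ENNReal.mul_rpow_of_nonneg _ _ (by linarith), ENNReal.mul_rpow_of_nonneg _ _ (by linarith),
          ENNReal.mul_rpow_of_nonneg _ _ (by linarith), ← ENNReal.rpow_mul, ← ENNReal.rpow_mul,
          ENNReal.ofReal_rpow_of_nonneg (by positivity) (by linarith)]
        have e1 : N ^ p = N ^ (p - 2) * N ^ 2 := by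
          rw [← ENNReal.rpow_ofNat, ← ENNReal.rpow_add_of_nonneg _ _ (by linarith) (by norm_num)]
          simp
        have e2 : B ^ ((1 / 2 + 1 / p) * p) = B ^ (1 / 2 * (p - 2)) * B ^ 2 := by
          rw [← ENNReal.rpow_ofNat, ← ENNReal.rpow_add_of_nonneg _ _ (by linarith) (by norm_num)]
          congr 1
          field_simp
          ring
        have e3 : s⁻¹ ^ (p - 2) = s ^ (2 - p) := by
          rw [Real.inv_rpow hs.le, ← Real.rpow_neg hs.le]; ring_nf
        rw [e1, e2, e3]
        ring

/-- `∫₀¹ ∫_{|h| < r} ‖G (x + s h)‖ dh ds`. -/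
noncomputable def segOp (r : ℝ) (G : Plane → F) (x : Plane) : ℝ≥0∞ :=
  ∫⁻ s in Icc (0 : ℝ) 1, avgOp r s G x

theorem measurable_segOp {G : Plane → F} (hG : StronglyMeasurable G) (r : ℝ) :
    Measurable (segOp r G) :=
  ((measurable_avgOp hG r).comp measurable_swap).lintegral_prod_right'

theorem lintegral_rpow_Icc {a : ℝ} (ha : -1 < a) :
    ∫⁻ s in Icc (0 : ℝ) 1, ENNReal.ofReal (s ^ a) = ENNReal.ofReal (1 / (a + 1)) := by
  rw [← ofReal_integral_eq_lintegral_ofReal]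
  · rw [integral_Icc_eq_integral_Ioc, ← intervalIntegral.integral_of_le zero_le_one,
      integral_rpow (Or.inl ha)]
    rw [Real.one_rpow, Real.zero_rpow (by linarith)]
    simp
  · have := intervalIntegral.intervalIntegrable_rpow' (a := 0) (b := 1) ha
    rw [intervalIntegrable_iff_integrableOn_Icc_of_le zero_le_one] at this
    exact this
  · filter_upwards [ae_restrict_mem measurableSet_Icc] with s hs
    exact Real.rpow_nonneg hs.1 _

theorem ae_restrict_Icc_pos : ∀ᵐ s ∂(volume.restrict (Icc (0 : ℝ) 1)), 0 < s := by
  have h1 : ∀ᵐ s ∂(volume.restrict (Icc (0 : ℝ) 1)), s ≠ 0 :=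
    ae_restrict_of_ae (Measure.ae_ne volume 0)
  filter_upwards [ae_restrict_mem measurableSet_Icc, h1] with s hs h0
  exact lt_of_le_of_ne hs.1 (Ne.symm h0)

/-- The sup bound at parameter s costs s^(-2/q), which is integrable on (0,1) exactly because q > 2;
its integral is the constant 1/(1 - 2/q). -/
theorem segOp_le_eLpNorm {G : Plane → F} (hG : StronglyMeasurable G) (r : ℝ)
    {q : ℝ≥0∞} (hq : 2 < q) (x : Plane) :
    segOp r G x ≤ ENNReal.ofReal (1 / (1 - 2 * q⁻¹.toReal)) * eLpNorm G q volume
      * volume (Metric.ball (0 : Plane) r) ^ (1 - q⁻¹.toReal) := by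
  have hq1 : q⁻¹.toReal < 1 / 2 := by
    have : q⁻¹ < 2⁻¹ := ENNReal.inv_lt_inv.2 hq
    have h2 := (ENNReal.toReal_lt_toReal this.ne_top (by simp)).2 this
    simpa using h2
  have hpt : ∀ᵐ s ∂(volume.restrict (Icc (0 : ℝ) 1)), avgOp r s G x
      ≤ ENNReal.ofReal (s ^ (-(2 * q⁻¹.toReal))) * (eLpNorm G q volume
      * volume (Metric.ball (0 : Plane) r) ^ (1 - q⁻¹.toReal)) := by
    filter_upwards [ae_restrict_Icc_pos] with s hs
    have := avgOp_le_eLpNorm hG r hs ((by norm_num : (1 : ℝ≥0∞) ≤ 2).trans hq.le) x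
    rw [one_div, ENNReal.ofReal_rpow_of_nonneg (by positivity) ENNReal.toReal_nonneg,
      mul_assoc] at this
    convert this using 3
    rw [Real.inv_rpow (by positivity), ← Real.rpow_natCast, ← Real.rpow_mul hs.le,
      ← Real.rpow_neg hs.le]
    norm_num
  refine (lintegral_mono_ae hpt).trans ?_
  rw [lintegral_mul_const]
  · rw [lintegral_rpow_Icc (by linarith), mul_assoc]
    ring_nf
    rfl
  · fun_prop

/-- The L^p norm of `avgOp r s G` grows like s^(-(1-2/p)), an integrable power. Weighted Hölder in s
followed by Tonelli takes the place of Minkowski's integral inequality. -/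
theorem lintegral_segOp_rpow_le {G : Plane → F} (hG : StronglyMeasurable G) (r : ℝ)
    {p : ℝ} (hp : 2 ≤ p) (hN : eLpNorm G 2 volume ≠ ⊤) :
    (∫⁻ x, segOp r G x ^ p) ^ (1 / p) ≤ ENNReal.ofReal (p - 1) ^ (1 - 1 / p) *
      (volume (Metric.ball (0 : Plane) r) ^ (1 / 2 + 1 / p) * eLpNorm G 2 volume) := by
  set D := volume (Metric.ball (0 : Plane) r) ^ (1 / 2 + 1 / p) * eLpNorm G 2 volume with hD
  have hp0 : 0 < p := by linarith
  set p' := p / (p - 1) with hp'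
  have hconj : p'.HolderConjugate p := (Real.HolderConjugate.conjExponent (by linarith)).symm
  -- With this exponent s^(αp) = s^(p-2) cancels the factor s^(2-p) of `lintegral_avgOp_rpow_le`,
  -- while αp' = (p-2)/(p-1) < 1 keeps s^(-αp') integrable, with integral p - 1.
  set α := 1 - 2 / p with hα
  have hαp : α * p = p - 2 := by rw [hα]; field_simp
  have hαp' : α * p' = (p - 2) / (p - 1) := by
    rw [hα, hp']; field_simp
  have hm : ∀ x, Measurable fun s : ℝ => avgOp r s G x := fun x =>
    (measurable_avgOp hG r).comp measurable_prodMk_right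
  have hpt : ∀ x, segOp r G x ^ p ≤ ENNReal.ofReal (p - 1) ^ (p / p')
      * ∫⁻ s in Icc (0 : ℝ) 1, ENNReal.ofReal (s ^ (p - 2)) * avgOp r s G x ^ p := by
    intro x
    have h1 : segOp r G x ≤ ∫⁻ s in Icc (0 : ℝ) 1, ((fun s => ENNReal.ofReal (s ^ (-α)))
        * (fun s => ENNReal.ofReal (s ^ α) * avgOp r s G x)) s := by
      refine lintegral_mono_ae ?_
      filter_upwards [ae_restrict_Icc_pos] with s hs
      simp only [Pi.mul_apply]
      rw [← mul_assoc, ← ENNReal.ofReal_mul (by positivity), ← Real.rpow_add hs]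
      simp
    have h2 := h1.trans (ENNReal.lintegral_mul_le_Lp_mul_Lq _ hconj
      (f := fun s => ENNReal.ofReal (s ^ (-α)))
      (g := fun s => ENNReal.ofReal (s ^ α) * avgOp r s G x) (by fun_prop)
      (Measurable.mul (by fun_prop) (hm x)).aemeasurable)
    have e1 : ∫⁻ s in Icc (0 : ℝ) 1, ENNReal.ofReal (s ^ (-α)) ^ p' = ENNReal.ofReal (p - 1) := by
      have : ∀ s ∈ Icc (0 : ℝ) 1, ENNReal.ofReal (s ^ (-α)) ^ p' = ENNReal.ofReal (s ^ (-(α * p'))) := by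
        intro s hs
        rw [ENNReal.ofReal_rpow_of_nonneg (Real.rpow_nonneg hs.1 _) hconj.pos.le,
          ← Real.rpow_mul hs.1]
        ring_nf
      have hlt : α * p' < 1 := by
        rw [hαp', div_lt_one (by linarith)]; linarith
      rw [setLIntegral_congr_fun measurableSet_Icc this, lintegral_rpow_Icc (by linarith), hαp']
      congr 1
      have : p - 1 ≠ 0 := by linarith
      have h3 : -((p - 2) / (p - 1)) + 1 = 1 / (p - 1) := by field_simp; ring
      rw [h3]; simp
    have e2 : ∫⁻ s in Icc (0 : ℝ) 1, (ENNReal.ofReal (s ^ α) * avgOp r s G x) ^ p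
        = ∫⁻ s in Icc (0 : ℝ) 1, ENNReal.ofReal (s ^ (p - 2)) * avgOp r s G x ^ p := by
      refine setLIntegral_congr_fun measurableSet_Icc fun s hs => ?_
      rw [ENNReal.mul_rpow_of_nonneg _ _ hp0.le,
        ENNReal.ofReal_rpow_of_nonneg (Real.rpow_nonneg hs.1 _) hp0.le, ← Real.rpow_mul hs.1, hαp]
    rw [e1, e2] at h2
    calc segOp r G x ^ p ≤ _ := ENNReal.rpow_le_rpow h2 hp0.le
      _ = _ := by
        rw [ENNReal.mul_rpow_of_nonneg _ _ hp0.le, ← ENNReal.rpow_mul, ← ENNReal.rpow_mul,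
          one_div_mul_cancel hp0.ne', ENNReal.rpow_one]
        congr 2
        ring
  have hc : ENNReal.ofReal (p - 1) ^ (p / p') ≠ ⊤ :=
    ENNReal.rpow_ne_top_of_nonneg (div_nonneg hp0.le hconj.pos.le) (by simp)
  have hsum : ∫⁻ x, segOp r G x ^ p ≤ ENNReal.ofReal (p - 1) ^ (p / p') * D ^ p := by
    refine (lintegral_mono hpt).trans ?_
    rw [lintegral_const_mul' _ _ hc]
    gcongr
    rw [lintegral_lintegral_swap]
    · calc _ ≤ ∫⁻ s in Icc (0 : ℝ) 1, D ^ p := by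
            refine lintegral_mono_ae ?_
            filter_upwards [ae_restrict_Icc_pos] with s hs
            rw [lintegral_const_mul' _ _ (by simp)]
            calc _ ≤ ENNReal.ofReal (s ^ (p - 2)) * (ENNReal.ofReal (s ^ (2 - p)) * D ^ p) := by
                  gcongr
                  exact lintegral_avgOp_rpow_le hG r hs hp hN
              _ = D ^ p := by
                  rw [← mul_assoc, ← ENNReal.ofReal_mul (by positivity), ← Real.rpow_add hs]
                  simp
        _ = D ^ p := by simp
    · refine Measurable.aemeasurable ?_
      refine Measurable.mul ?_ (((measurable_avgOp hG r).comp measurable_swap).pow_const p)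
      fun_prop
  calc _ ≤ (ENNReal.ofReal (p - 1) ^ (p / p') * D ^ p) ^ (1 / p) := by gcongr
    _ = _ := by
      rw [ENNReal.mul_rpow_of_nonneg _ _ (by positivity), ← ENNReal.rpow_mul, ← ENNReal.rpow_mul,
        mul_one_div_cancel hp0.ne', ENNReal.rpow_one]
      congr 2
      rw [hp']
      field_simp

end

/-! ### Integrated bounds for differences under translation -/

section
variable {F : Type} [NormedAddCommGroup F] [NormedSpace ℝ F] [CompleteSpace F]

theorem HasWeakGradient.lintegral_sub_shift_sq_le {v : Plane → F} {G : Plane → GradVal F}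
    (H : HasWeakGradient v G) (hG : StronglyMeasurable G) (h : Plane) :
    ∫⁻ x, ‖v (x + h) - v x‖ₑ ^ 2 ≤ ‖h‖ₑ ^ 2 * ∫⁻ x, ‖G x‖ₑ ^ 2 := by
  calc _ ≤ ∫⁻ x, ‖h‖ₑ ^ 2 * ∫⁻ s in Icc (0 : ℝ) 1, ‖G (x + s • h)‖ₑ ^ 2 := by
        refine lintegral_mono_ae ?_
        filter_upwards [H.enorm_sub_shift_le h] with x hx
        calc _ ≤ (‖h‖ₑ * ∫⁻ s in Icc (0 : ℝ) 1, ‖G (x + s • h)‖ₑ) ^ 2 := by gcongr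
          _ ≤ _ := by
            rw [mul_pow]
            gcongr
            refine (sq_lintegral_le
              (hG.comp_measurable (by fun_prop)).enorm.aemeasurable).trans ?_
            simp
    _ = ‖h‖ₑ ^ 2 * ∫⁻ s in Icc (0 : ℝ) 1, ∫⁻ x, ‖G (x + s • h)‖ₑ ^ 2 := by
        rw [lintegral_const_mul' _ _ (by simp), lintegral_lintegral_swap]
        exact ((hG.comp_measurable (by fun_prop)).enorm.pow_const 2).aemeasurable
    _ = _ := by
        have : ∀ s : ℝ, ∫⁻ x, ‖G (x + s • h)‖ₑ ^ 2 = ∫⁻ x, ‖G x‖ₑ ^ 2 := fun s =>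
          lintegral_add_right_eq_self (fun x => ‖G x‖ₑ ^ 2) (s • h)
        simp [this]

theorem HasWeakGradient.lintegral_ball_sub_le {v : Plane → F} {G : Plane → GradVal F}
    (H : HasWeakGradient v G) (hv : StronglyMeasurable v) (hG : StronglyMeasurable G) (r : ℝ) :
    ∀ᵐ x, ∫⁻ h in Metric.ball (0 : Plane) r, ‖v (x + h) - v x‖ₑ
      ≤ ENNReal.ofReal r * segOp r G x := by
  have hm : MeasurableSet {z : Plane × Plane | ‖v (z.2 + z.1) - v z.2‖ₑ
      ≤ ‖z.1‖ₑ * ∫⁻ s in Icc (0 : ℝ) 1, ‖G (z.2 + s • z.1)‖ₑ} := by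
    refine measurableSet_le ?_ ?_
    · exact ((hv.comp_measurable (by fun_prop)).sub (hv.comp_measurable (by fun_prop))).enorm
    · refine Measurable.mul (by fun_prop) ?_
      refine Measurable.lintegral_prod_right' (f := fun w : (Plane × Plane) × ℝ =>
        ‖G (w.1.2 + w.2 • w.1.1)‖ₑ) ?_
      exact (hG.comp_measurable (by fun_prop)).enorm
  -- The segment bound holds for each h off a null set of x depending on h. Joint measurability lets
  -- the quantifiers be exchanged, so that for almost every x it can be integrated in h.
  have h1 := (Measure.ae_ae_comm (μ := volume) (ν := volume)
    (p := fun h x : Plane => ‖v (x + h) - v x‖ₑ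
      ≤ ‖h‖ₑ * ∫⁻ s in Icc (0 : ℝ) 1, ‖G (x + s • h)‖ₑ) hm).1
    (Filter.Eventually.of_forall fun h => H.enorm_sub_shift_le h)
  filter_upwards [h1] with x hx
  calc _ ≤ ∫⁻ h in Metric.ball (0 : Plane) r,
          ENNReal.ofReal r * ∫⁻ s in Icc (0 : ℝ) 1, ‖G (x + s • h)‖ₑ := by
        refine lintegral_mono_ae ?_
        filter_upwards [ae_restrict_of_ae hx, ae_restrict_mem Metric.isOpen_ball.measurableSet]
          with h hh hb
        refine hh.trans ?_
        gcongr
        rw [← ofReal_norm]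
        exact ENNReal.ofReal_le_ofReal (mem_ball_zero_iff.1 hb).le
    _ = _ := by
        rw [lintegral_const_mul' _ _ (by simp), lintegral_lintegral_swap]
        · rfl
        · exact ((hG.comp_measurable (by fun_prop)).enorm).aemeasurable
end

/-! ### Measure density of Lipschitz domains -/

theorem ofReal_sq_le_volume_ball (z : Plane) {s : ℝ} (hs : 0 ≤ s) :
    ENNReal.ofReal (s ^ 2) ≤ volume (Metric.ball z s) := by
  rw [EuclideanSpace.volume_ball_fin_two, ENNReal.ofReal_pow hs]
  refine le_mul_of_one_le_right zero_le ?_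
  rw [ENNReal.one_le_ofReal]
  linarith [Real.pi_gt_three]

theorem volume_ball_le (z : Plane) {s : ℝ} (hs : 0 ≤ s) :
    volume (Metric.ball z s) ≤ ENNReal.ofReal (4 * s ^ 2) := by
  rw [EuclideanSpace.volume_ball_fin_two, ENNReal.ofReal_mul (by norm_num), ENNReal.ofReal_pow hs,
    mul_comm]
  gcongr
  exact Real.pi_le_four

theorem dist_coord_le (a b : Plane) (i : Fin 2) : |a i - b i| ≤ dist a b := by
  have := EuclideanSpace.dist_eq a b
  rw [this]
  refine Real.abs_le_sqrt ?_
  have h := Finset.single_le_sum (f := fun j => dist (a j) (b j) ^ 2)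
    (fun j _ => sq_nonneg _) (Finset.mem_univ i)
  simpa [Real.dist_eq, sq_abs] using h

/-- An interior cone argument. From x' in D move up by s/2 in the graph direction to z. Within
distance κs of z the height drops by at most κs and the graph rises by at most Kκs above its value
at x'; since κ(1+K) = 1/4 < 1/2, the ball of radius κs about z stays above the graph. The
restriction to radius r/2 keeps everything inside the coordinate ball. -/
theorem measure_density_graph {D : Set Plane} {x : Plane} {e : Plane ≃ₗᵢ[ℝ] Plane} {γ : ℝ → ℝ}
    {K : ℝ≥0} {r : ℝ} (hγ : LipschitzWith K γ)
    (h : ∀ y ∈ Metric.ball x r, (y ∈ D ↔ γ (e y 0) < e y 1)) :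
    ∀ x' ∈ Metric.ball x (r / 2) ∩ D, ∀ s, 0 < s → s ≤ r / 2 →
      ENNReal.ofReal ((1 / (4 * (1 + K))) ^ 2 * s ^ 2) ≤ volume (D ∩ Metric.ball x' s) := by
  intro x' hx' s hs hsr
  have hK : (0 : ℝ) ≤ K := K.2
  set κ : ℝ := 1 / (4 * (1 + K)) with hκ
  have hκ0 : 0 < κ := by positivity
  have hκK : κ * (1 + K) = 1 / 4 := by rw [hκ]; field_simp
  have hκ1 : κ ≤ 1 / 4 := by nlinarith
  set z : Plane := x' + e.symm (EuclideanSpace.single 1 (s / 2)) with hz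
  have hzx : dist z x' = s / 2 := by
    rw [hz, dist_self_add_left, LinearIsometryEquiv.norm_map]
    simp [abs_of_pos hs]
  have hez : e z = e x' + EuclideanSpace.single 1 (s / 2) := by simp [hz]
  rw [← mul_pow]
  refine (ofReal_sq_le_volume_ball z (by positivity)).trans (measure_mono fun y hy => ?_)
  have hyz : dist y z < κ * s := hy
  have hyx' : dist y x' < s := by
    have := dist_triangle y z x'
    nlinarith
  have hyx : y ∈ Metric.ball x r := by
    have := dist_triangle y x' x
    have h2 : dist x' x < r / 2 := hx'.1
    rw [Metric.mem_ball]
    linarith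
  have hx'x : x' ∈ Metric.ball x r := by
    have h2 : dist x' x < r / 2 := hx'.1
    rw [Metric.mem_ball]
    linarith [dist_nonneg (x := x') (y := x)]
  refine ⟨(h y hyx).2 ?_, hyx'⟩
  have hx'D := (h x' hx'x).1 hx'.2
  have hd : dist (e y) (e z) < κ * s := by rwa [LinearIsometryEquiv.dist_map]
  have h0 := (dist_coord_le (e y) (e z) 0).trans hd.le
  have h1 := (dist_coord_le (e y) (e z) 1).trans hd.le
  rw [hez] at h0 h1
  simp at h0 h1
  have hL := hγ.dist_le_mul (e y 0) (e x' 0)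
  rw [Real.dist_eq, Real.dist_eq] at hL
  have h4 := (abs_le.1 (hL.trans (mul_le_mul_of_nonneg_left h0 hK))).2
  have h5 := (abs_le.1 h1).1
  nlinarith

theorem IsBoundedLipschitzDomain.measure_density {D : Set Plane}
    (hD : IsBoundedLipschitzDomain D) : ∃ c s₀ : ℝ, 0 < c ∧ 0 < s₀ ∧ ∀ x ∈ D, ∀ s, 0 < s →
      s ≤ s₀ → ENNReal.ofReal (c * s ^ 2) ≤ volume (D ∩ Metric.ball x s) := by
  obtain ⟨hopen, hbdd, hfr⟩ := hD
  suffices H : ∃ c s₀ : ℝ, 0 < c ∧ 0 < s₀ ∧ ∀ x ∈ closure D ∩ D, ∀ s, 0 < s →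
      s ≤ s₀ → ENNReal.ofReal (c * s ^ 2) ≤ volume (D ∩ Metric.ball x s) by
    obtain ⟨c, s₀, hc, hs, H⟩ := H
    exact ⟨c, s₀, hc, hs, fun x hx => H x ⟨subset_closure hx, hx⟩⟩
  -- Compactness of the closure makes c and s₀ uniform: they are produced near each point and
  -- replaced by minima under finite unions.
  refine hbdd.isCompact_closure.induction_on
    (p := fun A => ∃ c s₀ : ℝ, 0 < c ∧ 0 < s₀ ∧ ∀ x ∈ A ∩ D, ∀ s, 0 < s →
      s ≤ s₀ → ENNReal.ofReal (c * s ^ 2) ≤ volume (D ∩ Metric.ball x s)) ?_ ?_ ?_ ?_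
  · exact ⟨1, 1, one_pos, one_pos, by simp⟩
  · rintro A B hAB ⟨c, s₀, hc, hs, H⟩
    exact ⟨c, s₀, hc, hs, fun x hx => H x ⟨hAB hx.1, hx.2⟩⟩
  · rintro A B ⟨c, s₀, hc, hs, H⟩ ⟨c', s₀', hc', hs', H'⟩
    refine ⟨min c c', min s₀ s₀', lt_min hc hc', lt_min hs hs', ?_⟩
    rintro x ⟨hx | hx, hxD⟩ s h0 h1
    · refine le_trans (ENNReal.ofReal_le_ofReal ?_) (H x ⟨hx, hxD⟩ s h0 (h1.trans (min_le_left _ _)))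
      gcongr
      exact min_le_left _ _
    · refine le_trans (ENNReal.ofReal_le_ofReal ?_)
        (H' x ⟨hx, hxD⟩ s h0 (h1.trans (min_le_right _ _)))
      gcongr
      exact min_le_right _ _
  · intro x hx
    by_cases hxD : x ∈ D
    · obtain ⟨δ, hδ, hball⟩ := Metric.isOpen_iff.1 hopen x hxD
      refine ⟨Metric.ball x (δ / 2), mem_nhdsWithin_of_mem_nhds
        (Metric.ball_mem_nhds _ (by positivity)), 1, δ / 2, one_pos, by positivity, ?_⟩
      intro x' hx' s h0 h1
      have : D ∩ Metric.ball x' s = Metric.ball x' s := by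
        refine inter_eq_right.2 fun y hy => hball ?_
        have h2 : dist x' x < δ / 2 := hx'.1
        have h3 : dist y x' < s := hy
        have := dist_triangle y x' x
        rw [Metric.mem_ball]
        linarith
      rw [this, one_mul]
      exact ofReal_sq_le_volume_ball x' h0.le
    · obtain ⟨e, γ, K, r, hr, hγ, h⟩ := hfr x ⟨hx, by rwa [hopen.interior_eq]⟩
      exact ⟨Metric.ball x (r / 2), mem_nhdsWithin_of_mem_nhds
        (Metric.ball_mem_nhds _ (by positivity)), (1 / (4 * (1 + K))) ^ 2, r / 2,
        by positivity, by positivity, measure_density_graph hγ h⟩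

/-! ### Weak formulations in time -/

theorem contDiff_primitive {ψ : ℝ → ℝ} (hψ : ContDiff ℝ ∞ ψ) :
    ContDiff ℝ ∞ (fun t => ∫ s in (0 : ℝ)..t, ψ s) := by
  have hd : ∀ t, HasDerivAt (fun t => ∫ s in (0 : ℝ)..t, ψ s) (ψ t) t := fun t =>
    intervalIntegral.integral_hasDerivAt_right (hψ.continuous.intervalIntegrable _ _)
      hψ.continuous.aestronglyMeasurable.stronglyMeasurableAtFilter hψ.continuous.continuousAt
  rw [contDiff_infty_iff_deriv]
  refine ⟨fun t => (hd t).differentiableAt, ?_⟩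
  rwa [show deriv (fun t => ∫ s in (0 : ℝ)..t, ψ s) = ψ from funext fun t => (hd t).deriv]

/-- A compactly supported ψ has a compactly supported primitive only if its mean is zero. Since only
t > 0 matters, the primitive is normalised to vanish for large t and cut off on the negative axis.
-/
theorem exists_test_primitive {ψ : ℝ → ℝ} (hψ : ContDiff ℝ ∞ ψ) (hc : HasCompactSupport ψ) :
    ∃ θ : ℝ → ℝ, ContDiff ℝ ∞ θ ∧ HasCompactSupport θ ∧ ∀ t, 0 < t → deriv θ t = ψ t := by
  obtain ⟨R, hR⟩ := hc.isCompact.isBounded.subset_closedBall (0 : ℝ)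
  set R' := max R 0
  have hz : ∀ t, R' < t → ψ t = 0 := by
    intro t ht
    by_contra hne
    have := hR (subset_tsupport _ hne)
    simp only [mem_closedBall_zero_iff, Real.norm_eq_abs] at this
    have h1 := le_abs_self t
    have h2 := le_max_left R 0
    linarith
  set P : ℝ → ℝ := fun t => ∫ s in (0 : ℝ)..t, ψ s with hP
  have hPc : ContDiff ℝ ∞ P := contDiff_primitive hψ
  have hPR : ∀ t, R' < t → P t = P R' := by
    intro t ht
    rw [hP, ← sub_eq_zero]
    simp only
    rw [intervalIntegral.integral_interval_sub_left (hψ.continuous.intervalIntegrable _ _)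
      (hψ.continuous.intervalIntegrable _ _), intervalIntegral.integral_of_le ht.le]
    exact setIntegral_eq_zero_of_forall_eq_zero fun s hs => hz s hs.1
  -- The transition factor is 0 for t ≤ -2 and 1 for t ≥ -1, so it leaves the half-line t > 0
  -- untouched.
  refine ⟨fun t => Real.smoothTransition (t + 2) * (P t - P R'), ?_, ?_, ?_⟩
  · exact (Real.smoothTransition.contDiff.comp (by fun_prop)).mul (hPc.sub contDiff_const)
  · refine HasCompactSupport.intro (isCompact_Icc (a := (-2 : ℝ)) (b := R')) fun t ht => ?_
    rw [mem_Icc, not_and_or, not_le, not_le] at ht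
    rcases ht with ht | ht
    · rw [Real.smoothTransition.zero_of_nonpos (by linarith), zero_mul]
    · rw [hPR t ht, sub_self, mul_zero]
  · intro t ht
    have : (fun t => Real.smoothTransition (t + 2) * (P t - P R')) =ᶠ[𝓝 t] fun t => P t - P R' := by
      filter_upwards [lt_mem_nhds ht] with s hs
      rw [Real.smoothTransition.one_of_one_le (by linarith), one_mul]
    rw [this.deriv_eq, deriv_sub_const]
    exact (intervalIntegral.integral_hasDerivAt_right (hψ.continuous.intervalIntegrable _ _)
      hψ.continuous.aestronglyMeasurable.stronglyMeasurableAtFilter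
      hψ.continuous.continuousAt).deriv

theorem intervalIntegrable_of_ae_bound {J : ℝ → ℝ} {C : ℝ}
    (hJ : AEStronglyMeasurable J (volume.restrict (Ioi (0 : ℝ))))
    (hb : ∀ᵐ t ∂(volume.restrict (Ioi (0 : ℝ))), |J t| ≤ C) {a b : ℝ} (ha : 0 ≤ a) (hb' : 0 ≤ b) :
    IntervalIntegrable J volume a b := by
  rw [intervalIntegrable_iff]
  have hsub : uIoc a b ⊆ Ioi 0 := fun x hx => (le_min ha hb').trans_lt hx.1
  exact IntegrableOn.of_bound (by simp [uIoc]) (hJ.mono_set hsub) C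
    (ae_restrict_of_ae_restrict_of_subset hsub hb)

/-- The hypothesis is the weak form of a' = J, a(0) = a₀, with test functions allowed to be nonzero
at 0. The primitive A satisfies the same identity by integration by parts, so a - A annihilates
every θ'; by `exists_test_primitive` these exhaust the test functions on the half-line. -/
theorem ae_eq_primitive_of_weak {a J : ℝ → ℝ} {a₀ Ca CJ : ℝ}
    (ha : AEStronglyMeasurable a (volume.restrict (Ioi (0 : ℝ))))
    (hab : ∀ᵐ t ∂(volume.restrict (Ioi (0 : ℝ))), |a t| ≤ Ca)
    (hJ : AEStronglyMeasurable J (volume.restrict (Ioi (0 : ℝ))))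
    (hJb : ∀ᵐ t ∂(volume.restrict (Ioi (0 : ℝ))), |J t| ≤ CJ)
    (h : ∀ θ : ℝ → ℝ, ContDiff ℝ ∞ θ → HasCompactSupport θ →
      (∫ t in Ioi (0 : ℝ), deriv θ t * a t) + (∫ t in Ioi (0 : ℝ), θ t * J t) = - (θ 0 * a₀)) :
    ∀ᵐ t ∂(volume.restrict (Ioi (0 : ℝ))), a t = a₀ + ∫ s in (0 : ℝ)..t, J s := by
  set A : ℝ → ℝ := fun t => a₀ + ∫ s in (0 : ℝ)..t, J s with hA
  have hJi : ∀ b, 0 ≤ b → IntervalIntegrable J volume 0 b := fun b hb =>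
    intervalIntegrable_of_ae_bound hJ hJb le_rfl hb
  have hAcont : ContinuousOn A (Ici 0) := by
    intro t ht
    have h1 := (hJi (t + 1) (by have := mem_Ici.1 ht; linarith)).absolutelyContinuousOnInterval_intervalIntegral
      (c := 0) (by simp)
    have h2 : ContinuousOn A (uIcc 0 (t + 1)) := continuousOn_const.add h1.continuousOn
    rw [uIcc_of_le (by have := mem_Ici.1 ht; linarith)] at h2
    refine ((h2 t ⟨ht, by linarith⟩).mono_of_mem_nhdsWithin ?_)
    rw [mem_nhdsWithin]
    exact ⟨Iio (t + 1), isOpen_Iio, by simp, fun x hx => ⟨hx.2, hx.1.le⟩⟩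
  have key : ∀ θ : ℝ → ℝ, ContDiff ℝ ∞ θ → HasCompactSupport θ →
      ∫ t in Ioi (0 : ℝ), deriv θ t * (a t - A t) = 0 := by
    intro θ hθ hc
    obtain ⟨R, hR⟩ := hc.isCompact.isBounded.subset_closedBall (0 : ℝ)
    -- The extra 1 puts R' beyond the support of θ, so that the boundary term at R' vanishes.
    set R' := max R 0 + 1 with hR'
    have hR'0 : 0 < R' := by positivity
    have hz : ∀ t, R' ≤ t → θ t = 0 ∧ deriv θ t = 0 := by
      intro t ht
      have h2 := le_max_left R 0
      have hn : t ∉ tsupport θ := by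
        intro hmem
        have := hR hmem
        simp only [mem_closedBall_zero_iff, Real.norm_eq_abs] at this
        have h1 := le_abs_self t
        linarith
      exact ⟨image_eq_zero_of_notMem_tsupport hn,
        by_contra fun hm => hn (support_deriv_subset hm)⟩
    have hred : ∀ f : ℝ → ℝ, (∀ t, R' < t → f t = 0) →
        ∫ t in Ioi (0 : ℝ), f t = ∫ t in (0 : ℝ)..R', f t := by
      intro f hf
      rw [intervalIntegral.integral_of_le hR'0.le]
      refine setIntegral_eq_of_subset_of_forall_sdiff_eq_zero measurableSet_Ioi
        (fun x hx => hx.1) fun x hx => hf x ?_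
      by_contra hle
      exact hx.2 ⟨hx.1, not_lt.1 hle⟩
    have hw := h θ hθ hc
    have hJac := (hJi R' hR'0.le).absolutelyContinuousOnInterval_intervalIntegral (c := 0) (by simp)
    have hAac : AbsolutelyContinuousOnInterval A 0 R' := by
      have hconst : AbsolutelyContinuousOnInterval (fun _ : ℝ => a₀) 0 R' :=
        contDiffOn_const.absolutelyContinuousOnInterval
      exact hconst.add hJac
    have hθac : AbsolutelyContinuousOnInterval θ 0 R' :=
      (hθ.of_le (by simp)).contDiffOn.absolutelyContinuousOnInterval
    have hbp := hAac.integral_mul_deriv_eq_deriv_mul hθac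
    have hderiv : ∫ t in (0 : ℝ)..R', deriv A t * θ t = ∫ t in (0 : ℝ)..R', θ t * J t := by
      refine intervalIntegral.integral_congr_ae ?_
      filter_upwards [(hJi R' hR'0.le).ae_hasDerivAt_integral] with t ht htm
      have h1 := ht (uIoc_subset_uIcc htm) 0 (by simp)
      rw [(h1.const_add a₀).deriv, mul_comm]
    have hbd : A R' * θ R' = 0 := by rw [(hz R' le_rfl).1, mul_zero]
    have hA0 : A 0 = a₀ := by simp [hA]
    rw [hderiv, hbd, hA0] at hbp
    rw [hred _ (fun t ht => by rw [(hz t ht.le).2, zero_mul]),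
      hred _ (fun t ht => by rw [(hz t ht.le).1, zero_mul])] at hw
    rw [hred _ (fun t ht => by rw [(hz t ht.le).2, zero_mul])]
    simp_rw [mul_sub]
    have hdc : Continuous (deriv θ) := hθ.continuous_deriv (by simp)
    rw [intervalIntegral.integral_sub]
    · have : ∫ t in (0 : ℝ)..R', deriv θ t * A t = ∫ t in (0 : ℝ)..R', A t * deriv θ t := by
        simp_rw [mul_comm]
      rw [this, hbp]
      linarith
    · exact (intervalIntegrable_of_ae_bound ha hab le_rfl hR'0.le).continuousOn_mul hdc.continuousOn
    · refine ContinuousOn.intervalIntegrable (hdc.continuousOn.mul (hAcont.mono ?_))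
      rw [uIcc_of_le hR'0.le]
      exact fun x hx => hx.1
  have hf : LocallyIntegrable ((Ioi (0 : ℝ)).indicator fun t => a t - A t) volume := by
    rw [locallyIntegrable_iff]
    intro k hk
    obtain ⟨R, hR⟩ := hk.isBounded.subset_closedBall (0 : ℝ)
    have hR0 : (0 : ℝ) ≤ max R 0 := le_max_right _ _
    have h1 : IntegrableOn (fun t => a t - A t) (Ioc 0 (max R 0)) := by
      have e1 := intervalIntegrable_of_ae_bound ha hab le_rfl hR0
      have e2 : IntervalIntegrable A volume 0 (max R 0) :=
        ContinuousOn.intervalIntegrable (hAcont.mono (by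
          rw [uIcc_of_le hR0]; exact fun x hx => hx.1))
      have e3 := e1.sub e2
      rwa [intervalIntegrable_iff_integrableOn_Ioc_of_le hR0] at e3
    have h2 : IntegrableOn ((Ioi (0 : ℝ)).indicator fun t => a t - A t) (Iic (max R 0)) := by
      rw [integrableOn_indicator_iff measurableSet_Ioi]
      exact h1
    refine h2.mono_set fun x hx => ?_
    have := hR hx
    simp only [mem_closedBall_zero_iff, Real.norm_eq_abs] at this
    exact ((le_abs_self x).trans this).trans (le_max_left _ _)
  have hzero := ae_eq_zero_of_integral_contDiff_smul_eq_zero hf fun ψ hψ hc => by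
    obtain ⟨θ, hθ, hθc, hd⟩ := exists_test_primitive hψ hc
    refine Eq.trans ?_ (key θ hθ hθc)
    rw [← integral_indicator measurableSet_Ioi]
    refine integral_congr_ae (Filter.Eventually.of_forall fun t => ?_)
    by_cases ht : t ∈ Ioi (0 : ℝ)
    · simp [ht, hd t ht]
    · simp [ht]
  rw [ae_restrict_iff' measurableSet_Ioi]
  filter_upwards [hzero] with t ht hpos
  rw [indicator_of_mem hpos] at ht
  linarith

/-! ### The continuity equation with bounded density and finite kinetic energy -/

/-- Bounded nonnegative densities transported by a field of finite kinetic energy. -/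
structure BoundedTransport (ρ₀ : Plane → ℝ) (ρ : ℝ → Plane → ℝ) (u : ℝ → Plane → Plane)
    (K M : ℝ) : Prop where
  energy_nonneg : 0 ≤ M
  init_measurable : Measurable ρ₀
  init_nonneg : ∀ x, 0 ≤ ρ₀ x
  init_le_one : ∀ x, ρ₀ x ≤ 1
  density_measurable : Measurable (Function.uncurry ρ)
  density_nonneg : ∀ t x, 0 ≤ ρ t x
  density_le : ∀ t x, ρ t x ≤ K
  velocity_measurable : Measurable (Function.uncurry u)
  energy : ∀ᵐ t ∂(volume.restrict (Ioi (0 : ℝ))),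
    ∫⁻ x, ENNReal.ofReal (ρ t x) * ‖u t x‖ₑ ^ 2 ≤ ENNReal.ofReal (M ^ 2)
  continuity_eq : ∀ φ : ℝ × Plane → ℝ, ContDiff ℝ ∞ φ → HasCompactSupport φ →
    (∫ t in Ioi (0 : ℝ), ∫ x, ρ t x * timeDeriv φ t x)
      + (∫ t in Ioi (0 : ℝ), ∫ x, ρ t x * ∑ i : Fin 2, u t x i * spaceDeriv i φ t x)
      = - ∫ x, ρ₀ x * φ (0, x)

theorem sum_mul_basisVec (L : Plane →L[ℝ] ℝ) (w : Plane) :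
    ∑ i : Fin 2, w i * L (basisVec i) = L w := by
  conv_rhs => rw [plane_eq_sum w]
  simp

/-- The flux `∫ ρ u · ∇φ` at time `t`. -/
noncomputable def flux (ρ : ℝ → Plane → ℝ) (u : ℝ → Plane → Plane) (φ : Plane → ℝ) (t : ℝ) : ℝ :=
  ∫ x, ρ t x * fderiv ℝ φ x (u t x)

/-- The gradient of χ² keeps a factor χ. This is why squares of cutoffs are used: the flux of ∫ρχ²
is then controlled by the square root of that same mass. -/
theorem enorm_fderiv_sq_le {χ : Plane → ℝ} (hχ : ContDiff ℝ ∞ χ) {b : ℝ}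
    (hb : ∀ x, ‖fderiv ℝ χ x‖ ≤ b) (x : Plane) :
    ‖fderiv ℝ (fun x => χ x ^ 2) x‖ₑ ≤ ENNReal.ofReal (2 * b * |χ x|) := by
  have h1 : HasFDerivAt (fun x => χ x ^ 2) ((2 * χ x) • fderiv ℝ χ x) x := by
    have h := (hχ.differentiable (by simp) x).hasFDerivAt
    simp_rw [pow_two]
    exact (h.mul h).congr_fderiv (by rw [two_mul, add_smul])
  rw [h1.fderiv, ← ofReal_norm, norm_smul]
  refine ENNReal.ofReal_le_ofReal ?_
  rw [Real.norm_eq_abs, abs_mul, abs_two]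
  calc _ ≤ 2 * |χ x| * b := by gcongr; exact hb x
    _ = _ := by ring

namespace BoundedTransport

variable {ρ₀ : Plane → ℝ} {ρ : ℝ → Plane → ℝ} {u : ℝ → Plane → Plane} {K M : ℝ}

theorem measurable_density_slice (H : BoundedTransport ρ₀ ρ u K M) (t : ℝ) : Measurable (ρ t) :=
  H.density_measurable.comp measurable_prodMk_left

theorem measurable_velocity_slice (H : BoundedTransport ρ₀ ρ u K M) (t : ℝ) : Measurable (u t) :=
  H.velocity_measurable.comp measurable_prodMk_left

theorem sq_lintegral_momentum_le (H : BoundedTransport ρ₀ ρ u K M) {t : ℝ}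
    (ht : ∫⁻ x, ENNReal.ofReal (ρ t x) * ‖u t x‖ₑ ^ 2 ≤ ENNReal.ofReal (M ^ 2))
    {w : Plane → ℝ≥0∞} (hw : Measurable w) :
    (∫⁻ x, ENNReal.ofReal (ρ t x) * ‖u t x‖ₑ * w x) ^ 2
      ≤ ENNReal.ofReal (M ^ 2) * ∫⁻ x, ENNReal.ofReal (ρ t x) * w x ^ 2 := by
  have hρ := H.measurable_density_slice t
  have hu := H.measurable_velocity_slice t
  have hs : ∀ x, ENNReal.ofReal √(ρ t x) ^ 2 = ENNReal.ofReal (ρ t x) := fun x => by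
    rw [← ENNReal.ofReal_pow (Real.sqrt_nonneg _), Real.sq_sqrt (H.density_nonneg t x)]
  have h := sq_lintegral_mul_le (μ := volume)
    (f := fun x => ENNReal.ofReal √(ρ t x) * ‖u t x‖ₑ)
    (g := fun x => ENNReal.ofReal √(ρ t x) * w x) (by fun_prop) (by fun_prop)
  calc _ = (∫⁻ x, ENNReal.ofReal √(ρ t x) * ‖u t x‖ₑ * (ENNReal.ofReal √(ρ t x) * w x)) ^ 2 := by
        congr 1
        refine lintegral_congr fun x => ?_
        rw [← hs]
        ring
    _ ≤ _ := h
    _ ≤ _ := by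
        simp only [mul_pow, hs]
        gcongr

theorem measurable_mass (H : BoundedTransport ρ₀ ρ u K M) {φ : Plane → ℝ} (hφ : Measurable φ) :
    StronglyMeasurable fun t => ∫ x, ρ t x * φ x := by
  refine StronglyMeasurable.integral_prod_right (f := fun t x => ρ t x * φ x)
    (Measurable.stronglyMeasurable ?_)
  exact H.density_measurable.mul (hφ.comp measurable_snd)

theorem measurable_flux (H : BoundedTransport ρ₀ ρ u K M) {φ : Plane → ℝ}
    (hφ : ContDiff ℝ ∞ φ) : StronglyMeasurable (flux ρ u φ) := by
  refine StronglyMeasurable.integral_prod_right (f := fun t x => ρ t x * fderiv ℝ φ x (u t x))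
    (Measurable.stronglyMeasurable ?_)
  refine H.density_measurable.mul ?_
  have h1 : Measurable (fun z : ℝ × Plane => ((fderiv ℝ φ z.2), Function.uncurry u z)) :=
    ((hφ.continuous_fderiv (by simp)).measurable.comp measurable_snd).prodMk H.velocity_measurable
  have h2 : Continuous fun p : (Plane →L[ℝ] ℝ) × Plane => p.1 p.2 :=
    isBoundedBilinearMap_apply.continuous
  exact h2.measurable.comp h1

theorem enorm_flux_le (H : BoundedTransport ρ₀ ρ u K M) (φ : Plane → ℝ) (t : ℝ) :
    ‖flux ρ u φ t‖ₑ ≤ ∫⁻ x, ENNReal.ofReal (ρ t x) * ‖u t x‖ₑ * ‖fderiv ℝ φ x‖ₑ := by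
  refine (enorm_integral_le_lintegral_enorm _).trans (lintegral_mono fun x => ?_)
  rw [enorm_mul, Real.enorm_of_nonneg (H.density_nonneg t x), mul_assoc, mul_comm ‖u t x‖ₑ]
  gcongr
  rw [← enorm_norm, ← enorm_norm (fderiv ℝ φ x), ← enorm_norm (u t x), ← enorm_mul]
  exact enorm_le_iff_norm_le.2 (by simpa using (fderiv ℝ φ x).le_opNorm (u t x))

/-- A qualitative bound, depending on K; it only serves to make the flux integrable in time. -/
theorem exists_flux_bound (H : BoundedTransport ρ₀ ρ u K M) {φ : Plane → ℝ}
    (hφ : ContDiff ℝ ∞ φ) (hc : HasCompactSupport φ) :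
    ∃ C : ℝ, ∀ᵐ t ∂(volume.restrict (Ioi (0 : ℝ))), |flux ρ u φ t| ≤ C := by
  set B : ℝ≥0∞ := ENNReal.ofReal (M ^ 2) * (ENNReal.ofReal K * ∫⁻ x, ‖fderiv ℝ φ x‖ₑ ^ 2) with hB
  have hcont := hφ.continuous_fderiv (by simp)
  have hBt : B ≠ ⊤ := by
    refine ENNReal.mul_ne_top (by simp) (ENNReal.mul_ne_top (by simp) ?_)
    have := hcont.memLp_of_hasCompactSupport (μ := volume) (p := 2) (hc.fderiv (𝕜 := ℝ))
    rw [← eLpNorm_two_sq]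
    exact ENNReal.pow_ne_top this.2.ne
  refine ⟨√B.toReal, ?_⟩
  filter_upwards [H.energy] with t ht
  refine Real.abs_le_sqrt ?_
  have h1 : ‖flux ρ u φ t‖ₑ ^ 2 ≤ B := by
    refine (pow_le_pow_left' (H.enorm_flux_le φ t) 2).trans
      ((H.sq_lintegral_momentum_le ht hcont.measurable.enorm).trans ?_)
    rw [hB, ← lintegral_const_mul' (ENNReal.ofReal K) _ (by simp)]
    refine mul_le_mul_right (lintegral_mono fun x => mul_le_mul_left ?_ _) _
    exact ENNReal.ofReal_le_ofReal (H.density_le t x)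
  have h2 := ENNReal.toReal_mono hBt h1
  simpa using h2

/-- The continuity equation is tested with products θ(t)φ(x), which gives the weak form of an
ordinary differential equation for the mass. -/
theorem ae_mass_eq (H : BoundedTransport ρ₀ ρ u K M) {φ : Plane → ℝ}
    (hφ : ContDiff ℝ ∞ φ) (hc : HasCompactSupport φ) :
    ∀ᵐ t ∂(volume.restrict (Ioi (0 : ℝ))),
      ∫ x, ρ t x * φ x = (∫ x, ρ₀ x * φ x) + ∫ s in (0 : ℝ)..t, flux ρ u φ s := by
  obtain ⟨C, hC⟩ := H.exists_flux_bound hφ hc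
  have hint : Integrable φ := hφ.continuous.integrable_of_hasCompactSupport hc
  refine ae_eq_primitive_of_weak (Ca := K * ∫ x, ‖φ x‖)
    (H.measurable_mass hφ.continuous.measurable).aestronglyMeasurable
    (Filter.Eventually.of_forall fun t => ?_) (H.measurable_flux hφ).aestronglyMeasurable hC ?_
  · rw [← integral_const_mul, ← Real.norm_eq_abs]
    refine norm_integral_le_of_norm_le (hint.norm.const_mul K) (Filter.Eventually.of_forall fun x => ?_)
    rw [norm_mul, Real.norm_of_nonneg (H.density_nonneg t x)]
    gcongr
    exact H.density_le t x
  · intro θ hθ hθc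
    set Φ : ℝ × Plane → ℝ := fun z => θ z.1 * φ z.2 with hΦ
    have hΦc : ContDiff ℝ ∞ Φ := (hθ.comp contDiff_fst).mul (hφ.comp contDiff_snd)
    have hΦs : HasCompactSupport Φ := by
      refine HasCompactSupport.intro (hθc.isCompact.prod hc.isCompact) fun z hz => ?_
      rw [mem_prod, not_and_or] at hz
      rcases hz with hz | hz
      · simp [hΦ, image_eq_zero_of_notMem_tsupport hz]
      · simp [hΦ, image_eq_zero_of_notMem_tsupport hz]
    have hfd : ∀ t x, HasFDerivAt Φ (θ t • (fderiv ℝ φ x).comp (ContinuousLinearMap.snd ℝ ℝ Plane)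
        + φ x • (fderiv ℝ θ t).comp (ContinuousLinearMap.fst ℝ ℝ Plane)) (t, x) := by
      intro t x
      have h1 : HasFDerivAt (fun z : ℝ × Plane => θ z.1)
          ((fderiv ℝ θ t).comp (ContinuousLinearMap.fst ℝ ℝ Plane)) (t, x) :=
        ((hθ.differentiable (by simp) t).hasFDerivAt).comp (t, x) hasFDerivAt_fst
      have h2 : HasFDerivAt (fun z : ℝ × Plane => φ z.2)
          ((fderiv ℝ φ x).comp (ContinuousLinearMap.snd ℝ ℝ Plane)) (t, x) :=
        ((hφ.differentiable (by simp) x).hasFDerivAt).comp (t, x) hasFDerivAt_snd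
      exact h1.mul h2
    have ht : ∀ t x, timeDeriv Φ t x = deriv θ t * φ x := by
      intro t x
      rw [timeDeriv, (hfd t x).fderiv]
      simp [mul_comm]
    have hs : ∀ i t x, spaceDeriv i Φ t x = θ t * fderiv ℝ φ x (basisVec i) := by
      intro i t x
      rw [spaceDeriv, (hfd t x).fderiv]
      simp
    have h := H.continuity_eq Φ hΦc hΦs
    simp only [ht, hs] at h
    have e1 : ∀ t, ∫ x, ρ t x * (deriv θ t * φ x) = deriv θ t * ∫ x, ρ t x * φ x := by
      intro t
      rw [← integral_const_mul]
      exact integral_congr_ae (Filter.Eventually.of_forall fun x => by simp only; ring)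
    have e2 : ∀ t, ∫ x, ρ t x * ∑ i : Fin 2, u t x i * (θ t * fderiv ℝ φ x (basisVec i))
        = θ t * flux ρ u φ t := by
      intro t
      rw [flux, ← integral_const_mul]
      refine integral_congr_ae (Filter.Eventually.of_forall fun x => ?_)
      simp only
      rw [← sum_mul_basisVec, Finset.mul_sum, Finset.mul_sum, Finset.mul_sum]
      exact Finset.sum_congr rfl fun i _ => by ring
    have e3 : ∫ x, ρ₀ x * Φ (0, x) = θ 0 * ∫ x, ρ₀ x * φ x := by
      rw [← integral_const_mul]
      exact integral_congr_ae (Filter.Eventually.of_forall fun x => by simp only [hΦ]; ring)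
    simpa only [e1, e2, e3] using h

theorem integrable_density_mul (H : BoundedTransport ρ₀ ρ u K M) (t : ℝ) {φ : Plane → ℝ}
    (hφ : Integrable φ) : Integrable fun x => ρ t x * φ x :=
  hφ.bdd_mul (c := K) (H.measurable_density_slice t).aestronglyMeasurable
    (Filter.Eventually.of_forall fun x => by
      rw [Real.norm_of_nonneg (H.density_nonneg t x)]; exact H.density_le t x)

/-- Cauchy–Schwarz with ρ = √ρ·√ρ: one factor is the kinetic energy, the other is 4b²∫ρχ². The bound
K of the density does not enter. -/
theorem abs_flux_sq_le (H : BoundedTransport ρ₀ ρ u K M) {χ : Plane → ℝ}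
    (hχ : ContDiff ℝ ∞ χ) (hc : HasCompactSupport χ) {b : ℝ} (hb : ∀ x, ‖fderiv ℝ χ x‖ ≤ b) {t : ℝ}
    (ht : ∫⁻ x, ENNReal.ofReal (ρ t x) * ‖u t x‖ₑ ^ 2 ≤ ENNReal.ofReal (M ^ 2)) :
    |flux ρ u (fun x => χ x ^ 2) t| ≤ 2 * b * M * √(∫ x, ρ t x * χ x ^ 2) := by
  have hb0 : 0 ≤ b := (norm_nonneg _).trans (hb 0)
  have hfd := enorm_fderiv_sq_le hχ hb
  have hc2 : HasCompactSupport (fun x => χ x ^ 2) :=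
    hc.comp_left (g := fun y : ℝ => y ^ 2) (by simp)
  have hχ2 : Integrable fun x => χ x ^ 2 :=
    (hχ.continuous.pow 2).integrable_of_hasCompactSupport hc2
  have hmass : ∫⁻ x, ENNReal.ofReal (ρ t x) * ENNReal.ofReal (2 * b * |χ x|) ^ 2
      = ENNReal.ofReal ((2 * b) ^ 2 * ∫ x, ρ t x * χ x ^ 2) := by
    rw [← integral_const_mul, ofReal_integral_eq_lintegral_ofReal]
    · refine lintegral_congr fun x => ?_
      rw [← ENNReal.ofReal_pow (by positivity), ← ENNReal.ofReal_mul (H.density_nonneg t x),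
        mul_pow, sq_abs]
      congr 1
      ring
    · exact (H.integrable_density_mul t hχ2).const_mul _
    · exact Filter.Eventually.of_forall fun x => by
        have := H.density_nonneg t x
        positivity
  have hm0 : 0 ≤ ∫ x, ρ t x * χ x ^ 2 :=
    integral_nonneg fun x => mul_nonneg (H.density_nonneg t x) (sq_nonneg _)
  have h1 : ‖flux ρ u (fun x => χ x ^ 2) t‖ₑ ^ 2
      ≤ ENNReal.ofReal (M ^ 2 * ((2 * b) ^ 2 * ∫ x, ρ t x * χ x ^ 2)) := by
    calc _ ≤ (∫⁻ x, ENNReal.ofReal (ρ t x) * ‖u t x‖ₑ * ENNReal.ofReal (2 * b * |χ x|)) ^ 2 := by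
          gcongr
          refine (H.enorm_flux_le _ t).trans ?_
          gcongr with x
          exact hfd x
      _ ≤ _ := by
          refine (H.sq_lintegral_momentum_le ht (by
            have := hχ.continuous.measurable
            fun_prop)).trans ?_
          rw [hmass, ENNReal.ofReal_mul (sq_nonneg M)]
  have h2 := ENNReal.toReal_mono (by simp) h1
  rw [ENNReal.toReal_ofReal (by positivity)] at h2
  have hM := H.energy_nonneg
  rw [ENNReal.toReal_pow, toReal_enorm, Real.norm_eq_abs, sq_abs] at h2
  refine abs_le_of_sq_le_sq ?_ (by positivity)
  rw [mul_pow, Real.sq_sqrt hm0]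
  linarith

/-- Bound on the change of the mass `∫ ρ(t) χ²` up to time `t`. -/
theorem mass_bounds (H : BoundedTransport ρ₀ ρ u K M) {χ : Plane → ℝ}
    (hχ : ContDiff ℝ ∞ χ) (hc : HasCompactSupport χ) {b : ℝ} (hb : ∀ x, ‖fderiv ℝ χ x‖ ≤ b) {t : ℝ}
    (ht : 0 ≤ t) :
    |∫ s in (0 : ℝ)..t, flux ρ u (fun x => χ x ^ 2) s|
      ≤ 2 * b * M * t * (√(∫ x, ρ₀ x * χ x ^ 2) + 2 * b * M * t) := by
  have hb0 : 0 ≤ b := (norm_nonneg _).trans (hb 0)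
  have hM := H.energy_nonneg
  have hc2 : HasCompactSupport (fun x => χ x ^ 2) :=
    hc.comp_left (g := fun y : ℝ => y ^ 2) (by simp)
  obtain ⟨C, hC⟩ := H.exists_flux_bound (hχ.pow 2) hc2
  set J := flux ρ u (fun x => χ x ^ 2) with hJ
  set a₀ := ∫ x, ρ₀ x * χ x ^ 2 with ha₀
  have ha0 : 0 ≤ a₀ := integral_nonneg fun x => mul_nonneg (H.init_nonneg x) (sq_nonneg _)
  have hJi : IntervalIntegrable J volume 0 t :=
    intervalIntegrable_of_ae_bound (H.measurable_flux (hχ.pow 2)).aestronglyMeasurable hC le_rfl ht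
  have hcont : ContinuousOn (fun τ => a₀ + ∫ s in (0 : ℝ)..τ, J s) (Icc 0 t) := by
    have := (hJi.absolutelyContinuousOnInterval_intervalIntegral (c := 0) (by simp)).continuousOn
    rw [uIcc_of_le ht] at this
    exact continuousOn_const.add this
  -- Differentiating the square root of the mass would fail where the mass vanishes; instead the
  -- flux is estimated by means of the maximum S of the mass on [0,t].
  obtain ⟨τ, hτ, hmax⟩ := isCompact_Icc.exists_isMaxOn (nonempty_Icc.2 ht) hcont
  set S := a₀ + ∫ s in (0 : ℝ)..τ, J s with hS
  have hS0 : 0 ≤ S := by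
    have := hmax (left_mem_Icc.2 ht)
    simp at this
    linarith
  have hest : ∀ σ ∈ Icc 0 t, |∫ s in (0 : ℝ)..σ, J s| ≤ 2 * b * M * √S * σ := by
    intro σ hσ
    have := intervalIntegral.norm_integral_le_of_norm_le_const_ae (a := 0) (b := σ) (f := J)
      (C := 2 * b * M * √S) ?_
    · simpa [abs_of_nonneg hσ.1] using this
    · have h1 := (ae_restrict_iff' measurableSet_Ioi).1 (H.ae_mass_eq (hχ.pow 2) hc2)
      have h2 := (ae_restrict_iff' measurableSet_Ioi).1 H.energy
      filter_upwards [h1, h2] with s hs1 hs2 hsm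
      rw [uIoc_of_le hσ.1] at hsm
      have hle : ∫ x, ρ s x * χ x ^ 2 ≤ S := by
        rw [hs1 hsm.1]
        exact hmax ⟨hsm.1.le, hsm.2.trans hσ.2⟩
      refine (H.abs_flux_sq_le hχ hc hb (hs2 hsm.1)).trans ?_
      gcongr
  set β := 2 * b * M * t with hβ
  have hβ0 : 0 ≤ β := by positivity
  have hSle : S ≤ a₀ + β * √S := by
    have h1 := (abs_le.1 (hest τ hτ)).2
    have h2 : 2 * b * M * √S * τ ≤ 2 * b * M * √S * t := by gcongr; exact hτ.2
    rw [hS]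
    rw [hβ]
    linarith
  -- If √S exceeded √a₀ + β, then S - β√S = √S(√S - β) would exceed a₀.
  have hsq : √S ≤ √a₀ + β := by
    by_contra hlt
    push Not at hlt
    have e1 := Real.sq_sqrt hS0
    have e2 := Real.sq_sqrt ha0
    nlinarith [Real.sqrt_nonneg S, Real.sqrt_nonneg a₀]
  calc _ ≤ _ := hest t (right_mem_Icc.2 ht)
    _ = β * √S := by rw [hβ]; ring
    _ ≤ _ := by gcongr

end BoundedTransport

/-! ### Mollification at a fixed time and the commutator -/

/-- `k` is a smooth nonnegative kernel of mass one at scale `ε`. -/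
structure IsMollifier (C ε : ℝ) (k : Plane → ℝ) : Prop where
  scale_pos : 0 < ε
  contDiff : ContDiff ℝ ∞ k
  nonneg : ∀ z, 0 ≤ k z
  support : ∀ z, ε ≤ ‖z‖ → k z = 0
  integral_eq : ∫ z, k z = 1
  le : ∀ z, k z ≤ C * (ε ^ 2)⁻¹
  fderiv_le : ∀ z, ‖fderiv ℝ k z‖ ≤ C * (ε ^ 3)⁻¹

theorem exists_isMollifier : ∃ C : ℝ, 0 ≤ C ∧ ∀ ε : ℝ, 0 < ε → ∃ k, IsMollifier C ε k := by
  -- Outer radius 1 makes the kernel rescaled by ε vanish for ‖z‖ ≥ ε; all constants come from this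
  -- one profile and are independent of ε.
  let η : ContDiffBump (0 : Plane) := ⟨1 / 2, 1, by norm_num, by norm_num⟩
  set η₀ : Plane → ℝ := η.normed volume with hη₀
  have hcd : ContDiff ℝ ∞ η₀ := η.contDiff_normed
  have hcs : HasCompactSupport η₀ := η.hasCompactSupport_normed
  obtain ⟨C₁, hC₁⟩ := hcd.continuous.bounded_above_of_compact_support hcs
  obtain ⟨C₂, hC₂⟩ := (hcd.continuous_fderiv (by simp)).bounded_above_of_compact_support
    (hcs.fderiv (𝕜 := ℝ))
  have hC₁0 : 0 ≤ C₁ := (norm_nonneg _).trans (hC₁ 0)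
  refine ⟨max C₁ C₂, hC₁0.trans (le_max_left _ _), fun ε hε => ?_⟩
  have hd : ∀ z, HasFDerivAt (fun z => (ε ^ 2)⁻¹ * η₀ (ε⁻¹ • z))
      ((ε ^ 2)⁻¹ • (ε⁻¹ • fderiv ℝ η₀ (ε⁻¹ • z))) z := by
    intro z
    have h1 : HasFDerivAt (fun z : Plane => ε⁻¹ • z) (ε⁻¹ • ContinuousLinearMap.id ℝ Plane) z :=
      (ε⁻¹ • ContinuousLinearMap.id ℝ Plane).hasFDerivAt
    have h2 := ((hcd.differentiable (by simp) (ε⁻¹ • z)).hasFDerivAt.comp z h1).const_mul (ε ^ 2)⁻¹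
    refine h2.congr_fderiv ?_
    ext v
    simp
  refine ⟨fun z => (ε ^ 2)⁻¹ * η₀ (ε⁻¹ • z), hε, ?_, ?_, ?_, ?_, ?_, ?_⟩
  · exact contDiff_const.mul (hcd.comp (by fun_prop))
  · exact fun z => mul_nonneg (by positivity) (η.nonneg_normed _)
  · intro z hz
    have : η₀ (ε⁻¹ • z) = 0 := by
      by_contra hne
      have h1 : ε⁻¹ • z ∈ Function.support (η.normed volume) := hne
      rw [η.support_normed_eq] at h1
      have h2 : ‖ε⁻¹ • z‖ < 1 := by simpa using h1
      rw [norm_smul, Real.norm_of_nonneg (by positivity), inv_mul_lt_iff₀ hε] at h2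
      linarith
    rw [this, mul_zero]
  · rw [integral_const_mul, Measure.integral_comp_smul]
    simp only [finrank_euclideanSpace, Fintype.card_fin, smul_eq_mul]
    rw [η.integral_normed, abs_of_pos (by positivity)]
    field_simp
  · intro z
    have := (le_abs_self _).trans ((hC₁ (ε⁻¹ • z)).trans (le_max_left C₁ C₂))
    rw [mul_comm]
    gcongr
  · intro z
    rw [(hd z).fderiv, norm_smul, norm_smul, Real.norm_of_nonneg (by positivity),
      Real.norm_of_nonneg (by positivity)]
    have := (hC₂ (ε⁻¹ • z)).trans (le_max_right C₁ C₂)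
    calc (ε ^ 2)⁻¹ * (ε⁻¹ * ‖fderiv ℝ η₀ (ε⁻¹ • z)‖)
        = ‖fderiv ℝ η₀ (ε⁻¹ • z)‖ * (ε ^ 3)⁻¹ := by field_simp
      _ ≤ _ := by gcongr

namespace IsMollifier
variable {C ε : ℝ} {k : Plane → ℝ}

theorem hasCompactSupport (H : IsMollifier C ε k) : HasCompactSupport k :=
  HasCompactSupport.intro (isCompact_closedBall (0 : Plane) ε) fun z hz => by
    rw [mem_closedBall_zero_iff, not_le] at hz
    exact H.support z hz.le

theorem continuous_fderiv (H : IsMollifier C ε k) : Continuous (fderiv ℝ k) :=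
  H.contDiff.continuous_fderiv (by simp)

theorem contDiff_sub_left (H : IsMollifier C ε k) (x : Plane) :
    ContDiff ℝ ∞ (fun y => k (x - y)) := H.contDiff.comp (by fun_prop)

theorem hasCompactSupport_sub_left (H : IsMollifier C ε k) (x : Plane) :
    HasCompactSupport (fun y => k (x - y)) :=
  H.hasCompactSupport.comp_homeomorph (Homeomorph.subLeft x)

theorem fderiv_sub_left (H : IsMollifier C ε k) (x y : Plane) :
    fderiv ℝ (fun y => k (x - y)) y = - fderiv ℝ k (x - y) := by
  have h1 : HasFDerivAt (fun y : Plane => x - y) (-ContinuousLinearMap.id ℝ Plane) y := by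
    simpa using (hasFDerivAt_id y).const_sub x
  have h2 := ((H.contDiff.differentiable (by simp) (x - y)).hasFDerivAt.comp y h1).fderiv
  rw [show (fun y => k (x - y)) = k ∘ (fun y => x - y) from rfl, h2]
  ext v
  simp

theorem integral_sub_left (H : IsMollifier C ε k) (x : Plane) : ∫ y, k (x - y) = 1 := by
  rw [integral_sub_left_eq_self k volume x, H.integral_eq]

theorem integrable (H : IsMollifier C ε k) : Integrable k :=
  H.contDiff.continuous.integrable_of_hasCompactSupport H.hasCompactSupport

/-- The mollification of `f`. -/
noncomputable def smooth (_ : IsMollifier C ε k) (f : Plane → ℝ) (x : Plane) : ℝ := ∫ y, f y * k (x - y)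

theorem contDiff_smooth (H : IsMollifier C ε k) {f : Plane → ℝ} (hf : LocallyIntegrable f volume) :
    ContDiff ℝ ∞ (H.smooth f) :=
  H.hasCompactSupport.contDiff_convolution_right (ContinuousLinearMap.mul ℝ ℝ) hf H.contDiff

theorem integrable_smul_fderiv (H : IsMollifier C ε k) {f : Plane → ℝ}
    (hf : LocallyIntegrable f volume) (x : Plane) :
    Integrable (fun y => f y • fderiv ℝ k (x - y)) :=
  hf.integrable_smul_right_of_hasCompactSupport (H.continuous_fderiv.comp (by fun_prop))
    ((H.hasCompactSupport.fderiv (𝕜 := ℝ)).comp_homeomorph (Homeomorph.subLeft x))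

theorem fderiv_smooth (H : IsMollifier C ε k) {f : Plane → ℝ} (hf : LocallyIntegrable f volume)
    (x v : Plane) : fderiv ℝ (H.smooth f) x v = ∫ y, f y * fderiv ℝ k (x - y) v := by
  have h1 : HasFDerivAt (H.smooth f) _ x := H.hasCompactSupport.hasFDerivAt_convolution_right
    (ContinuousLinearMap.mul ℝ ℝ) hf (H.contDiff.of_le (by simp)) x
  have h2 : fderiv ℝ (H.smooth f) x = ∫ y, f y • fderiv ℝ k (x - y) := by
    rw [h1.fderiv]
    rfl
  rw [h2, ContinuousLinearMap.integral_apply (H.integrable_smul_fderiv hf x)]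
  rfl

theorem integral_fderiv_eq_zero (H : IsMollifier C ε k) (x v : Plane) :
    ∫ y, fderiv ℝ k (x - y) v = 0 := by
  have h := H.fderiv_smooth (f := fun _ => 1) (locallyIntegrable_const 1) x v
  have h1 : H.smooth (fun _ => 1) = fun _ => 1 := by
    funext x
    simp [smooth, H.integral_sub_left]
  rw [h1] at h
  simpa using h.symm

end IsMollifier

theorem IsWeaklyDivFree.integral_fderiv_eq_zero {w : Plane → Plane} (hw : IsWeaklyDivFree w)
    {φ : Plane → ℝ} (hφ : ContDiff ℝ ∞ φ) (hc : HasCompactSupport φ) :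
    ∫ x, fderiv ℝ φ x (w x) = 0 := by
  rw [← hw φ hφ hc]
  simp_rw [sum_mul_basisVec]

theorem integrable_clm_apply {w : Plane → Plane} (hw : LocallyIntegrable w volume)
    {L : Plane → (Plane →L[ℝ] ℝ)} (hL : Continuous L) (hc : HasCompactSupport L) :
    Integrable fun x => L x (w x) := by
  obtain ⟨R, -, hR⟩ := tsupport_subset_closedBall (φ := L) hc
  obtain ⟨B, hB⟩ := hL.bounded_above_of_compact_support hc
  have h1 : Integrable ((Metric.closedBall (0 : Plane) R).indicator w) :=
    (hw.integrableOn_isCompact (isCompact_closedBall _ _)).integrable_indicator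
      Metric.isClosed_closedBall.measurableSet
  refine (h1.norm.const_mul B).mono' ?_ (Filter.Eventually.of_forall fun x => ?_)
  · have h2 : Continuous fun p : (Plane →L[ℝ] ℝ) × Plane => p.1 p.2 :=
      isBoundedBilinearMap_apply.continuous
    exact h2.comp_aestronglyMeasurable
      (hL.aestronglyMeasurable.prodMk hw.aestronglyMeasurable)
  · by_cases hx : x ∈ Metric.closedBall (0 : Plane) R
    · rw [indicator_of_mem hx]
      exact ((L x).le_opNorm _).trans (by gcongr; exact hB x)
    · rw [hR x (by simpa using hx)]
      simp [hx]

section Commutator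

variable {C ε K : ℝ} {k : Plane → ℝ} {f : Plane → ℝ} {w : Plane → Plane}

theorem locallyIntegrable_of_bounded (hf : Measurable f) (h0 : ∀ x, 0 ≤ f x) (hK : ∀ x, f x ≤ K) :
    LocallyIntegrable f volume :=
  (locallyIntegrable_const K).mono hf.aestronglyMeasurable (Filter.Eventually.of_forall fun x => by
    rw [Real.norm_of_nonneg (h0 x), Real.norm_of_nonneg ((h0 x).trans (hK x))]
    exact hK x)

/-- The commutator between transport by `w` and mollification of `f`. -/
noncomputable def IsMollifier.comm (_ : IsMollifier C ε k) (f : Plane → ℝ) (w : Plane → Plane) (x : Plane) : ℝ :=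
  ∫ y, (f y - f x) * (- fderiv ℝ k (x - y)) (w y - w x)

/-- The mollified flux. -/
noncomputable def IsMollifier.flux (_ : IsMollifier C ε k) (f : Plane → ℝ) (w : Plane → Plane) (x : Plane) : ℝ :=
  ∫ y, f y * (- fderiv ℝ k (x - y)) (w y)

/-- Expand the product of differences in the commutator. The two terms carrying f(x) vanish, one
because w is divergence free and the other because ∇k has integral zero; the term f(y)w(x) is the
transport of the mollified density. -/
theorem IsMollifier.flux_eq (H : IsMollifier C ε k) (hf : Measurable f) (h0 : ∀ x, 0 ≤ f x)
    (hK : ∀ x, f x ≤ K) (hw : LocallyIntegrable w volume) (hdiv : IsWeaklyDivFree w) (x : Plane) :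
    H.flux f w x = H.comm f w x - fderiv ℝ (H.smooth f) x (w x) := by
  have hfl := locallyIntegrable_of_bounded hf h0 hK
  have hcD : Continuous fun y => - fderiv ℝ k (x - y) :=
    (H.continuous_fderiv.comp (by fun_prop)).neg
  have hsD : HasCompactSupport fun y => - fderiv ℝ k (x - y) :=
    ((H.hasCompactSupport.fderiv (𝕜 := ℝ)).comp_homeomorph (Homeomorph.subLeft x)).neg
  have i1 : Integrable fun y => (- fderiv ℝ k (x - y)) (w y) := integrable_clm_apply hw hcD hsD
  have i2 : Integrable fun y => (- fderiv ℝ k (x - y)) (w x) :=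
    integrable_clm_apply (locallyIntegrable_const (w x)) hcD hsD
  have hbd : ∀ {g : Plane → ℝ}, Integrable g → Integrable fun y => f y * g y := fun hg =>
    hg.bdd_mul (c := K) hf.aestronglyMeasurable (Filter.Eventually.of_forall fun y => by
      rw [Real.norm_of_nonneg (h0 y)]; exact hK y)
  have z1 : ∫ y, (- fderiv ℝ k (x - y)) (w y) = 0 := by
    rw [← hdiv.integral_fderiv_eq_zero (H.contDiff_sub_left x) (H.hasCompactSupport_sub_left x)]
    simp_rw [H.fderiv_sub_left]
  have z2 : ∫ y, (- fderiv ℝ k (x - y)) (w x) = 0 := by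
    simp only [neg_apply, integral_neg, H.integral_fderiv_eq_zero, neg_zero]
  have z3 : ∫ y, f y * (- fderiv ℝ k (x - y)) (w x) = - fderiv ℝ (H.smooth f) x (w x) := by
    rw [H.fderiv_smooth hfl]
    simp [integral_neg]
  have e : ∀ y, (f y - f x) * (- fderiv ℝ k (x - y)) (w y - w x)
      = (f y * (- fderiv ℝ k (x - y)) (w y) - f y * (- fderiv ℝ k (x - y)) (w x))
        - (f x * (- fderiv ℝ k (x - y)) (w y) - f x * (- fderiv ℝ k (x - y)) (w x)) := by
    intro y
    rw [map_sub]
    ring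
  rw [IsMollifier.comm, integral_congr_ae (Filter.Eventually.of_forall e), integral_sub,
    integral_sub, integral_sub, integral_const_mul, integral_const_mul, z1, z2, z3,
    IsMollifier.flux]
  · ring
  · exact i1.const_mul _
  · exact i2.const_mul _
  · exact hbd i1
  · exact hbd i2
  · exact (hbd i1).sub (hbd i2)
  · exact (i1.const_mul _).sub (i2.const_mul _)

theorem IsMollifier.continuous_flux (H : IsMollifier C ε k) (hf : Measurable f)
    (h0 : ∀ x, 0 ≤ f x) (hK : ∀ x, f x ≤ K) (hw : LocallyIntegrable w volume) :
    Continuous (H.flux f w) := by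
  have hfw : LocallyIntegrable (fun y => f y • w y) volume := by
    rw [locallyIntegrable_iff_closedBall] at hw ⊢
    intro R
    exact Integrable.bdd_smul (φ := f) (hw R) K hf.aestronglyMeasurable
      (Filter.Eventually.of_forall fun y => by
        rw [Real.norm_of_nonneg (h0 y)]; exact hK y)
  have h := (H.hasCompactSupport.fderiv (𝕜 := ℝ)).neg.continuous_convolution_right
    (μ := volume) (ContinuousLinearMap.apply ℝ ℝ) hfw H.continuous_fderiv.neg
  convert h using 1
  funext x
  simp [IsMollifier.flux, convolution]

/-- Renormalization at one time: β'(f_ε) w·∇f_ε = w·∇(β(f_ε)) by the chain rule, which is legitimate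
since f_ε is smooth, and as w is divergence free the derivative can be moved onto ζ. -/
theorem IsMollifier.integral_flux_eq (H : IsMollifier C ε k) (hf : Measurable f)
    (h0 : ∀ x, 0 ≤ f x) (hK : ∀ x, f x ≤ K) (hw : LocallyIntegrable w volume)
    (hdiv : IsWeaklyDivFree w) {β : ℝ → ℝ} (hβ : ContDiff ℝ ∞ β) {ζ : Plane → ℝ}
    (hζ : ContDiff ℝ ∞ ζ) (hc : HasCompactSupport ζ) :
    ∫ x, ζ x * (deriv β (H.smooth f x) * H.flux f w x)
      = (∫ x, ζ x * (deriv β (H.smooth f x) * H.comm f w x))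
        + ∫ x, β (H.smooth f x) * fderiv ℝ ζ x (w x) := by
  have hfl := locallyIntegrable_of_bounded hf h0 hK
  have hs := H.contDiff_smooth hfl
  have hβs : ContDiff ℝ ∞ fun x => β (H.smooth f x) := hβ.comp hs
  have hdβ : Continuous fun x => deriv β (H.smooth f x) :=
    (hβ.continuous_deriv (by simp)).comp hs.continuous
  have c1 : ∀ g : Plane → ℝ, HasCompactSupport fun x => ζ x * g x := fun g => hc.mul_right (f' := g)
  have c2 : HasCompactSupport fun x => (ζ x * deriv β (H.smooth f x)) • fderiv ℝ (H.smooth f) x :=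
    HasCompactSupport.smul_right (f := fun x => ζ x * deriv β (H.smooth f x)) (c1 _)
  have c3 : HasCompactSupport fun x => β (H.smooth f x) • fderiv ℝ ζ x :=
    HasCompactSupport.smul_left (f := fun x => β (H.smooth f x)) (hc.fderiv (𝕜 := ℝ))
  have i1 : Integrable fun x => ζ x * (deriv β (H.smooth f x) * H.flux f w x) :=
    (hζ.continuous.mul (hdβ.mul (H.continuous_flux hf h0 hK hw))).integrable_of_hasCompactSupport
      (c1 _)
  have i2 : Integrable fun x => ((ζ x * deriv β (H.smooth f x)) • fderiv ℝ (H.smooth f) x) (w x) :=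
    integrable_clm_apply hw ((hζ.continuous.mul hdβ).smul (hs.continuous_fderiv (by simp)))
      c2
  have i3 : Integrable fun x => (β (H.smooth f x) • fderiv ℝ ζ x) (w x) :=
    integrable_clm_apply hw (hβs.continuous.smul (hζ.continuous_fderiv (by simp)))
      c3
  have hprod : ∀ x, fderiv ℝ (fun x => ζ x * β (H.smooth f x)) x (w x)
      = ((ζ x * deriv β (H.smooth f x)) • fderiv ℝ (H.smooth f) x) (w x)
        + (β (H.smooth f x) • fderiv ℝ ζ x) (w x) := by
    intro x
    have h1 := (hζ.differentiable (by simp) x).hasFDerivAt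
    have h2 := ((hβ.differentiable (by simp) (H.smooth f x)).hasDerivAt).comp_hasFDerivAt x
      (hs.differentiable (by simp) x).hasFDerivAt
    have h3 := (h1.mul h2).fderiv
    rw [show (fun x => ζ x * β (H.smooth f x)) = ζ * (β ∘ H.smooth f) from rfl, h3]
    simp
    ring
  have hz := hdiv.integral_fderiv_eq_zero (hζ.mul hβs) (c1 _)
  rw [integral_congr_ae (Filter.Eventually.of_forall hprod), integral_add i2 i3] at hz
  have e : ∀ x, ζ x * (deriv β (H.smooth f x) * H.comm f w x)
      = ζ x * (deriv β (H.smooth f x) * H.flux f w x)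
        + ((ζ x * deriv β (H.smooth f x)) • fderiv ℝ (H.smooth f) x) (w x) := by
    intro x
    rw [H.flux_eq hf h0 hK hw hdiv x]
    simp
    ring
  rw [integral_congr_ae (Filter.Eventually.of_forall e), integral_add i1 i2]
  simp only [smul_apply, smul_eq_mul] at hz ⊢
  linarith

end Commutator

/-! ### Quantitative estimates for mollification -/

/-- Mean oscillation of `f` at scale `ε`. -/
noncomputable def meanOsc (ε : ℝ) (f : Plane → ℝ) (x : Plane) : ℝ≥0∞ :=
  ENNReal.ofReal (ε ^ 2)⁻¹ * ∫⁻ h in Metric.ball (0 : Plane) ε, ‖f (x + h) - f x‖ₑ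

theorem lintegral_kernel_le {ε : ℝ} {q : Plane → ℝ≥0∞} {c : ℝ≥0∞} (hc : c ≠ ⊤)
    (hq : ∀ z, q z ≤ (Metric.ball (0 : Plane) ε).indicator (fun _ => c) z) (F : Plane → ℝ≥0∞)
    (x : Plane) : ∫⁻ y, F y * q (x - y) ≤ c * ∫⁻ h in Metric.ball (0 : Plane) ε, F (x + h) := by
  rw [← lintegral_const_mul' _ _ hc, ← lintegral_indicator Metric.isOpen_ball.measurableSet,
    ← lintegral_add_left_eq_self (μ := volume) (fun y => F y * q (x - y)) x]
  refine lintegral_mono fun h => ?_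
  have h1 := hq (x - (x + h))
  by_cases hh : h ∈ Metric.ball (0 : Plane) ε
  · rw [indicator_of_mem hh, mul_comm c]
    refine mul_le_mul_right (h1.trans (indicator_le_self _ _ _)) _
  · have h2 : x - (x + h) ∉ Metric.ball (0 : Plane) ε := by simpa using hh
    rw [indicator_of_notMem h2] at h1
    rw [indicator_of_notMem hh, le_antisymm h1 zero_le, mul_zero]

namespace IsMollifier
variable {C ε : ℝ} {k : Plane → ℝ}

theorem enorm_le_indicator (H : IsMollifier C ε k) (z : Plane) :
    ‖k z‖ₑ ≤ (Metric.ball (0 : Plane) ε).indicator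
      (fun _ => ENNReal.ofReal (C * (ε ^ 2)⁻¹)) z := by
  by_cases hz : z ∈ Metric.ball (0 : Plane) ε
  · rw [indicator_of_mem hz, Real.enorm_of_nonneg (H.nonneg z)]
    exact ENNReal.ofReal_le_ofReal (H.le z)
  · rw [H.support z (by simpa using hz)]
    simp

theorem enorm_fderiv_le_indicator (H : IsMollifier C ε k) (z : Plane) :
    ‖- fderiv ℝ k z‖ₑ ≤ (Metric.ball (0 : Plane) ε).indicator
      (fun _ => ENNReal.ofReal (C * (ε ^ 3)⁻¹)) z := by
  rw [enorm_neg]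
  by_cases hz : z ∈ Metric.ball (0 : Plane) ε
  · rw [indicator_of_mem hz, ← ofReal_norm]
    exact ENNReal.ofReal_le_ofReal (H.fderiv_le z)
  · have hmin : IsLocalMin k z := Filter.Eventually.of_forall fun y => by
      rw [H.support z (by simpa using hz)]
      exact H.nonneg y
    rw [hmin.fderiv_eq_zero]
    rw [← ofReal_norm, norm_zero, ENNReal.ofReal_zero]
    exact zero_le

theorem enorm_smooth_sub_le (H : IsMollifier C ε k) {f : Plane → ℝ}
    (hf : LocallyIntegrable f volume) (x : Plane) :
    ‖H.smooth f x - f x‖ₑ ≤ ENNReal.ofReal C * meanOsc ε f x := by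
  have i1 : Integrable fun y => f y * k (x - y) :=
    hf.integrable_smul_right_of_hasCompactSupport (H.contDiff_sub_left x).continuous
      (H.hasCompactSupport_sub_left x)
  have i2 : Integrable fun y => k (x - y) :=
    (H.contDiff_sub_left x).continuous.integrable_of_hasCompactSupport
      (H.hasCompactSupport_sub_left x)
  have e : H.smooth f x - f x = ∫ y, (f y - f x) * k (x - y) := by
    simp_rw [sub_mul]
    rw [integral_sub i1 (i2.const_mul _), integral_const_mul, H.integral_sub_left, mul_one]
    rfl
  rw [e]
  refine (enorm_integral_le_lintegral_enorm _).trans ?_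
  simp_rw [enorm_mul]
  refine (lintegral_kernel_le (by simp) H.enorm_le_indicator (fun y => ‖f y - f x‖ₑ) x).trans ?_
  rw [meanOsc, ENNReal.ofReal_mul' (by positivity), mul_assoc]

theorem enorm_comm_le (H : IsMollifier C ε k) (f : Plane → ℝ) (w : Plane → Plane) (x : Plane) :
    ‖H.comm f w x‖ₑ ≤ ENNReal.ofReal (C * (ε ^ 3)⁻¹)
      * ∫⁻ h in Metric.ball (0 : Plane) ε, ‖f (x + h) - f x‖ₑ * ‖w (x + h) - w x‖ₑ := by
  refine (enorm_integral_le_lintegral_enorm _).trans ?_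
  refine le_trans (lintegral_mono fun y => ?_)
    (lintegral_kernel_le (by simp) H.enorm_fderiv_le_indicator
      (fun y => ‖f y - f x‖ₑ * ‖w y - w x‖ₑ) x)
  rw [enorm_mul, mul_assoc]
  gcongr
  rw [mul_comm]
  exact ContinuousLinearMap.le_opENorm _ _

end IsMollifier

/-- Each h contributes at most |h|²‖G‖² ≤ ε²‖G‖², and the ball of radius ε has area at most 4ε². -/
theorem lintegral_lintegral_sub_sq_le {w : Plane → Plane} {G : Plane → GradVal Plane}
    (hw : StronglyMeasurable w) (hG : StronglyMeasurable G) (H : HasWeakGradient w G)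
    {ε : ℝ} (hε : 0 ≤ ε) (B : Set Plane) :
    ∫⁻ x in B, ∫⁻ h in Metric.ball (0 : Plane) ε, ‖w (x + h) - w x‖ₑ ^ 2
      ≤ ENNReal.ofReal (4 * ε ^ 4) * eLpNorm G 2 volume ^ 2 := by
  rw [lintegral_lintegral_swap]
  · calc _ ≤ ∫⁻ h in Metric.ball (0 : Plane) ε, ENNReal.ofReal (ε ^ 2) * eLpNorm G 2 volume ^ 2 := by
          refine setLIntegral_mono' Metric.isOpen_ball.measurableSet fun h hh => ?_
          refine (setLIntegral_le_lintegral _ _).trans ((H.lintegral_sub_shift_sq_le hG h).trans ?_)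
          rw [eLpNorm_two_sq, ENNReal.ofReal_pow hε]
          gcongr
          rw [← ofReal_norm]
          exact ENNReal.ofReal_le_ofReal (mem_ball_zero_iff.1 hh).le
      _ ≤ _ := by
          rw [lintegral_const, Measure.restrict_apply_univ, mul_right_comm]
          gcongr
          refine (mul_le_mul_right (volume_ball_le 0 hε) _).trans ?_
          rw [← ENNReal.ofReal_mul (by positivity)]
          exact ENNReal.ofReal_le_ofReal (le_of_eq (by ring))
  · exact ((((hw.comp_measurable (by fun_prop)).sub
      (hw.comp_measurable (by fun_prop))).enorm).pow_const 2).aemeasurable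

theorem le_of_sq_le_sq_ennreal {a b : ℝ≥0∞} (h : a ^ 2 ≤ b ^ 2) : a ≤ b :=
  (ENNReal.pow_le_pow_left_iff two_ne_zero).1 h

theorem rpow_half_sq (a : ℝ≥0∞) : (a ^ (1 / 2 : ℝ)) ^ 2 = a := by
  rw [← ENNReal.rpow_ofNat, ← ENNReal.rpow_mul]
  norm_num

theorem lintegral_lintegral_mul_sub_sq_le {w : Plane → Plane} {G : Plane → GradVal Plane}
    (hw : StronglyMeasurable w) (hG : StronglyMeasurable G) (H : HasWeakGradient w G)
    {ε : ℝ} (hε : 0 ≤ ε) (B : Set Plane) {F : Plane × Plane → ℝ≥0∞} (hF : Measurable F) :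
    (∫⁻ x in B, ∫⁻ h in Metric.ball (0 : Plane) ε, F (x, h) * ‖w (x + h) - w x‖ₑ) ^ 2
      ≤ (∫⁻ x in B, ∫⁻ h in Metric.ball (0 : Plane) ε, F (x, h) ^ 2)
        * (ENNReal.ofReal (4 * ε ^ 4) * eLpNorm G 2 volume ^ 2) := by
  have hm : Measurable fun z : Plane × Plane => ‖w (z.1 + z.2) - w z.1‖ₑ :=
    ((hw.comp_measurable (by fun_prop)).sub (hw.comp_measurable (by fun_prop))).enorm
  have h := sq_lintegral_mul_le (μ := (volume.restrict B).prod
    (volume.restrict (Metric.ball (0 : Plane) ε))) hF.aemeasurable hm.aemeasurable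
  rw [lintegral_prod (fun z => F z * ‖w (z.1 + z.2) - w z.1‖ₑ) (hF.mul hm).aemeasurable, lintegral_prod _ (hF.pow_const 2).aemeasurable,
    lintegral_prod _ (hm.pow_const 2).aemeasurable] at h
  exact h.trans (mul_le_mul_right (lintegral_lintegral_sub_sq_le hw hG H hε B) _)

/-! ### Commutator and flux estimates at a fixed time -/

section Static

variable {C ε K : ℝ} {k : Plane → ℝ} {f : Plane → ℝ} {w : Plane → Plane} {G : Plane → GradVal Plane}

/-- The DiPerna–Lions commutator estimate. The kernel gradient costs ε^(-3). By Cauchy–Schwarz the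
differences of w give 2ε²‖G‖, and |f(x+h) - f(x)|² ≤ K|f(x+h) - f(x)| gives ε√K times the root of
the mean oscillation. The powers of ε cancel, and the remaining oscillation tends to zero with ε. -/
theorem IsMollifier.lintegral_comm_le (H : IsMollifier C ε k) (hC : 0 ≤ C) (hf : Measurable f)
    (h0 : ∀ x, 0 ≤ f x) (hK : ∀ x, f x ≤ K) (hw : StronglyMeasurable w)
    (hG : StronglyMeasurable G) (hwG : HasWeakGradient w G) (B : Set Plane) :
    ∫⁻ x in B, ‖H.comm f w x‖ₑ ≤ (ENNReal.ofReal (2 * C * √K) * eLpNorm G 2 volume)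
      * (∫⁻ x in B, meanOsc ε f x) ^ (1 / 2 : ℝ) := by
  have hε := H.scale_pos
  have hK0 : 0 ≤ K := (h0 0).trans (hK 0)
  refine le_of_sq_le_sq_ennreal ?_
  set c := ENNReal.ofReal (C * (ε ^ 3)⁻¹)
  have hm : Measurable fun z : Plane × Plane => ‖f (z.1 + z.2) - f z.1‖ₑ := by fun_prop
  have h1 : ∫⁻ x in B, ‖H.comm f w x‖ₑ ≤ c * ∫⁻ x in B, ∫⁻ h in Metric.ball (0 : Plane) ε,
      ‖f (x + h) - f x‖ₑ * ‖w (x + h) - w x‖ₑ := by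
    rw [← lintegral_const_mul' _ _ (by simp [c])]
    exact lintegral_mono fun x => H.enorm_comm_le f w x
  have h2 := lintegral_lintegral_mul_sub_sq_le hw hG hwG hε.le B hm
  have h3 : ∫⁻ x in B, ∫⁻ h in Metric.ball (0 : Plane) ε, ‖f (x + h) - f x‖ₑ ^ 2
      ≤ ENNReal.ofReal (K * ε ^ 2) * ∫⁻ x in B, meanOsc ε f x := by
    rw [← lintegral_const_mul' _ _ (by simp)]
    refine lintegral_mono fun x => ?_
    rw [meanOsc, ← mul_assoc, ← ENNReal.ofReal_mul (by positivity),
      show K * ε ^ 2 * (ε ^ 2)⁻¹ = K by field_simp, ← lintegral_const_mul' _ _ (by simp)]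
    refine lintegral_mono fun h => ?_
    rw [pow_two]
    gcongr
    rw [← ofReal_norm]
    refine ENNReal.ofReal_le_ofReal (abs_le.2 ⟨?_, ?_⟩)
    · linarith [h0 (x + h), hK x]
    · linarith [h0 x, hK (x + h)]
  calc _ ≤ (c * ∫⁻ x in B, ∫⁻ h in Metric.ball (0 : Plane) ε,
      ‖f (x + h) - f x‖ₑ * ‖w (x + h) - w x‖ₑ) ^ 2 := by gcongr
    _ ≤ c ^ 2 * ((ENNReal.ofReal (K * ε ^ 2) * ∫⁻ x in B, meanOsc ε f x)
        * (ENNReal.ofReal (4 * ε ^ 4) * eLpNorm G 2 volume ^ 2)) := by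
        rw [mul_pow]
        gcongr
        exact h2.trans (by gcongr)
    _ = (c ^ 2 * ENNReal.ofReal (K * ε ^ 2) * ENNReal.ofReal (4 * ε ^ 4))
        * eLpNorm G 2 volume ^ 2 * ∫⁻ x in B, meanOsc ε f x := by ring
    _ = _ := by
        rw [mul_pow, mul_pow, rpow_half_sq]
        congr 2
        rw [← ENNReal.ofReal_pow (by positivity), ← ENNReal.ofReal_mul (by positivity),
          ← ENNReal.ofReal_mul (by positivity), ← ENNReal.ofReal_pow (by positivity)]
        congr 1
        rw [mul_pow (2 * C), Real.sq_sqrt hK0]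
        field_simp
        ring

theorem IsMollifier.smooth_nonneg (H : IsMollifier C ε k) (h0 : ∀ x, 0 ≤ f x) (x : Plane) :
    0 ≤ H.smooth f x := integral_nonneg fun y => mul_nonneg (h0 y) (H.nonneg _)

theorem IsMollifier.smooth_le (H : IsMollifier C ε k) (hf : Measurable f) (h0 : ∀ x, 0 ≤ f x)
    (hK : ∀ x, f x ≤ K) (x : Plane) : H.smooth f x ≤ K := by
  have i2 : Integrable fun y => k (x - y) :=
    (H.contDiff_sub_left x).continuous.integrable_of_hasCompactSupport
      (H.hasCompactSupport_sub_left x)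
  calc H.smooth f x ≤ ∫ y, K * k (x - y) := by
        refine integral_mono ?_ (i2.const_mul _) fun y =>
          mul_le_mul_of_nonneg_right (hK y) (H.nonneg _)
        exact (locallyIntegrable_of_bounded hf h0 hK).integrable_smul_right_of_hasCompactSupport
          (H.contDiff_sub_left x).continuous (H.hasCompactSupport_sub_left x)
    _ = K := by rw [integral_const_mul, H.integral_sub_left, mul_one]

/-- Under the mollification |w(x)| is replaced by |w(y)| + |w(y) - w(x)|. The first part reproduces
f|w| because the kernel has mass one; the second is of order ε on a set of finite measure. Thus only
the integral of f|w| matters, and w itself need not be globally integrable. -/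
theorem IsMollifier.lintegral_smooth_mul_le (H : IsMollifier C ε k) (hC : 0 ≤ C)
    (hf : Measurable f) (h0 : ∀ x, 0 ≤ f x) (hK : ∀ x, f x ≤ K) (hw : StronglyMeasurable w)
    (hG : StronglyMeasurable G) (hwG : HasWeakGradient w G) {B : Set Plane} {V : ℝ} (hV : 0 ≤ V)
    (hB : volume B ≤ ENNReal.ofReal (V ^ 2)) :
    ∫⁻ x in B, ENNReal.ofReal (H.smooth f x) * ‖w x‖ₑ
      ≤ (∫⁻ y, ENNReal.ofReal (f y) * ‖w y‖ₑ)
        + ENNReal.ofReal (4 * K * C * ε * V) * eLpNorm G 2 volume := by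
  have hε := H.scale_pos
  have hK0 : 0 ≤ K := (h0 0).trans (hK 0)
  have hfl := locallyIntegrable_of_bounded hf h0 hK
  have hkm : Measurable k := H.contDiff.continuous.measurable
  have hwm : Measurable w := hw.measurable
  have hpt : ∀ x, ENNReal.ofReal (H.smooth f x) * ‖w x‖ₑ
      ≤ (∫⁻ y, ENNReal.ofReal (f y) * ‖w y‖ₑ * ENNReal.ofReal (k (x - y)))
        + ENNReal.ofReal (K * (C * (ε ^ 2)⁻¹))
          * ∫⁻ h in Metric.ball (0 : Plane) ε, 1 * ‖w (x + h) - w x‖ₑ := by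
    intro x
    have e1 : ENNReal.ofReal (H.smooth f x) = ∫⁻ y, ENNReal.ofReal (f y * k (x - y)) :=
      ofReal_integral_eq_lintegral_ofReal
        (hfl.integrable_smul_right_of_hasCompactSupport (H.contDiff_sub_left x).continuous
          (H.hasCompactSupport_sub_left x))
        (Filter.Eventually.of_forall fun y => mul_nonneg (h0 y) (H.nonneg _))
    rw [e1, ← lintegral_mul_const' _ _ enorm_ne_top]
    have e2 : ∀ y, ENNReal.ofReal (f y * k (x - y)) * ‖w x‖ₑ
        ≤ ENNReal.ofReal (f y) * ‖w y‖ₑ * ENNReal.ofReal (k (x - y))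
          + ENNReal.ofReal K * (‖w y - w x‖ₑ * ‖k (x - y)‖ₑ) := by
      intro y
      have : ‖w x‖ₑ ≤ ‖w y‖ₑ + ‖w y - w x‖ₑ := by
        rw [enorm_sub_rev]
        calc ‖w x‖ₑ = ‖w y + (w x - w y)‖ₑ := by congr 1; abel
          _ ≤ _ := enorm_add_le _ _
      rw [ENNReal.ofReal_mul (h0 y), Real.enorm_of_nonneg (H.nonneg _)]
      calc _ ≤ ENNReal.ofReal (f y) * ENNReal.ofReal (k (x - y)) * (‖w y‖ₑ + ‖w y - w x‖ₑ) := by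
            gcongr
        _ = ENNReal.ofReal (f y) * ‖w y‖ₑ * ENNReal.ofReal (k (x - y))
          + ENNReal.ofReal (f y) * (‖w y - w x‖ₑ * ENNReal.ofReal (k (x - y))) := by ring
        _ ≤ _ := by
            gcongr
            exact hK y
    refine (lintegral_mono e2).trans ?_
    rw [lintegral_add_left (by fun_prop)]
    gcongr
    rw [lintegral_const_mul' _ _ (by simp), ENNReal.ofReal_mul hK0, mul_assoc]
    gcongr
    simp only [one_mul]
    exact lintegral_kernel_le (by simp) H.enorm_le_indicator (fun y => ‖w y - w x‖ₑ) x
  refine (lintegral_mono hpt).trans ?_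
  rw [lintegral_add_left]
  · refine add_le_add ?_ ?_
    · refine (setLIntegral_le_lintegral _ _).trans ?_
      rw [lintegral_lintegral_swap]
      · refine lintegral_mono fun y => ?_
        rw [lintegral_const_mul _ (by fun_prop)]
        have : ∫⁻ x, ENNReal.ofReal (k (x - y)) = 1 := by
          rw [lintegral_sub_right_eq_self (fun z => ENNReal.ofReal (k z)) y,
            ← ofReal_integral_eq_lintegral_ofReal H.integrable
              (Filter.Eventually.of_forall H.nonneg), H.integral_eq, ENNReal.ofReal_one]
        rw [this, mul_one]
      · exact Measurable.aemeasurable (by fun_prop)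
    · refine le_of_sq_le_sq_ennreal ?_
      rw [lintegral_const_mul' _ _ (by simp), mul_pow]
      have h2 := lintegral_lintegral_mul_sub_sq_le hw hG hwG hε.le B
        (F := fun _ => 1) measurable_const
      have h3 : ∫⁻ x in B, ∫⁻ h in Metric.ball (0 : Plane) ε, (1 : ℝ≥0∞) ^ 2
          ≤ ENNReal.ofReal (4 * ε ^ 2 * V ^ 2) := by
        simp only [one_pow, lintegral_const, Measure.restrict_apply_univ, one_mul]
        rw [ENNReal.ofReal_mul (by positivity)]
        exact mul_le_mul' (volume_ball_le 0 hε.le) hB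
      calc _ ≤ ENNReal.ofReal (K * (C * (ε ^ 2)⁻¹)) ^ 2 * (ENNReal.ofReal (4 * ε ^ 2 * V ^ 2)
            * (ENNReal.ofReal (4 * ε ^ 4) * eLpNorm G 2 volume ^ 2)) := by
            gcongr
            exact h2.trans (by gcongr)
        _ = _ := by
            rw [← mul_assoc, ← mul_assoc, mul_pow, ← ENNReal.ofReal_pow (by positivity),
              ← ENNReal.ofReal_mul (by positivity), ← ENNReal.ofReal_mul (by positivity),
              ← ENNReal.ofReal_pow (by positivity)]
            congr 2
            field_simp
  · exact Measurable.lintegral_prod_right' (f := fun z : Plane × Plane =>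
      ENNReal.ofReal (f z.2) * ‖w z.2‖ₑ * ENNReal.ofReal (k (z.1 - z.2))) (by fun_prop)

/-- The commutator part is bounded by `IsMollifier.lintegral_comm_le`. In the part where ζ is
differentiated, β(s) ≤ s for s ≥ 0 leads back to f_ε|w|. -/
theorem IsMollifier.enorm_integral_flux_le (H : IsMollifier C ε k) (hC : 0 ≤ C)
    (hf : Measurable f) (h0 : ∀ x, 0 ≤ f x) (hK : ∀ x, f x ≤ K) (hw : StronglyMeasurable w)
    (hG : StronglyMeasurable G) (hwG : HasWeakGradient w G) (hdiv : IsWeaklyDivFree w)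
    {B : Set Plane} (hBm : MeasurableSet B) {V : ℝ} (hV : 0 ≤ V)
    (hB : volume B ≤ ENNReal.ofReal (V ^ 2))
    {β : ℝ → ℝ} (hβ : ContDiff ℝ ∞ β) (hβ0 : ∀ s, 0 ≤ s → |β s| ≤ s) {Cβ : ℝ}
    (hCβ : ∀ s, |deriv β s| ≤ Cβ) {ζ : Plane → ℝ} (hζ : ContDiff ℝ ∞ ζ)
    (hζB : ∀ x, x ∉ B → ζ x = 0 ∧ fderiv ℝ ζ x = 0) (hc : HasCompactSupport ζ)
    (hζ1 : ∀ x, |ζ x| ≤ 1) {b : ℝ} (hb : ∀ x, ‖fderiv ℝ ζ x‖ ≤ b) :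
    ‖∫ x, ζ x * (deriv β (H.smooth f x) * H.flux f w x)‖ₑ
      ≤ ENNReal.ofReal Cβ * ((ENNReal.ofReal (2 * C * √K) * eLpNorm G 2 volume)
          * (∫⁻ x in B, meanOsc ε f x) ^ (1 / 2 : ℝ))
        + ENNReal.ofReal b * ((∫⁻ y, ENNReal.ofReal (f y) * ‖w y‖ₑ)
          + ENNReal.ofReal (4 * K * C * ε * V) * eLpNorm G 2 volume) := by
  rw [H.integral_flux_eq hf h0 hK hwG.1 hdiv hβ hζ hc]
  refine (enorm_add_le _ _).trans (add_le_add ?_ ?_)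
  · refine (enorm_integral_le_lintegral_enorm _).trans ?_
    refine le_trans ?_ (mul_le_mul_right (H.lintegral_comm_le hC hf h0 hK hw hG hwG B) _)
    rw [← lintegral_const_mul' _ _ (by simp), ← lintegral_indicator hBm]
    refine lintegral_mono fun x => ?_
    by_cases hx : x ∈ B
    · rw [indicator_of_mem hx, enorm_mul, enorm_mul]
      have h1 : ‖ζ x‖ₑ ≤ 1 := by
        rw [← ofReal_norm, ← ENNReal.ofReal_one]
        exact ENNReal.ofReal_le_ofReal (hζ1 x)
      have h2 : ‖deriv β (H.smooth f x)‖ₑ ≤ ENNReal.ofReal Cβ := by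
        rw [← ofReal_norm]
        exact ENNReal.ofReal_le_ofReal (hCβ _)
      calc _ ≤ 1 * (ENNReal.ofReal Cβ * ‖H.comm f w x‖ₑ) := by gcongr
        _ = _ := one_mul _
    · rw [(hζB x hx).1]
      simp
  · refine (enorm_integral_le_lintegral_enorm _).trans ?_
    refine le_trans ?_ (mul_le_mul_right
      (H.lintegral_smooth_mul_le hC hf h0 hK hw hG hwG hV hB) _)
    rw [← lintegral_const_mul' _ _ (by simp), ← lintegral_indicator hBm]
    refine lintegral_mono fun x => ?_
    by_cases hx : x ∈ B
    · rw [indicator_of_mem hx, enorm_mul]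
      have h1 : ‖β (H.smooth f x)‖ₑ ≤ ENNReal.ofReal (H.smooth f x) := by
        rw [← ofReal_norm]
        exact ENNReal.ofReal_le_ofReal (hβ0 _ (H.smooth_nonneg h0 x))
      have h2 : ‖fderiv ℝ ζ x (w x)‖ₑ ≤ ENNReal.ofReal b * ‖w x‖ₑ := by
        refine (ContinuousLinearMap.le_opENorm _ _).trans ?_
        gcongr
        rw [← ofReal_norm]
        exact ENNReal.ofReal_le_ofReal (hb x)
      calc _ ≤ ENNReal.ofReal (H.smooth f x) * (ENNReal.ofReal b * ‖w x‖ₑ) := by gcongr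
        _ = _ := by ring
    · rw [(hζB x hx).2]
      simp

end Static

/-! ### Auxiliary functions -/

/-- Since β vanishes exactly on arguments at most one, the vanishing of β(ρ) expresses ρ ≤ 1.
Boundedness, bounded derivative and |β(s)| ≤ s make the error terms controllable. -/
theorem exists_renormalization : ∃ (β : ℝ → ℝ) (Cβ : ℝ), ContDiff ℝ ∞ β ∧ (∀ s, s ≤ 1 → β s = 0) ∧
    (∀ s, 1 < s → 0 < β s) ∧ (∀ s, 0 ≤ β s) ∧ (∀ s, β s ≤ 1) ∧ (∀ s, 0 ≤ s → |β s| ≤ s) ∧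
    ∀ s, |deriv β s| ≤ Cβ := by
  have hcd : ContDiff ℝ ∞ (fun s : ℝ => Real.smoothTransition (s - 1)) :=
    Real.smoothTransition.contDiff.comp (by fun_prop)
  have hcont : Continuous (deriv fun s : ℝ => Real.smoothTransition (s - 1)) :=
    hcd.continuous_deriv (by simp)
  obtain ⟨C, hC⟩ := (isCompact_Icc (a := (1 : ℝ)) (b := 2)).exists_bound_of_continuousOn
    hcont.continuousOn
  have hC0 : 0 ≤ C := (norm_nonneg _).trans (hC 1 (by simp))
  refine ⟨fun s => Real.smoothTransition (s - 1), C, hcd,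
    fun s hs => Real.smoothTransition.zero_of_nonpos (by linarith),
    fun s hs => Real.smoothTransition.pos_of_pos (by linarith),
    fun s => Real.smoothTransition.nonneg _, fun s => Real.smoothTransition.le_one _,
    fun s hs => ?_, fun s => ?_⟩
  · rw [abs_of_nonneg (Real.smoothTransition.nonneg _)]
    rcases le_total s 1 with h | h
    · rw [Real.smoothTransition.zero_of_nonpos (by linarith)]
      exact hs
    · exact (Real.smoothTransition.le_one _).trans h
  -- Outside [1,2] the transition is locally constant, so the bound of its derivative on this
  -- compact interval is global.
  · by_cases h : s ∈ Icc (1 : ℝ) 2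
    · exact hC s h
    · rw [mem_Icc, not_and_or, not_le, not_le] at h
      rcases h with h | h
      · have : (fun s : ℝ => Real.smoothTransition (s - 1)) =ᶠ[𝓝 s] fun _ => 0 := by
          filter_upwards [gt_mem_nhds h] with y hy
          exact Real.smoothTransition.zero_of_nonpos (by linarith)
        rw [this.deriv_eq]
        simpa using hC0
      · have : (fun s : ℝ => Real.smoothTransition (s - 1)) =ᶠ[𝓝 s] fun _ => 1 := by
          filter_upwards [lt_mem_nhds h] with y hy
          exact Real.smoothTransition.one_of_one_le (by linarith)
        rw [this.deriv_eq]
        simpa using hC0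

/-- `χ` is a smooth cutoff between the balls of radii `r` and `2 r` around `q`. -/
structure IsCutoff (c : ℝ) (q : Plane) (r : ℝ) (χ : Plane → ℝ) : Prop where
  contDiff : ContDiff ℝ ∞ χ
  nonneg : ∀ x, 0 ≤ χ x
  le_one : ∀ x, χ x ≤ 1
  eq_one : ∀ x ∈ Metric.ball q r, χ x = 1
  eq_zero : ∀ x, x ∉ Metric.ball q (2 * r) → χ x = 0
  fderiv_le : ∀ x, ‖fderiv ℝ χ x‖ ≤ c / r

theorem exists_isCutoff : ∃ c : ℝ, 0 ≤ c ∧ ∀ (q : Plane) (r : ℝ), 0 < r →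
    ∃ χ, IsCutoff c q r χ := by
  let η : ContDiffBump (0 : Plane) := ⟨1, 2, by norm_num, by norm_num⟩
  have hcd : ContDiff ℝ ∞ (η : Plane → ℝ) := η.contDiff
  obtain ⟨C, hC⟩ := (hcd.continuous_fderiv (by simp)).bounded_above_of_compact_support
    (η.hasCompactSupport.fderiv (𝕜 := ℝ))
  refine ⟨C, (norm_nonneg _).trans (hC 0), fun q r hr => ?_⟩
  have hd : ∀ x, HasFDerivAt (fun x => η (r⁻¹ • (x - q)))
      (r⁻¹ • fderiv ℝ η (r⁻¹ • (x - q))) x := by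
    intro x
    have h1 : HasFDerivAt (fun x : Plane => r⁻¹ • (x - q)) (r⁻¹ • ContinuousLinearMap.id ℝ Plane) x := by
      have := (r⁻¹ • ContinuousLinearMap.id ℝ Plane).hasFDerivAt (x := x - q)
      exact (this.comp x ((hasFDerivAt_id x).sub_const q)).congr_fderiv (by ext v; simp)
    have h2 := (hcd.differentiable (by simp) (r⁻¹ • (x - q))).hasFDerivAt.comp x h1
    refine h2.congr_fderiv ?_
    ext v
    simp
  have hn : ∀ x : Plane, ‖r⁻¹ • (x - q)‖ = r⁻¹ * dist x q := fun x => by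
    rw [norm_smul, Real.norm_of_nonneg (by positivity), dist_eq_norm]
  refine ⟨fun x => η (r⁻¹ • (x - q)), hcd.comp (by fun_prop), fun x => η.nonneg,
    fun x => η.le_one, fun x hx => ?_, fun x hx => ?_, fun x => ?_⟩
  · refine η.one_of_mem_closedBall ?_
    rw [mem_closedBall_zero_iff, hn, inv_mul_le_iff₀ hr]
    simpa [η] using (Metric.mem_ball.1 hx).le
  · refine η.zero_of_le_dist ?_
    rw [dist_zero_right, hn, le_inv_mul_iff₀ hr]
    simpa [η, mul_comm] using hx
  · rw [(hd x).fderiv, norm_smul, Real.norm_of_nonneg (by positivity), div_eq_inv_mul]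
    gcongr
    exact hC _

namespace IsCutoff
variable {c r : ℝ} {q : Plane} {χ : Plane → ℝ}

theorem hasCompactSupport (H : IsCutoff c q r χ) : HasCompactSupport χ :=
  HasCompactSupport.intro (isCompact_closedBall q (2 * r)) fun x hx =>
    H.eq_zero x fun h => hx (Metric.ball_subset_closedBall h)

theorem fderiv_eq_zero (H : IsCutoff c q r χ) {x : Plane} (hx : x ∉ Metric.ball q (2 * r)) :
    fderiv ℝ χ x = 0 := by
  have hmin : IsLocalMin χ x := Filter.Eventually.of_forall fun y => by
    rw [H.eq_zero x hx]
    exact H.nonneg y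
  exact hmin.fderiv_eq_zero

theorem hasCompactSupport_sq (H : IsCutoff c q r χ) : HasCompactSupport fun x => χ x ^ 2 :=
  H.hasCompactSupport.comp_left (g := fun y : ℝ => y ^ 2) (by simp)

theorem integrable_sq (H : IsCutoff c q r χ) : Integrable fun x => χ x ^ 2 :=
  (H.contDiff.continuous.pow 2).integrable_of_hasCompactSupport H.hasCompactSupport_sq

end IsCutoff

/-! ### Renormalization in time -/

/-- The chain rule (β(a))' = β'(a)J, integrated twice in time. Integration by parts against T - t,
which vanishes at T, avoids evaluating a at any particular time, where it is only known almost
everywhere. -/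
theorem integral_renormalized {a J : ℝ → ℝ} {a₀ CJ : ℝ}
    (hJ : AEStronglyMeasurable J (volume.restrict (Ioi (0 : ℝ))))
    (hJb : ∀ᵐ t ∂(volume.restrict (Ioi (0 : ℝ))), |J t| ≤ CJ)
    (ha : ∀ᵐ t ∂(volume.restrict (Ioi (0 : ℝ))), a t = a₀ + ∫ s in (0 : ℝ)..t, J s)
    {β : ℝ → ℝ} (hβ : ContDiff ℝ ∞ β) {Cβ : ℝ} (hCβ : ∀ s, |deriv β s| ≤ Cβ) {T : ℝ} (hT : 0 ≤ T) :
    ∫ t in Ioc 0 T, β (a t)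
      = T * β a₀ + ∫ t in Ioc 0 T, (T - t) * (deriv β (a t) * J t) := by
  set h : ℝ → ℝ := fun t => a₀ + ∫ s in (0 : ℝ)..t, J s with hh
  have hJi : IntervalIntegrable J volume 0 T := intervalIntegrable_of_ae_bound hJ hJb le_rfl hT
  have hCβ0 : 0 ≤ Cβ := (abs_nonneg _).trans (hCβ 0)
  have hJb' := (ae_restrict_iff' measurableSet_Ioi).1 hJb
  have hsubset : Ioc 0 T ⊆ Ioi 0 := fun x hx => hx.1
  have hlipβ : LipschitzWith Cβ.toNNReal β := by
    refine lipschitzWith_of_nnnorm_deriv_le (hβ.differentiable (by simp)) fun s => ?_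
    rw [← NNReal.coe_le_coe, coe_nnnorm, Real.coe_toNNReal _ hCβ0]
    exact hCβ s
  have hliph : LipschitzOnWith CJ.toNNReal h (uIcc 0 T) := by
    rw [uIcc_of_le hT]
    refine LipschitzOnWith.of_dist_le_mul fun x hx y hy => ?_
    rw [Real.dist_eq, hh]
    simp only [add_sub_add_left_eq_sub]
    have hi : ∀ z ∈ Icc 0 T, IntervalIntegrable J volume 0 z := fun z hz =>
      intervalIntegrable_of_ae_bound hJ hJb le_rfl hz.1
    rw [intervalIntegral.integral_interval_sub_left (hi x hx) (hi y hy), ← Real.norm_eq_abs]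
    refine intervalIntegral.norm_integral_le_of_norm_le_const_ae ?_
    filter_upwards [hJb'] with s hs hsm
    exact (hs ((le_min hy.1 hx.1).trans_lt hsm.1)).trans (Real.le_coe_toNNReal _)
  have hac1 : AbsolutelyContinuousOnInterval (fun t => β (h t)) 0 T :=
    (hlipβ.comp_lipschitzOnWith hliph).absolutelyContinuousOnInterval
  have hac2 : AbsolutelyContinuousOnInterval (fun t : ℝ => T - t) 0 T :=
    ContDiffOn.absolutelyContinuousOnInterval (by fun_prop)
  have hbp := hac2.integral_mul_deriv_eq_deriv_mul hac1
  have h0 : h 0 = a₀ := by simp [hh]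
  have e1 : ∫ t in (0 : ℝ)..T, (T - t) * deriv (fun t => β (h t)) t
      = ∫ t in Ioc 0 T, (T - t) * (deriv β (a t) * J t) := by
    rw [intervalIntegral.integral_of_le hT]
    refine integral_congr_ae ?_
    filter_upwards [ae_restrict_of_ae hJi.ae_hasDerivAt_integral,
      ae_restrict_of_ae_restrict_of_subset hsubset ha, ae_restrict_mem measurableSet_Ioc]
      with t ht hat htm
    have h1 : HasDerivAt h (J t) t := by
      have := ht (by rw [uIcc_of_le hT]; exact ⟨htm.1.le, htm.2⟩) 0 (by simp)
      exact this.const_add a₀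
    have h2 := ((hβ.differentiable (by simp) (h t)).hasDerivAt).comp t h1
    rw [show (fun t => β (h t)) = β ∘ h from rfl, h2.deriv, hat]
  have e2 : ∫ t in (0 : ℝ)..T, deriv (fun t : ℝ => T - t) t * β (h t)
      = - ∫ t in Ioc 0 T, β (a t) := by
    rw [intervalIntegral.integral_of_le hT, ← integral_neg]
    refine integral_congr_ae ?_
    filter_upwards [ae_restrict_of_ae_restrict_of_subset hsubset ha] with t hat
    rw [deriv_const_sub, hat]
    simp [hh]
  rw [e1, e2, h0] at hbp
  rw [hbp]
  ring

namespace BoundedTransport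

variable {ρ₀ : Plane → ℝ} {ρ : ℝ → Plane → ℝ} {u : ℝ → Plane → Plane} {K M C ε : ℝ}
  {k : Plane → ℝ}

theorem flux_mollifier (Hk : IsMollifier C ε k) (t : ℝ) (x : Plane) :
    _root_.flux ρ u (fun y => k (x - y)) t = Hk.flux (ρ t) (u t) x := by
  simp only [_root_.flux, IsMollifier.flux, Hk.fderiv_sub_left]

/-- The L² norm of ∇k(x - ·) does not depend on x, so the bound holds for all x at once, off the
null set of times of the energy bound. -/
theorem exists_mollified_flux_bound (H : BoundedTransport ρ₀ ρ u K M) (Hk : IsMollifier C ε k) :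
    ∃ C' : ℝ, ∀ᵐ t ∂(volume.restrict (Ioi (0 : ℝ))), ∀ x, |Hk.flux (ρ t) (u t) x| ≤ C' := by
  set B : ℝ≥0∞ := ENNReal.ofReal (M ^ 2) * (ENNReal.ofReal K * ∫⁻ x, ‖fderiv ℝ k x‖ₑ ^ 2) with hB
  have hBt : B ≠ ⊤ := by
    refine ENNReal.mul_ne_top (by simp) (ENNReal.mul_ne_top (by simp) ?_)
    have := Hk.continuous_fderiv.memLp_of_hasCompactSupport (μ := volume) (p := 2)
      (Hk.hasCompactSupport.fderiv (𝕜 := ℝ))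
    rw [← eLpNorm_two_sq]
    exact ENNReal.pow_ne_top this.2.ne
  refine ⟨√B.toReal, ?_⟩
  filter_upwards [H.energy] with t ht x
  rw [← flux_mollifier]
  refine Real.abs_le_sqrt ?_
  have hcont : Continuous (fderiv ℝ fun y => k (x - y)) :=
    (Hk.contDiff_sub_left x).continuous_fderiv (by simp)
  have h1 : ‖_root_.flux ρ u (fun y => k (x - y)) t‖ₑ ^ 2 ≤ B := by
    refine (pow_le_pow_left' (H.enorm_flux_le _ t) 2).trans
      ((H.sq_lintegral_momentum_le ht hcont.measurable.enorm).trans ?_)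
    have e : ∫⁻ x, ‖fderiv ℝ k x‖ₑ ^ 2 = ∫⁻ y, ‖fderiv ℝ (fun y => k (x - y)) y‖ₑ ^ 2 := by
      simp_rw [Hk.fderiv_sub_left, enorm_neg]
      exact (lintegral_sub_left_eq_self (fun z => ‖fderiv ℝ k z‖ₑ ^ 2) x).symm
    rw [hB, e, ← lintegral_const_mul' (ENNReal.ofReal K) _ (by simp)]
    refine mul_le_mul_right (lintegral_mono fun x => mul_le_mul_left ?_ _) _
    exact ENNReal.ofReal_le_ofReal (H.density_le t x)
  have h2 := ENNReal.toReal_mono hBt h1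
  rwa [ENNReal.toReal_pow, toReal_enorm, Real.norm_eq_abs, sq_abs] at h2

theorem stronglyMeasurable_smooth (H : BoundedTransport ρ₀ ρ u K M) (Hk : IsMollifier C ε k) :
    StronglyMeasurable fun z : ℝ × Plane => Hk.smooth (ρ z.1) z.2 := by
  refine StronglyMeasurable.integral_prod_right' (f := fun w : (ℝ × Plane) × Plane =>
    ρ w.1.1 w.2 * k (w.1.2 - w.2)) (Measurable.stronglyMeasurable ?_)
  have hk := Hk.contDiff.continuous.measurable
  exact (H.density_measurable.comp (g := Function.uncurry ρ)
    (f := fun w : (ℝ × Plane) × Plane => (w.1.1, w.2)) (by fun_prop)).mul (by fun_prop)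

theorem stronglyMeasurable_mollified_flux (H : BoundedTransport ρ₀ ρ u K M)
    (Hk : IsMollifier C ε k) :
    StronglyMeasurable fun z : ℝ × Plane => Hk.flux (ρ z.1) (u z.1) z.2 := by
  refine StronglyMeasurable.integral_prod_right' (f := fun w : (ℝ × Plane) × Plane =>
    ρ w.1.1 w.2 * (- fderiv ℝ k (w.1.2 - w.2)) (u w.1.1 w.2)) (Measurable.stronglyMeasurable ?_)
  have hk := Hk.continuous_fderiv.measurable
  refine (H.density_measurable.comp (g := Function.uncurry ρ)
    (f := fun w : (ℝ × Plane) × Plane => (w.1.1, w.2)) (by fun_prop)).mul ?_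
  have h1 : Measurable fun w : (ℝ × Plane) × Plane => u w.1.1 w.2 :=
    H.velocity_measurable.comp (g := Function.uncurry u)
      (f := fun w : (ℝ × Plane) × Plane => (w.1.1, w.2)) (by fun_prop)
  have h3 : Measurable fun w : (ℝ × Plane) × Plane => (- fderiv ℝ k (w.1.2 - w.2), u w.1.1 w.2) :=
    Measurable.prodMk (hk.comp (by fun_prop)).neg h1
  have h2 : Continuous fun p : (Plane →L[ℝ] ℝ) × Plane => p.1 p.2 :=
    isBoundedBilinearMap_apply.continuous
  exact h2.measurable.comp h3

theorem integral_renormalized_smooth (H : BoundedTransport ρ₀ ρ u K M) (Hk : IsMollifier C ε k)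
    {β : ℝ → ℝ} (hβ : ContDiff ℝ ∞ β) (hβ1 : ∀ s, s ≤ 1 → β s = 0) {Cβ : ℝ}
    (hCβ : ∀ s, |deriv β s| ≤ Cβ) {T : ℝ} (hT : 0 ≤ T) (x : Plane) :
    ∫ t in Ioc 0 T, β (Hk.smooth (ρ t) x)
      = ∫ t in Ioc 0 T, (T - t) * (deriv β (Hk.smooth (ρ t) x) * Hk.flux (ρ t) (u t) x) := by
  obtain ⟨C', hC'⟩ := H.exists_mollified_flux_bound Hk
  have h1 := H.ae_mass_eq (Hk.contDiff_sub_left x) (Hk.hasCompactSupport_sub_left x)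
  have h2 := integral_renormalized (a := fun t => Hk.smooth (ρ t) x)
    (J := _root_.flux ρ u (fun y => k (x - y))) (a₀ := Hk.smooth ρ₀ x) (CJ := C')
    (H.measurable_flux (Hk.contDiff_sub_left x)).aestronglyMeasurable
    (hC'.mono fun t ht => by rw [flux_mollifier]; exact ht x) h1 hβ hCβ hT
  -- The mollified initial density is still at most one, so β kills the initial term.
  rw [h2, hβ1 _ (Hk.smooth_le H.init_measurable H.init_nonneg H.init_le_one x)]
  simp only [flux_mollifier Hk, mul_zero, zero_add]

theorem integrable_renormalized_smooth (H : BoundedTransport ρ₀ ρ u K M)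
    (Hk : IsMollifier C ε k) {β : ℝ → ℝ} (hβ : Continuous β) (hβ0 : ∀ s, 0 ≤ β s)
    (hβle : ∀ s, β s ≤ 1) {ζ : Plane → ℝ} (hζ : Continuous ζ) (hζi : Integrable ζ)
    (μ : Measure ℝ) [IsFiniteMeasure μ] :
    Integrable (fun z : ℝ × Plane => ζ z.2 * β (Hk.smooth (ρ z.1) z.2)) (μ.prod volume) := by
  refine (hζi.norm.comp_snd μ).mono' ?_ (Filter.Eventually.of_forall fun z => ?_)
  · exact ((hζ.comp continuous_snd).stronglyMeasurable.mul
      (hβ.comp_stronglyMeasurable (H.stronglyMeasurable_smooth Hk))).aestronglyMeasurable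
  · rw [norm_mul, Real.norm_of_nonneg (hβ0 _)]
    exact mul_le_of_le_one_right (norm_nonneg _) (hβle _)

theorem integrable_renormalized_flux (H : BoundedTransport ρ₀ ρ u K M)
    (Hk : IsMollifier C ε k) {β' : ℝ → ℝ} (hβ : Continuous β') {Cβ : ℝ} (hCβ : ∀ s, |β' s| ≤ Cβ)
    (T : ℝ) {ζ : Plane → ℝ} (hζ : Continuous ζ) (hζi : Integrable ζ) :
    Integrable (fun z : ℝ × Plane => ζ z.2 * ((T - z.1) *
      (β' (Hk.smooth (ρ z.1) z.2) * Hk.flux (ρ z.1) (u z.1) z.2)))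
      ((volume.restrict (Ioc 0 T)).prod volume) := by
  obtain ⟨C', hC'⟩ := H.exists_mollified_flux_bound Hk
  have hae : ∀ᵐ z : ℝ × Plane ∂((volume.restrict (Ioc 0 T)).prod volume), z.1 ∈ Ioc 0 T ∧
      ∀ x, |Hk.flux (ρ z.1) (u z.1) x| ≤ C' := by
    have h0 : ∀ᵐ t ∂(volume.restrict (Ioc 0 T)), t ∈ Ioc 0 T ∧
        ∀ x, |Hk.flux (ρ t) (u t) x| ≤ C' := by
      filter_upwards [ae_restrict_mem measurableSet_Ioc,
        ae_restrict_of_ae_restrict_of_subset (fun x hx => hx.1 : Ioc 0 T ⊆ Ioi 0) hC'] with t h1 h2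
      exact ⟨h1, h2⟩
    exact Measure.quasiMeasurePreserving_fst.ae h0
  refine ((hζi.norm.comp_snd _).const_mul (T * (Cβ * C'))).mono' ?_ ?_
  · refine StronglyMeasurable.aestronglyMeasurable ?_
    refine (hζ.comp continuous_snd).stronglyMeasurable.mul ?_
    refine StronglyMeasurable.mul ?_
      ((hβ.comp_stronglyMeasurable (H.stronglyMeasurable_smooth Hk)).mul
        (H.stronglyMeasurable_mollified_flux Hk))
    exact Continuous.stronglyMeasurable (by fun_prop)
  · filter_upwards [hae] with z hz
    have hT1 : |T - z.1| ≤ T := abs_le.2 ⟨by linarith [hz.1.2, hz.1.1], by linarith [hz.1.1]⟩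
    have hCβ0 : 0 ≤ Cβ := (abs_nonneg _).trans (hCβ 0)
    rw [norm_mul, norm_mul, norm_mul, mul_comm]
    simp only [Real.norm_eq_abs]
    gcongr
    · exact (abs_nonneg _).trans hT1
    · exact hCβ _
    · exact hz.2 _

theorem integral_integral_renormalized_smooth (H : BoundedTransport ρ₀ ρ u K M)
    (Hk : IsMollifier C ε k)
    {β : ℝ → ℝ} (hβ : ContDiff ℝ ∞ β) (hβ1 : ∀ s, s ≤ 1 → β s = 0) (hβ0 : ∀ s, 0 ≤ β s)
    (hβle : ∀ s, β s ≤ 1) {Cβ : ℝ} (hCβ : ∀ s, |deriv β s| ≤ Cβ) {T : ℝ} (hT : 0 ≤ T)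
    {ζ : Plane → ℝ} (hζ : Continuous ζ) (hζi : Integrable ζ) :
    ∫ z, ζ z.2 * β (Hk.smooth (ρ z.1) z.2) ∂((volume.restrict (Ioc 0 T)).prod volume)
      = ∫ t in Ioc 0 T, ((T - t) *
          ∫ x, ζ x * (deriv β (Hk.smooth (ρ t) x) * Hk.flux (ρ t) (u t) x)) := by
  have i1 := H.integrable_renormalized_smooth Hk hβ.continuous hβ0 hβle hζ hζi
    (volume.restrict (Ioc 0 T))
  have i2 := H.integrable_renormalized_flux Hk (hβ.continuous_deriv (by simp)) hCβ T hζ hζi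
  rw [integral_prod_symm _ i1]
  have e1 : ∀ x, ∫ t in Ioc 0 T, ζ x * β (Hk.smooth (ρ t) x)
      = ∫ t in Ioc 0 T, ζ x * ((T - t) *
          (deriv β (Hk.smooth (ρ t) x) * Hk.flux (ρ t) (u t) x)) := fun x => by
    rw [integral_const_mul, integral_const_mul, H.integral_renormalized_smooth Hk hβ hβ1 hCβ hT]
  have e2 : ∀ t, ∫ x, ζ x * ((T - t) * (deriv β (Hk.smooth (ρ t) x) * Hk.flux (ρ t) (u t) x))
      = (T - t) * ∫ x, ζ x * (deriv β (Hk.smooth (ρ t) x) * Hk.flux (ρ t) (u t) x) := fun t => by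
    rw [← integral_const_mul]
    exact integral_congr_ae (Filter.Eventually.of_forall fun x => mul_left_comm _ _ _)
  simp only [e1]
  rw [← integral_prod_symm _ i2, integral_prod _ i2]
  simp only [e2]

theorem lintegral_renormalized_smooth_le (H : BoundedTransport ρ₀ ρ u K M)
    (Hk : IsMollifier C ε k)
    {β : ℝ → ℝ} (hβ : ContDiff ℝ ∞ β) (hβ1 : ∀ s, s ≤ 1 → β s = 0) (hβ0 : ∀ s, 0 ≤ β s)
    (hβle : ∀ s, β s ≤ 1) {Cβ : ℝ} (hCβ : ∀ s, |deriv β s| ≤ Cβ) {T : ℝ} (hT : 0 ≤ T)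
    {ζ : Plane → ℝ} (hζ : Continuous ζ) (hζi : Integrable ζ) (hζ0 : ∀ x, 0 ≤ ζ x) :
    ∫⁻ t in Ioc 0 T, ∫⁻ x, ENNReal.ofReal (ζ x * β (Hk.smooth (ρ t) x))
      ≤ ENNReal.ofReal T * ∫⁻ t in Ioc 0 T,
        ‖∫ x, ζ x * (deriv β (Hk.smooth (ρ t) x) * Hk.flux (ρ t) (u t) x)‖ₑ := by
  have i1 := H.integrable_renormalized_smooth Hk hβ.continuous hβ0 hβle hζ hζi
    (volume.restrict (Ioc 0 T))
  rw [← lintegral_prod (fun z : ℝ × Plane => ENNReal.ofReal (ζ z.2 * β (Hk.smooth (ρ z.1) z.2)))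
    i1.aestronglyMeasurable.aemeasurable.ennreal_ofReal,
    ← ofReal_integral_eq_lintegral_ofReal i1
      (Filter.Eventually.of_forall fun z => mul_nonneg (hζ0 _) (hβ0 _)),
    H.integral_integral_renormalized_smooth Hk hβ hβ1 hβ0 hβle hCβ hT hζ hζi,
    ← lintegral_const_mul' _ _ (by simp)]
  refine (Real.ofReal_le_enorm _).trans ((enorm_integral_le_lintegral_enorm _).trans
    (lintegral_mono_ae ?_))
  filter_upwards [ae_restrict_mem measurableSet_Ioc] with t ht
  rw [enorm_mul]
  refine mul_le_mul_left ?_ _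
  rw [← ofReal_norm]
  exact ENNReal.ofReal_le_ofReal (abs_le.2 ⟨by linarith [ht.2, ht.1], by linarith [ht.1]⟩)

end BoundedTransport

/-! ### The maximum principle for the density -/

/-- Lebesgue's differentiation theorem: almost every point is a Lebesgue point. -/
theorem tendsto_meanOsc {f : Plane → ℝ} (hf : LocallyIntegrable f volume) :
    ∀ᵐ x, Filter.Tendsto (fun ε : ℝ => meanOsc ε f x) (𝓝[>] 0) (𝓝 0) := by
  filter_upwards [(Besicovitch.vitaliFamily (volume : Measure Plane)).ae_tendsto_average_norm_sub hf]
    with x hx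
  have h1 := hx.comp (Besicovitch.tendsto_filterAt volume x)
  have h2 : Filter.Tendsto (fun ε : ℝ => ENNReal.ofReal 4 * ENNReal.ofReal
      (⨍ y in Metric.closedBall x ε, ‖f y - f x‖)) (𝓝[>] 0) (𝓝 0) := by
    have h3 := ENNReal.Tendsto.const_mul (a := ENNReal.ofReal 4)
      (ENNReal.tendsto_ofReal h1) (Or.inr (by simp))
    simpa using h3
  refine tendsto_of_tendsto_of_tendsto_of_le_of_le' tendsto_const_nhds h2
    (Filter.Eventually.of_forall fun _ => zero_le) ?_
  filter_upwards [self_mem_nhdsWithin] with ε hε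
  have hε0 : (0 : ℝ) < ε := hε
  have hint : IntegrableOn (fun y => ‖f y - f x‖) (Metric.closedBall x ε) :=
    ((hf.sub (locallyIntegrable_const (f x))).integrableOn_isCompact
      (isCompact_closedBall _ _)).norm
  have e1 : ∫⁻ h in Metric.ball (0 : Plane) ε, ‖f (x + h) - f x‖ₑ
      = ∫⁻ y in Metric.ball x ε, ‖f y - f x‖ₑ := by
    rw [← lintegral_indicator Metric.isOpen_ball.measurableSet,
      ← lintegral_indicator Metric.isOpen_ball.measurableSet,
      ← lintegral_add_left_eq_self (μ := volume)
        (fun y => (Metric.ball x ε).indicator (fun y => ‖f y - f x‖ₑ) y) x]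
    refine lintegral_congr fun h => ?_
    by_cases hh : h ∈ Metric.ball (0 : Plane) ε
    · have : x + h ∈ Metric.ball x ε := by simpa using hh
      rw [indicator_of_mem hh, indicator_of_mem this]
    · have : x + h ∉ Metric.ball x ε := by simpa using hh
      rw [indicator_of_notMem hh, indicator_of_notMem this]
  have e2 : ∫⁻ y in Metric.ball x ε, ‖f y - f x‖ₑ
      ≤ ENNReal.ofReal (∫ y in Metric.closedBall x ε, ‖f y - f x‖) := by
    rw [ofReal_integral_eq_lintegral_ofReal hint
      (Filter.Eventually.of_forall fun y => norm_nonneg _)]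
    simp only [ofReal_norm]
    exact lintegral_mono_set Metric.ball_subset_closedBall
  have e3 : ∫ y in Metric.closedBall x ε, ‖f y - f x‖
      ≤ (4 * ε ^ 2) * ⨍ y in Metric.closedBall x ε, ‖f y - f x‖ := by
    have hv : volume.real (Metric.closedBall x ε) ≤ 4 * ε ^ 2 := by
      rw [Measure.real, Measure.addHaar_closedBall_eq_addHaar_ball]
      exact ENNReal.toReal_le_of_le_ofReal (by positivity) (volume_ball_le x hε0.le)
    have hv0 : 0 < volume.real (Metric.closedBall x ε) :=
      ENNReal.toReal_pos (Metric.measure_closedBall_pos _ _ hε0).ne' measure_closedBall_lt_top.ne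
    rw [setAverage_eq, smul_eq_mul]
    have hI : 0 ≤ ∫ y in Metric.closedBall x ε, ‖f y - f x‖ :=
      integral_nonneg fun y => norm_nonneg _
    rw [← mul_assoc, ← div_eq_mul_inv]
    exact le_mul_of_one_le_left hI ((one_le_div hv0).2 hv)
  rw [meanOsc, e1]
  calc _ ≤ ENNReal.ofReal (ε ^ 2)⁻¹ * ENNReal.ofReal
        ((4 * ε ^ 2) * ⨍ y in Metric.closedBall x ε, ‖f y - f x‖) := by
        gcongr
        exact e2.trans (ENNReal.ofReal_le_ofReal e3)
    _ = _ := by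
        rw [← ENNReal.ofReal_mul (by positivity), ← ENNReal.ofReal_mul (by norm_num)]
        congr 1
        field_simp

theorem meanOsc_le {f : Plane → ℝ} {K ε : ℝ} (h0 : ∀ x, 0 ≤ f x) (hK : ∀ x, f x ≤ K)
    (hε : 0 < ε) (x : Plane) : meanOsc ε f x ≤ ENNReal.ofReal (4 * K) := by
  have hK0 : 0 ≤ K := (h0 0).trans (hK 0)
  rw [meanOsc]
  calc _ ≤ ENNReal.ofReal (ε ^ 2)⁻¹ * ∫⁻ h in Metric.ball (0 : Plane) ε, ENNReal.ofReal K := by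
        gcongr with h
        rw [← ofReal_norm]
        refine ENNReal.ofReal_le_ofReal (abs_le.2 ⟨?_, ?_⟩)
        · linarith [h0 (x + h), hK x]
        · linarith [h0 x, hK (x + h)]
    _ ≤ ENNReal.ofReal (ε ^ 2)⁻¹ * (ENNReal.ofReal K * ENNReal.ofReal (4 * ε ^ 2)) := by
        rw [lintegral_const, Measure.restrict_apply_univ]
        gcongr
        exact volume_ball_le 0 hε.le
    _ = _ := by
        rw [← ENNReal.ofReal_mul hK0, ← ENNReal.ofReal_mul (by positivity)]
        congr 1
        field_simp

namespace BoundedTransport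

variable {ρ₀ : Plane → ℝ} {ρ : ℝ → Plane → ℝ} {u : ℝ → Plane → Plane} {K M C ε : ℝ}
  {k : Plane → ℝ} {G : ℝ → Plane → GradVal Plane}

theorem locallyIntegrable_slice (H : BoundedTransport ρ₀ ρ u K M) (t : ℝ) :
    LocallyIntegrable (ρ t) volume :=
  locallyIntegrable_of_bounded (H.measurable_density_slice t) (H.density_nonneg t) (H.density_le t)

theorem measurable_meanOsc (H : BoundedTransport ρ₀ ρ u K M) (ε : ℝ) :
    Measurable fun z : ℝ × Plane => meanOsc ε (ρ z.1) z.2 := by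
  refine Measurable.const_mul ?_ _
  refine Measurable.lintegral_prod_right' (f := fun w : (ℝ × Plane) × Plane =>
    ‖ρ w.1.1 (w.1.2 + w.2) - ρ w.1.1 w.1.2‖ₑ) ?_
  have h1 : Measurable fun w : (ℝ × Plane) × Plane => ρ w.1.1 (w.1.2 + w.2) :=
    H.density_measurable.comp (g := Function.uncurry ρ)
      (f := fun w : (ℝ × Plane) × Plane => (w.1.1, w.1.2 + w.2)) (by fun_prop)
  have h2 : Measurable fun w : (ℝ × Plane) × Plane => ρ w.1.1 w.1.2 :=
    H.density_measurable.comp (g := Function.uncurry ρ)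
      (f := fun w : (ℝ × Plane) × Plane => (w.1.1, w.1.2)) (by fun_prop)
  exact (h1.sub h2).enorm

theorem tendsto_lintegral_meanOsc (H : BoundedTransport ρ₀ ρ u K M) (T : ℝ) {B : Set Plane}
    (hB : volume B ≠ ⊤) : Filter.Tendsto
      (fun n : ℕ => ∫⁻ t in Ioc 0 T, ∫⁻ x in B, meanOsc (1 / ((n : ℝ) + 1)) (ρ t) x)
      Filter.atTop (𝓝 0) := by
  have hseq : Filter.Tendsto (fun n : ℕ => 1 / ((n : ℝ) + 1)) Filter.atTop (𝓝[>] 0) :=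
    tendsto_nhdsWithin_iff.2 ⟨tendsto_one_div_add_atTop_nhds_zero_nat,
      Filter.Eventually.of_forall fun n => mem_Ioi.2 (by positivity)⟩
  have hpos : ∀ n : ℕ, 0 < 1 / ((n : ℝ) + 1) := fun n => by positivity
  have hin : ∀ t, Filter.Tendsto (fun n : ℕ => ∫⁻ x in B, meanOsc (1 / ((n : ℝ) + 1)) (ρ t) x)
      Filter.atTop (𝓝 0) := by
    intro t
    have := tendsto_lintegral_of_dominated_convergence (μ := volume.restrict B)
      (F := fun (n : ℕ) x => meanOsc (1 / ((n : ℝ) + 1)) (ρ t) x) (f := fun _ => 0)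
      (fun _ => ENNReal.ofReal (4 * K))
      (fun n => (H.measurable_meanOsc _).comp measurable_prodMk_left)
      (fun n => Filter.Eventually.of_forall fun x =>
        meanOsc_le (H.density_nonneg t) (H.density_le t) (hpos n) x)
      (by
        rw [lintegral_const, Measure.restrict_apply_univ]
        exact ENNReal.mul_ne_top ENNReal.ofReal_ne_top hB)
      (ae_restrict_of_ae ((tendsto_meanOsc (H.locallyIntegrable_slice t)).mono
        fun x hx => hx.comp hseq))
    simpa using this
  have := tendsto_lintegral_of_dominated_convergence (μ := volume.restrict (Ioc 0 T))
      (F := fun (n : ℕ) t => ∫⁻ x in B, meanOsc (1 / ((n : ℝ) + 1)) (ρ t) x) (f := fun _ => 0)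
      (fun _ => ENNReal.ofReal (4 * K) * volume B)
      (fun n => (H.measurable_meanOsc _).lintegral_prod_right')
      (fun n => Filter.Eventually.of_forall fun t => by
        refine (lintegral_mono fun x =>
          meanOsc_le (H.density_nonneg t) (H.density_le t) (hpos n) x).trans ?_
        simp)
      (by
        rw [lintegral_const, Measure.restrict_apply_univ]
        exact ENNReal.mul_ne_top (ENNReal.mul_ne_top ENNReal.ofReal_ne_top hB) (by simp))
      (Filter.Eventually.of_forall hin)
  simpa using this

/-- The Lipschitz bound for β replaces ρ by its mollification at the cost of a mean oscillation; the
estimates at fixed times are then integrated, with Cauchy–Schwarz in time for the commutator. -/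
theorem lintegral_renormalized_le (H : BoundedTransport ρ₀ ρ u K M)
    (hGm : Measurable (Function.uncurry G))
    (hgrad : ∀ᵐ t ∂(volume.restrict (Ioi (0 : ℝ))), HasWeakGradient (u t) (G t))
    (hdiv : ∀ᵐ t ∂(volume.restrict (Ioi (0 : ℝ))), IsWeaklyDivFree (u t))
    (Hk : IsMollifier C ε k) (hC : 0 ≤ C)
    {β : ℝ → ℝ} (hβ : ContDiff ℝ ∞ β) (hβ1 : ∀ s, s ≤ 1 → β s = 0) (hβ0 : ∀ s, 0 ≤ β s)
    (hβle : ∀ s, β s ≤ 1) (hβs : ∀ s, 0 ≤ s → |β s| ≤ s) {Cβ : ℝ} (hCβ : ∀ s, |deriv β s| ≤ Cβ)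
    {T : ℝ} (hT : 0 ≤ T) {c r : ℝ} (hr : 0 ≤ r) {q : Plane} {ζ : Plane → ℝ} (Hζ : IsCutoff c q r ζ) :
    ∫⁻ t in Ioc 0 T, ∫⁻ x, ENNReal.ofReal (ζ x * β (ρ t x))
      ≤ ENNReal.ofReal T * (ENNReal.ofReal Cβ * (ENNReal.ofReal (2 * C * √K)
            * ((∫⁻ t in Ioc 0 T, ∫⁻ x, ‖G t x‖ₑ ^ 2) ^ (1 / 2 : ℝ)
            * (∫⁻ t in Ioc 0 T, ∫⁻ x in Metric.ball q (2 * r), meanOsc ε (ρ t) x) ^ (1 / 2 : ℝ)))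
          + ENNReal.ofReal (c / r) * ((∫⁻ t in Ioc 0 T, ∫⁻ y, ENNReal.ofReal (ρ t y) * ‖u t y‖ₑ)
            + ENNReal.ofReal (4 * K * C * ε * (4 * r))
              * ∫⁻ t in Ioc 0 T, eLpNorm (G t) 2 volume))
        + ENNReal.ofReal (Cβ * C)
          * ∫⁻ t in Ioc 0 T, ∫⁻ x in Metric.ball q (2 * r), meanOsc ε (ρ t) x := by
  set B := Metric.ball q (2 * r) with hB
  have hsubset : Ioc 0 T ⊆ Ioi 0 := fun x hx => hx.1
  have hCβ0 : 0 ≤ Cβ := (abs_nonneg _).trans (hCβ 0)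
  have hζi : Integrable ζ := Hζ.contDiff.continuous.integrable_of_hasCompactSupport
    Hζ.hasCompactSupport
  have hGs : ∀ t, StronglyMeasurable (G t) := fun t =>
    (hGm.comp measurable_prodMk_left).stronglyMeasurable
  have hus : ∀ t, StronglyMeasurable (u t) := fun t =>
    (H.measurable_velocity_slice t).stronglyMeasurable
  have hVB : volume B ≤ ENNReal.ofReal ((4 * r) ^ 2) := by
    refine (volume_ball_le q (by positivity)).trans (ENNReal.ofReal_le_ofReal (le_of_eq (by ring)))
  have hOm : Measurable fun t => ∫⁻ x in B, meanOsc ε (ρ t) x :=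
    (H.measurable_meanOsc ε).lintegral_prod_right'
  have hGsq : Measurable fun t => ∫⁻ x, ‖G t x‖ₑ ^ 2 :=
    (hGm.enorm.pow_const 2).lintegral_prod_right'
  have hNeq : ∀ t, eLpNorm (G t) 2 volume = (∫⁻ x, ‖G t x‖ₑ ^ 2) ^ (1 / 2 : ℝ) := fun t => by
    rw [← eLpNorm_two_sq, ← ENNReal.rpow_ofNat, ← ENNReal.rpow_mul]
    norm_num
  have hNm : Measurable fun t => eLpNorm (G t) 2 volume := by
    simp_rw [hNeq]
    exact hGsq.pow_const _
  have hPm : Measurable fun t => ∫⁻ y, ENNReal.ofReal (ρ t y) * ‖u t y‖ₑ :=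
    Measurable.lintegral_prod_right' (f := fun z : ℝ × Plane =>
      ENNReal.ofReal (Function.uncurry ρ z) * ‖Function.uncurry u z‖ₑ)
      (H.density_measurable.ennreal_ofReal.mul H.velocity_measurable.enorm)
  -- comparison with the mollified density
  have hlip : ∀ s s', |β s - β s'| ≤ Cβ * |s - s'| := by
    have hlipβ : LipschitzWith Cβ.toNNReal β := by
      refine lipschitzWith_of_nnnorm_deriv_le (hβ.differentiable (by simp)) fun s => ?_
      rw [← NNReal.coe_le_coe, coe_nnnorm, Real.coe_toNNReal _ hCβ0]
      exact hCβ s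
    intro s s'
    have := hlipβ.dist_le_mul s s'
    rwa [Real.coe_toNNReal _ hCβ0] at this
  have hcmp : ∀ t x, ENNReal.ofReal (ζ x * β (ρ t x))
      ≤ ENNReal.ofReal (ζ x * β (Hk.smooth (ρ t) x))
        + B.indicator (fun x => ENNReal.ofReal (Cβ * C) * meanOsc ε (ρ t) x) x := by
    intro t x
    by_cases hx : x ∈ B
    · rw [indicator_of_mem hx]
      have h1 : ζ x * β (ρ t x) ≤ ζ x * β (Hk.smooth (ρ t) x)
          + Cβ * ‖Hk.smooth (ρ t) x - ρ t x‖ := by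
        have h2 := (abs_le.1 (hlip (ρ t x) (Hk.smooth (ρ t) x))).2
        have h3 := Hζ.nonneg x
        have h4 := Hζ.le_one x
        rw [← Real.norm_eq_abs, norm_sub_rev] at h2
        have h5 : 0 ≤ Cβ * ‖Hk.smooth (ρ t) x - ρ t x‖ := by positivity
        nlinarith
      refine (ENNReal.ofReal_le_ofReal h1).trans (ENNReal.ofReal_add_le.trans ?_)
      refine add_le_add le_rfl ?_
      rw [ENNReal.ofReal_mul hCβ0, ENNReal.ofReal_mul hCβ0, mul_assoc, ofReal_norm]
      exact mul_le_mul_right (Hk.enorm_smooth_sub_le (H.locallyIntegrable_slice t) x) _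
    · rw [Hζ.eq_zero x hx]
      simp
  have hstep1 : ∫⁻ t in Ioc 0 T, ∫⁻ x, ENNReal.ofReal (ζ x * β (ρ t x))
      ≤ (∫⁻ t in Ioc 0 T, ∫⁻ x, ENNReal.ofReal (ζ x * β (Hk.smooth (ρ t) x)))
        + ENNReal.ofReal (Cβ * C) * ∫⁻ t in Ioc 0 T, ∫⁻ x in B, meanOsc ε (ρ t) x := by
    rw [← lintegral_const_mul' _ _ (by simp), ← lintegral_add_right _ (hOm.const_mul _)]
    refine lintegral_mono fun t => ?_
    refine (lintegral_mono (hcmp t)).trans ?_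
    rw [lintegral_add_right, lintegral_indicator Metric.isOpen_ball.measurableSet,
      lintegral_const_mul' _ _ (by simp)]
    exact (((H.measurable_meanOsc ε).comp measurable_prodMk_left).const_mul _).indicator
      Metric.isOpen_ball.measurableSet
  have hstat : ∀ᵐ t ∂(volume.restrict (Ioc 0 T)),
      ‖∫ x, ζ x * (deriv β (Hk.smooth (ρ t) x) * Hk.flux (ρ t) (u t) x)‖ₑ
      ≤ ENNReal.ofReal Cβ * (ENNReal.ofReal (2 * C * √K) * (eLpNorm (G t) 2 volume
          * (∫⁻ x in B, meanOsc ε (ρ t) x) ^ (1 / 2 : ℝ)))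
        + ENNReal.ofReal (c / r) * ((∫⁻ y, ENNReal.ofReal (ρ t y) * ‖u t y‖ₑ)
          + ENNReal.ofReal (4 * K * C * ε * (4 * r)) * eLpNorm (G t) 2 volume) := by
    filter_upwards [ae_restrict_of_ae_restrict_of_subset hsubset hgrad,
      ae_restrict_of_ae_restrict_of_subset hsubset hdiv] with t h1 h2
    have := Hk.enorm_integral_flux_le hC (H.measurable_density_slice t) (H.density_nonneg t)
      (H.density_le t) (hus t) (hGs t) h1 h2 (B := B) Metric.isOpen_ball.measurableSet
      (V := 4 * r) (by positivity) hVB hβ hβs hCβ Hζ.contDiff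
      (fun x hx => ⟨Hζ.eq_zero x hx, Hζ.fderiv_eq_zero hx⟩) Hζ.hasCompactSupport
      (fun x => by rw [abs_of_nonneg (Hζ.nonneg x)]; exact Hζ.le_one x) Hζ.fderiv_le
    rwa [mul_assoc (ENNReal.ofReal (2 * C * √K))] at this
  have hCS : ∫⁻ t in Ioc 0 T, eLpNorm (G t) 2 volume
      * (∫⁻ x in B, meanOsc ε (ρ t) x) ^ (1 / 2 : ℝ)
      ≤ (∫⁻ t in Ioc 0 T, ∫⁻ x, ‖G t x‖ₑ ^ 2) ^ (1 / 2 : ℝ)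
        * (∫⁻ t in Ioc 0 T, ∫⁻ x in B, meanOsc ε (ρ t) x) ^ (1 / 2 : ℝ) := by
    refine le_of_sq_le_sq_ennreal ((sq_lintegral_mul_le hNm.aemeasurable
      (hOm.pow_const _).aemeasurable).trans (le_of_eq ?_))
    rw [mul_pow, rpow_half_sq, rpow_half_sq]
    simp only [rpow_half_sq, eLpNorm_two_sq]
  refine hstep1.trans (add_le_add ?_ le_rfl)
  refine (H.lintegral_renormalized_smooth_le Hk hβ hβ1 hβ0 hβle hCβ hT Hζ.contDiff.continuous hζi
    Hζ.nonneg).trans (mul_le_mul_right ((lintegral_mono_ae hstat).trans ?_) _)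
  rw [lintegral_add_left, lintegral_const_mul' _ _ (by simp), lintegral_const_mul' _ _ (by simp),
    lintegral_const_mul' _ _ (by simp), lintegral_add_left hPm, lintegral_const_mul' _ _ (by simp)]
  · exact add_le_add (mul_le_mul_right (mul_le_mul_right hCS _) _) le_rfl
  · exact ((hNm.mul (hOm.pow_const _)).const_mul _).const_mul _

/-- The limit ε → 0 along 1/(n+1) with the cutoff fixed: every term except the flux of ρ|u| through
the cutoff tends to zero. -/
theorem lintegral_renormalized_le_flux (H : BoundedTransport ρ₀ ρ u K M)
    (hGm : Measurable (Function.uncurry G))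
    (hgrad : ∀ᵐ t ∂(volume.restrict (Ioi (0 : ℝ))), HasWeakGradient (u t) (G t))
    (hdiv : ∀ᵐ t ∂(volume.restrict (Ioi (0 : ℝ))), IsWeaklyDivFree (u t))
    (hN : ∫⁻ t in Ioi (0 : ℝ), ∫⁻ x, ‖G t x‖ₑ ^ 2 ≠ ⊤)
    {β : ℝ → ℝ} (hβ : ContDiff ℝ ∞ β) (hβ1 : ∀ s, s ≤ 1 → β s = 0) (hβ0 : ∀ s, 0 ≤ β s)
    (hβle : ∀ s, β s ≤ 1) (hβs : ∀ s, 0 ≤ s → |β s| ≤ s) {Cβ : ℝ} (hCβ : ∀ s, |deriv β s| ≤ Cβ)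
    {T : ℝ} (hT : 0 ≤ T) {c r : ℝ} (hr : 0 ≤ r) {q : Plane} {ζ : Plane → ℝ} (Hζ : IsCutoff c q r ζ) :
    ∫⁻ t in Ioc 0 T, ∫⁻ x, ENNReal.ofReal (ζ x * β (ρ t x))
      ≤ ENNReal.ofReal T * (ENNReal.ofReal (c / r)
        * ∫⁻ t in Ioc 0 T, ∫⁻ y, ENNReal.ofReal (ρ t y) * ‖u t y‖ₑ) := by
  obtain ⟨C, hC, hk⟩ := exists_isMollifier
  have hN2 : ∫⁻ t in Ioc 0 T, ∫⁻ x, ‖G t x‖ₑ ^ 2 ≠ ⊤ :=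
    ((lintegral_mono_set (fun x hx => hx.1 : Ioc 0 T ⊆ Ioi 0)).trans_lt hN.lt_top).ne
  have hGsq : Measurable fun t => ∫⁻ x, ‖G t x‖ₑ ^ 2 :=
    (hGm.enorm.pow_const 2).lintegral_prod_right'
  have hN1 : ∫⁻ t in Ioc 0 T, eLpNorm (G t) 2 volume ≠ ⊤ := by
    have hNeq : ∀ t, eLpNorm (G t) 2 volume = (∫⁻ x, ‖G t x‖ₑ ^ 2) ^ (1 / 2 : ℝ) := fun t => by
      rw [← eLpNorm_two_sq, ← ENNReal.rpow_ofNat, ← ENNReal.rpow_mul]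
      norm_num
    have h1 := sq_lintegral_le (μ := volume.restrict (Ioc 0 T))
      (f := fun t => eLpNorm (G t) 2 volume) (by
        simp_rw [hNeq]
        exact (hGsq.pow_const _).aemeasurable)
    simp only [eLpNorm_two_sq] at h1
    intro htop
    rw [htop] at h1
    have h2 : (volume.restrict (Ioc 0 T)) univ * ∫⁻ t in Ioc 0 T, ∫⁻ x, ‖G t x‖ₑ ^ 2 ≠ ⊤ :=
      ENNReal.mul_ne_top (by simp) hN2
    simp at h1
    exact h2 (by simpa using h1)
  have hΩ := H.tendsto_lintegral_meanOsc T (B := Metric.ball q (2 * r)) measure_ball_lt_top.ne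
  have hseq : Filter.Tendsto (fun n : ℕ => 1 / ((n : ℝ) + 1)) Filter.atTop (𝓝 0) :=
    tendsto_one_div_add_atTop_nhds_zero_nat
  have hΩ2 : Filter.Tendsto (fun n : ℕ => (∫⁻ t in Ioc 0 T, ∫⁻ x in Metric.ball q (2 * r),
      meanOsc (1 / ((n : ℝ) + 1)) (ρ t) x) ^ (1 / 2 : ℝ)) Filter.atTop (𝓝 0) := by
    have := (ENNReal.continuous_rpow_const (y := 1 / 2)).tendsto 0 |>.comp hΩ
    simpa [Function.comp_def] using this
  have hε : Filter.Tendsto (fun n : ℕ => ENNReal.ofReal (4 * K * C * (1 / ((n : ℝ) + 1)) * (4 * r)))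
      Filter.atTop (𝓝 0) := by
    have := ENNReal.tendsto_ofReal ((hseq.const_mul (4 * K * C)).mul_const (4 * r))
    simpa using this
  have hlim := (ENNReal.Tendsto.const_mul (a := ENNReal.ofReal T)
    ((ENNReal.Tendsto.const_mul (a := ENNReal.ofReal Cβ)
      (ENNReal.Tendsto.const_mul (a := ENNReal.ofReal (2 * C * √K))
        (ENNReal.Tendsto.const_mul
          (a := (∫⁻ t in Ioc 0 T, ∫⁻ x, ‖G t x‖ₑ ^ 2) ^ (1 / 2 : ℝ)) hΩ2
          (Or.inr (ENNReal.rpow_ne_top_of_nonneg (by norm_num) hN2)))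
        (Or.inr (by simp))) (Or.inr (by simp))).add
      (ENNReal.Tendsto.const_mul (a := ENNReal.ofReal (c / r))
        ((tendsto_const_nhds (x := ∫⁻ t in Ioc 0 T, ∫⁻ y, ENNReal.ofReal (ρ t y) * ‖u t y‖ₑ)).add
          (ENNReal.Tendsto.mul_const (b := ∫⁻ t in Ioc 0 T, eLpNorm (G t) 2 volume) hε
            (Or.inr hN1))) (Or.inr (by simp)))) (Or.inr (by simp))).add
    (ENNReal.Tendsto.const_mul (a := ENNReal.ofReal (Cβ * C)) hΩ (Or.inr (by simp)))
  simp only [mul_zero, zero_mul, add_zero, zero_add] at hlim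
  refine ge_of_tendsto' hlim fun n => ?_
  obtain ⟨k, Hk⟩ := hk (1 / ((n : ℝ) + 1)) (by positivity)
  exact H.lintegral_renormalized_le hGm hgrad hdiv Hk hC hβ hβ1 hβ0 hβle hβs hCβ hT hr Hζ

end BoundedTransport

/-! ### The maximum principle for the density -/

theorem lintegral_le_of_forall_ball {f : Plane → ℝ≥0∞} (hf : Measurable f) {a : ℝ≥0∞}
    (h : ∀ n : ℕ, ∫⁻ x in Metric.ball 0 ((n : ℝ) + 1), f x ≤ a) : ∫⁻ x, f x ≤ a :=
  le_of_tendsto' ((aecover_ball (x := (0 : Plane)) (r := fun n : ℕ => (n : ℝ) + 1)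
    (Filter.tendsto_atTop_add_const_right _ _ tendsto_natCast_atTop_atTop)
    ).lintegral_tendsto_of_countably_generated hf.aemeasurable) h

namespace BoundedTransport

variable {ρ₀ : Plane → ℝ} {ρ : ℝ → Plane → ℝ} {u : ℝ → Plane → Plane} {K M : ℝ}
  {G : ℝ → Plane → GradVal Plane}

/-- `mass_bounds` is applied to cutoffs of radius n + 1, whose gradients are all bounded by c, and n
tends to infinity. -/
theorem exists_mass_bound (H : BoundedTransport ρ₀ ρ u K M) (hρ₀ : Integrable ρ₀) (T : ℝ) :
    ∃ m : ℝ, ∀ᵐ t ∂(volume.restrict (Ioc 0 T)), ∫⁻ x, ENNReal.ofReal (ρ t x) ≤ ENNReal.ofReal m := by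
  obtain ⟨c, hc, hcut⟩ := exists_isCutoff
  choose χ hχ using fun n : ℕ => hcut 0 ((n : ℝ) + 1) (by positivity)
  set A := ∫ x, ρ₀ x with hA
  have hM := H.energy_nonneg
  refine ⟨A + 2 * c * M * T * (√A + 2 * c * M * T), ?_⟩
  have hall := ae_all_iff.2 fun n => H.ae_mass_eq ((hχ n).contDiff.pow 2) (hχ n).hasCompactSupport_sq
  filter_upwards [ae_restrict_of_ae_restrict_of_subset (fun x hx => hx.1 : Ioc 0 T ⊆ Ioi 0) hall,
    ae_restrict_mem measurableSet_Ioc] with t ht htT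
  refine lintegral_le_of_forall_ball (H.measurable_density_slice t).ennreal_ofReal fun n => ?_
  have hb : ∀ x, ‖fderiv ℝ (χ n) x‖ ≤ c := fun x =>
    ((hχ n).fderiv_le x).trans (div_le_self hc (by linarith [n.cast_nonneg (α := ℝ)]))
  have hmb := (abs_le.1 (H.mass_bounds (hχ n).contDiff (hχ n).hasCompactSupport hb htT.1.le)).2
  have hsq : ∀ x, χ n x ^ 2 ≤ 1 := fun x => pow_le_one₀ ((hχ n).nonneg x) ((hχ n).le_one x)
  have haA : ∫ x, ρ₀ x * χ n x ^ 2 ≤ A := by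
    refine integral_mono_of_nonneg (Filter.Eventually.of_forall fun x =>
      mul_nonneg (H.init_nonneg x) (sq_nonneg _)) hρ₀ (Filter.Eventually.of_forall fun x => ?_)
    exact mul_le_of_le_one_right (H.init_nonneg x) (hsq x)
  have hT' : t ≤ T := htT.2
  have ht0 : 0 ≤ t := htT.1.le
  have hT0 : 0 ≤ T := ht0.trans hT'
  calc ∫⁻ x in Metric.ball 0 ((n : ℝ) + 1), ENNReal.ofReal (ρ t x)
      ≤ ∫⁻ x in Metric.ball 0 ((n : ℝ) + 1), ENNReal.ofReal (ρ t x * χ n x ^ 2) := by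
        refine setLIntegral_mono' measurableSet_ball fun x hx => ?_
        rw [(hχ n).eq_one x hx]
        simp
    _ ≤ ∫⁻ x, ENNReal.ofReal (ρ t x * χ n x ^ 2) := setLIntegral_le_lintegral _ _
    _ = ENNReal.ofReal (∫ x, ρ t x * χ n x ^ 2) :=
        (ofReal_integral_eq_lintegral_ofReal (H.integrable_density_mul t (hχ n).integrable_sq)
          (Filter.Eventually.of_forall fun x =>
            mul_nonneg (H.density_nonneg t x) (sq_nonneg _))).symm
    _ ≤ _ := by
        refine ENNReal.ofReal_le_ofReal ?_
        rw [ht n]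
        refine add_le_add haA (hmb.trans ?_)
        gcongr

/-- Cauchy–Schwarz between the finite mass and the finite kinetic energy, uniformly on (0,T]. -/
theorem lintegral_momentum_ne_top (H : BoundedTransport ρ₀ ρ u K M) (hρ₀ : Integrable ρ₀) (T : ℝ) :
    ∫⁻ t in Ioc 0 T, ∫⁻ y, ENNReal.ofReal (ρ t y) * ‖u t y‖ₑ ≠ ⊤ := by
  obtain ⟨m, hm⟩ := H.exists_mass_bound hρ₀ T
  have hle : ∀ᵐ t ∂(volume.restrict (Ioc 0 T)), ∫⁻ y, ENNReal.ofReal (ρ t y) * ‖u t y‖ₑ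
      ≤ (ENNReal.ofReal (M ^ 2) * ENNReal.ofReal m) ^ (1 / 2 : ℝ) := by
    filter_upwards [hm, ae_restrict_of_ae_restrict_of_subset
      (fun x hx => hx.1 : Ioc 0 T ⊆ Ioi 0) H.energy] with t h1 h2
    have h3 := H.sq_lintegral_momentum_le h2 (w := fun _ => 1) measurable_const
    simp only [mul_one, one_pow] at h3
    rw [← ENNReal.rpow_ofNat] at h3
    have h4 := ENNReal.rpow_le_rpow (h3.trans (mul_le_mul_right h1 _)) (z := 1 / 2) (by norm_num)
    rwa [← ENNReal.rpow_mul, show (2 : ℝ) * (1 / 2) = 1 by norm_num, ENNReal.rpow_one] at h4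
  refine ((lintegral_mono_ae hle).trans_lt ?_).ne
  rw [lintegral_const, Measure.restrict_apply_univ]
  refine ENNReal.mul_lt_top (ENNReal.rpow_lt_top_of_nonneg (by norm_num) ?_) (by simp)
  exact ENNReal.mul_ne_top ENNReal.ofReal_ne_top ENNReal.ofReal_ne_top

/-- A transported density which initially is at most one stays so. -/
theorem ae_density_le_one (H : BoundedTransport ρ₀ ρ u K M) (hρ₀ : Integrable ρ₀)
    (hGm : Measurable (Function.uncurry G))
    (hgrad : ∀ᵐ t ∂(volume.restrict (Ioi (0 : ℝ))), HasWeakGradient (u t) (G t))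
    (hdiv : ∀ᵐ t ∂(volume.restrict (Ioi (0 : ℝ))), IsWeaklyDivFree (u t))
    (hN : ∫⁻ t in Ioi (0 : ℝ), ∫⁻ x, ‖G t x‖ₑ ^ 2 ≠ ⊤) :
    ∀ᵐ t ∂(volume.restrict (Ioi (0 : ℝ))), ∀ᵐ x, ρ t x ≤ 1 := by
  obtain ⟨β, Cβ, hβ, hβ1, hβpos, hβ0, hβle, hβs, hCβ⟩ := exists_renormalization
  obtain ⟨c, hc, hcut⟩ := exists_isCutoff
  have hβm : Measurable fun z : ℝ × Plane => ENNReal.ofReal (β (ρ z.1 z.2)) :=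
    (hβ.continuous.measurable.comp H.density_measurable).ennreal_ofReal
  have hzero : ∀ T : ℕ, ∀ᵐ t ∂(volume.restrict (Ioc (0 : ℝ) T)), ∀ᵐ x, ρ t x ≤ 1 := by
    intro T
    have hT : (0 : ℝ) ≤ T := T.cast_nonneg
    have hI := H.lintegral_momentum_ne_top hρ₀ (T : ℝ)
    set I := ∫⁻ t in Ioc 0 (T : ℝ), ∫⁻ y, ENNReal.ofReal (ρ t y) * ‖u t y‖ₑ with hIdef
    have hball : ∀ n : ℕ, ∫⁻ t in Ioc 0 (T : ℝ), ∫⁻ x in Metric.ball 0 ((n : ℝ) + 1),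
        ENNReal.ofReal (β (ρ t x)) ≤ 0 := by
      intro n
      -- The ball is fixed while the cutoff radius k + 1 grows; the flux bound carries the factor
      -- c/(k+1) and a finite integral I.
      have hlim : Filter.Tendsto (fun k : ℕ => ENNReal.ofReal T *
          (ENNReal.ofReal (c / ((k : ℝ) + 1)) * I)) Filter.atTop (𝓝 0) := by
        have h1 : Filter.Tendsto (fun k : ℕ => c / ((k : ℝ) + 1)) Filter.atTop (𝓝 0) := by
          simpa [div_eq_mul_inv] using
            (tendsto_one_div_add_atTop_nhds_zero_nat (𝕜 := ℝ)).const_mul c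
        have h2 := ENNReal.Tendsto.const_mul (a := ENNReal.ofReal T)
          (ENNReal.Tendsto.mul_const (b := I) (ENNReal.tendsto_ofReal h1) (Or.inr hI))
          (Or.inr (by simp))
        simpa using h2
      refine ge_of_tendsto hlim ?_
      filter_upwards [Filter.eventually_ge_atTop n] with k hk
      obtain ⟨ζ, hζ⟩ := hcut 0 ((k : ℝ) + 1) (by positivity)
      refine le_trans ?_ (H.lintegral_renormalized_le_flux hGm hgrad hdiv hN hβ hβ1 hβ0 hβle hβs hCβ
        hT (by positivity) hζ)
      refine lintegral_mono fun t => ?_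
      refine le_trans (setLIntegral_mono' measurableSet_ball fun x hx => ?_)
        (setLIntegral_le_lintegral (Metric.ball (0 : Plane) ((n : ℝ) + 1)) _)
      rw [hζ.eq_one x (Metric.ball_subset_ball (by gcongr) hx), one_mul]
    have hae : ∀ᵐ t ∂(volume.restrict (Ioc (0 : ℝ) T)), ∀ n : ℕ,
        ∫⁻ x in Metric.ball 0 ((n : ℝ) + 1), ENNReal.ofReal (β (ρ t x)) = 0 := by
      refine ae_all_iff.2 fun n => ?_
      exact (lintegral_eq_zero_iff hβm.lintegral_prod_right').1 (nonpos_iff_eq_zero.1 (hball n))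
    filter_upwards [hae] with t ht
    have hmt : Measurable fun x => ENNReal.ofReal (β (ρ t x)) := hβm.comp measurable_prodMk_left
    have h0 := (lintegral_eq_zero_iff hmt).1
      (nonpos_iff_eq_zero.1 (lintegral_le_of_forall_ball hmt fun n => (ht n).le))
    filter_upwards [h0] with x hx
    by_contra! hlt
    simp only [Pi.zero_apply, ENNReal.ofReal_eq_zero] at hx
    exact absurd (hβpos _ hlt) (not_lt.2 hx)
  rw [ae_restrict_iff' measurableSet_Ioi]
  filter_upwards [ae_all_iff.2 fun T => (ae_restrict_iff' measurableSet_Ioc).1 (hzero T)] with t ht ht0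
  obtain ⟨n, hn⟩ := exists_nat_ge t
  exact ht n ⟨ht0, hn⟩

end BoundedTransport

/-! ### Measurable representatives of weak solutions -/

/-- An indicator equals its own square, so the initial energy ∫ρ₀|u₀|² is the square of ‖ρ₀u₀‖ in
L²; finiteness is needed because `momentumNorm` passes through `ENNReal.toNNReal`. -/
theorem lintegral_patch_energy (D : Set Plane) (u₀ : Plane → Plane) (hu₀ : MemLp u₀ 2 volume) :
    ∫⁻ x, ENNReal.ofReal (patchDensity D x) * ‖u₀ x‖ₑ ^ 2
      ≤ ENNReal.ofReal ((momentumNorm (patchDensity D) u₀ : ℝ) ^ 2) := by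
  have hle : eLpNorm (fun x => patchDensity D x • u₀ x) 2 volume ≤ eLpNorm u₀ 2 volume := by
    refine eLpNorm_mono_enorm fun x => ?_
    by_cases hx : x ∈ D <;> simp [patchDensity, hx]
  have hne : eLpNorm (fun x => patchDensity D x • u₀ x) 2 volume ≠ ⊤ :=
    (hle.trans_lt hu₀.2).ne
  rw [ENNReal.ofReal_pow (NNReal.coe_nonneg _), ENNReal.ofReal_coe_nnreal, momentumNorm,
    ENNReal.coe_toNNReal hne, eLpNorm_two_sq]
  refine lintegral_mono fun x => ?_
  by_cases hx : x ∈ D <;> simp [patchDensity, hx]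

namespace IsWeakSolutionWithGrad

variable {ρ₀ : Plane → ℝ} {u₀ : Plane → Plane} {ρ : ℝ → Plane → ℝ} {u : ℝ → Plane → Plane}
  {G : ℝ → Plane → GradVal Plane}

/-- Passage to Borel representatives, with the density clamped to [0,K], so that measurability and
bounds hold everywhere. Every condition is an integral or an almost everywhere statement on slices,
hence unaffected. -/
theorem exists_boundedTransport (H : IsWeakSolutionWithGrad ρ₀ u₀ ρ u G)
    (hρ₀ : Measurable ρ₀) (hnonneg : ∀ x, 0 ≤ ρ₀ x) (hle : ∀ x, ρ₀ x ≤ 1) {M : ℝ} (hM : 0 ≤ M)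
    (hE : ∫⁻ x, ENNReal.ofReal (ρ₀ x) * ‖u₀ x‖ₑ ^ 2 ≤ ENNReal.ofReal (M ^ 2)) :
    ∃ ρ' u' G' K, BoundedTransport ρ₀ ρ' u' K M ∧ Measurable (Function.uncurry G') ∧
      (∀ᵐ t ∂(volume.restrict (Ioi (0 : ℝ))), HasWeakGradient (u' t) (G' t)) ∧
      (∀ᵐ t ∂(volume.restrict (Ioi (0 : ℝ))), IsWeaklyDivFree (u' t)) ∧
      ∫⁻ t in Ioi (0 : ℝ), ∫⁻ x, ‖G' t x‖ₑ ^ 2 ≠ ⊤ ∧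
      ∀ᵐ t ∂(volume.restrict (Ioi (0 : ℝ))), ρ t =ᵐ[volume] ρ' t := by
  set K := (eLpNorm (Function.uncurry ρ) ⊤ spaceTime).toReal with hK
  have hK0 : 0 ≤ K := ENNReal.toReal_nonneg
  have hρm := H.density_bounded.1
  have hGm := H.gradient_memLp.1
  set r := hρm.mk _ with hr
  set w := H.velocity_measurable.mk _ with hw
  set g := hGm.mk _ with hg
  have hbd : ∀ᵐ z ∂spaceTime, |Function.uncurry ρ z| ≤ K := by
    have := enorm_ae_le_eLpNormEssSup (Function.uncurry ρ) spaceTime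
    filter_upwards [this] with z hz
    rw [← eLpNorm_exponent_top] at hz
    have h := ENNReal.toReal_mono H.density_bounded.2.ne hz
    rwa [toReal_enorm, Real.norm_eq_abs] at h
  have hρae : ∀ᵐ t ∂(volume.restrict (Ioi (0 : ℝ))),
      ρ t =ᵐ[volume] fun x => max 0 (min K (r (t, x))) := by
    refine Measure.ae_ae_of_ae_prod (p := fun z => ρ z.1 z.2 = max 0 (min K (r z))) ?_
    filter_upwards [hρm.ae_eq_mk, hbd, H.density_nonneg] with z h1 h2 h3
    have h2' : ρ z.1 z.2 ≤ K := (le_abs_self _).trans h2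
    rw [hr, ← h1]
    change ρ z.1 z.2 = max 0 (min K (ρ z.1 z.2))
    rw [min_eq_right h2', max_eq_right h3]
  have huae : ∀ᵐ t ∂(volume.restrict (Ioi (0 : ℝ))), u t =ᵐ[volume] fun x => w (t, x) :=
    Measure.ae_ae_of_ae_prod (p := fun z => u z.1 z.2 = w z) H.velocity_measurable.ae_eq_mk
  have hGae : ∀ᵐ t ∂(volume.restrict (Ioi (0 : ℝ))), G t =ᵐ[volume] fun x => g (t, x) :=
    Measure.ae_ae_of_ae_prod (p := fun z => G z.1 z.2 = g z) hGm.ae_eq_mk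
  have hgmeas : Measurable g := hGm.stronglyMeasurable_mk.measurable
  refine ⟨fun t x => max 0 (min K (r (t, x))), fun t x => w (t, x), fun t x => g (t, x), K,
    ⟨hM, hρ₀, hnonneg, hle, ?_, fun t x => le_max_left _ _,
      fun t x => max_le hK0 (min_le_left _ _), ?_, ?_, ?_⟩, hgmeas, ?_, ?_, ?_, hρae⟩
  · exact measurable_const.max (measurable_const.min hρm.stronglyMeasurable_mk.measurable)
  · exact H.velocity_measurable.stronglyMeasurable_mk.measurable
  · filter_upwards [hρae, huae, ae_restrict_mem measurableSet_Ioi] with t h1 h2 h3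
    -- The dissipation is dropped, and the factors 1/2 then cancel.
    have h4 := (le_self_add.trans (H.energy t (le_of_lt h3)))
    rw [ENNReal.mul_le_mul_iff_right (by simp) (by simp)] at h4
    refine le_trans (le_of_eq (lintegral_congr_ae ?_)) (h4.trans hE)
    filter_upwards [h1, h2] with x hx1 hx2
    rw [← hx1, ← hx2]
  · intro φ hφ hc
    rw [← H.continuity_eq φ hφ hc]
    congr 1
    · refine integral_congr_ae ?_
      filter_upwards [hρae] with t h1
      refine integral_congr_ae ?_
      filter_upwards [h1] with x hx
      rw [← hx]
    · refine integral_congr_ae ?_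
      filter_upwards [hρae, huae] with t h1 h2
      refine integral_congr_ae ?_
      filter_upwards [h1, h2] with x hx1 hx2
      rw [← hx1, ← hx2]
  · filter_upwards [H.gradient, huae, hGae] with t h h1 h2 using h.congr h1 h2
  · filter_upwards [H.div_free, huae] with t h h1 φ hφ hc
    rw [← h φ hφ hc]
    refine integral_congr_ae ?_
    filter_upwards [h1] with x hx
    rw [← hx]
  · have h1 : eLpNorm (Function.uncurry G) 2 spaceTime ^ 2 = ∫⁻ z, ‖g z‖ₑ ^ 2 ∂spaceTime := by
      rw [eLpNorm_congr_ae hGm.ae_eq_mk, eLpNorm_two_sq]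
    rw [← lintegral_prod _ (hgmeas.enorm.pow_const 2).aemeasurable, ← spaceTime, ← h1]
    exact ENNReal.pow_ne_top H.gradient_memLp.2.ne

end IsWeakSolutionWithGrad

/-! ### Admissible times -/

/-- At time `t` the density takes values in `[0,1]`, and its mass near the balls with centre in
a dense sequence and rational radius is bounded below by means of the initial density. -/
structure IsAdmissibleDensity (ρ₀ : Plane → ℝ) (c M : ℝ) (χ : Plane → ℝ → Plane → ℝ) (t : ℝ)
    (f : Plane → ℝ) : Prop where
  aemeasurable : AEMeasurable f volume
  nonneg : ∀ᵐ x, 0 ≤ f x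
  le_one : ∀ᵐ x, f x ≤ 1
  mass_ge : ∀ (n : ℕ) (r : ℚ), 0 < r →
    (∫ x, ρ₀ x * χ (TopologicalSpace.denseSeq Plane n) r x ^ 2)
        - 2 * (c / r) * M * t
          * (√(∫ x, ρ₀ x * χ (TopologicalSpace.denseSeq Plane n) r x ^ 2) + 2 * (c / r) * M * t)
      ≤ ∫ x, f x * χ (TopologicalSpace.denseSeq Plane n) r x ^ 2

/-- The mass identity fails on a null set of times that depends on the cutoff. Restricting to
countably many centres and radii leaves one null set for all of them. -/
theorem IsWeakSolutionWithGrad.ae_isAdmissibleDensity {ρ₀ : Plane → ℝ} {u₀ : Plane → Plane}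
    {ρ : ℝ → Plane → ℝ} {u : ℝ → Plane → Plane} {G : ℝ → Plane → GradVal Plane}
    (H : IsWeakSolutionWithGrad ρ₀ u₀ ρ u G)
    (hρ₀ : Measurable ρ₀) (hint : Integrable ρ₀) (hnonneg : ∀ x, 0 ≤ ρ₀ x) (hle : ∀ x, ρ₀ x ≤ 1)
    {M : ℝ} (hM : 0 ≤ M)
    (hE : ∫⁻ x, ENNReal.ofReal (ρ₀ x) * ‖u₀ x‖ₑ ^ 2 ≤ ENNReal.ofReal (M ^ 2))
    {c : ℝ} {χ : Plane → ℝ → Plane → ℝ} (hχ : ∀ q r, 0 < r → IsCutoff c q r (χ q r)) :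
    ∀ᵐ t ∂(volume.restrict (Ioi (0 : ℝ))), IsAdmissibleDensity ρ₀ c M χ t (ρ t) := by
  obtain ⟨ρ', u', G', K, hB, hGm, hgrad, hdiv, hN, heq⟩ :=
    H.exists_boundedTransport hρ₀ hnonneg hle hM hE
  have hmass : ∀ᵐ t ∂(volume.restrict (Ioi (0 : ℝ))), ∀ (n : ℕ) (r : ℚ), 0 < r →
      (∫ x, ρ₀ x * χ (TopologicalSpace.denseSeq Plane n) r x ^ 2)
          - 2 * (c / r) * M * t
            * (√(∫ x, ρ₀ x * χ (TopologicalSpace.denseSeq Plane n) r x ^ 2) + 2 * (c / r) * M * t)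
        ≤ ∫ x, ρ' t x * χ (TopologicalSpace.denseSeq Plane n) r x ^ 2 := by
    refine ae_all_iff.2 fun n => ae_all_iff.2 fun r => ?_
    by_cases hr : 0 < r
    · have hc := hχ (TopologicalSpace.denseSeq Plane n) r (by exact_mod_cast hr)
      filter_upwards [hB.ae_mass_eq (hc.contDiff.pow 2) hc.hasCompactSupport_sq,
        ae_restrict_mem measurableSet_Ioi] with t h1 ht _
      have h2 := (abs_le.1 (hB.mass_bounds hc.contDiff hc.hasCompactSupport hc.fderiv_le
        (le_of_lt ht))).1
      rw [show (∫ x, ρ' t x * χ (TopologicalSpace.denseSeq Plane n) r x ^ 2) = _ from h1]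
      linarith
    · exact Filter.Eventually.of_forall fun t h => absurd h hr
  filter_upwards [hmass, heq, hB.ae_density_le_one hint hGm hgrad hdiv hN] with t h1 h2 h3
  refine ⟨(hB.measurable_density_slice t).aemeasurable.congr h2.symm, ?_, ?_, fun n r hr => ?_⟩
  · filter_upwards [h2] with x hx
    rw [hx]
    exact hB.density_nonneg t x
  · filter_upwards [h2, h3] with x hx hx'
    rwa [hx]
  · refine (h1 n r hr).trans (le_of_eq (integral_congr_ae ?_))
    filter_upwards [h2] with x hx
    rw [hx]

/-- The continuous functions max(f,g) and g agree almost everywhere on an open set, hence everywhere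
on it. -/
theorem ContinuousOn.le_of_ae_le {f g : ℝ → ℝ} {U : Set ℝ} (hU : IsOpen U) (hf : ContinuousOn f U)
    (hg : ContinuousOn g U) (h : ∀ᵐ t ∂(volume.restrict U), f t ≤ g t) : ∀ t ∈ U, f t ≤ g t := by
  have h1 : (fun t => max (f t) (g t)) =ᵐ[volume.restrict U] g := by
    filter_upwards [h] with t ht using max_eq_right ht
  intro t ht
  have := Measure.eqOn_open_of_ae_eq h1 hU (fun s hs => (hf s hs).max (hg s hs)) hg ht
  exact max_eq_right_iff.1 this

/-- All conditions are inequalities between integrals of ρ(t) against integrable functions, which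
are continuous in t, so they extend from almost every time to every positive time. The pointwise
bounds are recovered by testing with indicators of sets of finite measure. -/
theorem IsWeakStarContinuous.isAdmissibleDensity {ρ₀ : Plane → ℝ} {ρ : ℝ → Plane → ℝ} {c M : ℝ}
    {χ : Plane → ℝ → Plane → ℝ} (hχ : ∀ q r, 0 < r → IsCutoff c q r (χ q r))
    (H : IsWeakStarContinuous ρ)
    (h : ∀ᵐ t ∂(volume.restrict (Ioi (0 : ℝ))), IsAdmissibleDensity ρ₀ c M χ t (ρ t))
    {t : ℝ} (ht : 0 < t) : IsAdmissibleDensity ρ₀ c M χ t (ρ t) := by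
  have hL := H.1 t ht
  have hInt : ∀ t, IsAdmissibleDensity ρ₀ c M χ t (ρ t) → ∀ g : Plane → ℝ, Integrable g →
      Integrable fun x => ρ t x * g x := fun t h g hg =>
    hg.bdd_mul (c := 1) h.aemeasurable.aestronglyMeasurable (by
      filter_upwards [h.nonneg, h.le_one] with x h0 h1
      rwa [Real.norm_of_nonneg h0])
  have hlow : ∀ g : Plane → ℝ, Integrable g → (∀ x, 0 ≤ g x) → 0 ≤ ∫ x, ρ t x * g x := by
    intro g hg hg0
    refine ContinuousOn.le_of_ae_le isOpen_Ioi continuousOn_const (H.2 g hg) ?_ t ht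
    filter_upwards [h] with s hs
    refine integral_nonneg_of_ae ?_
    filter_upwards [hs.nonneg] with x hx using mul_nonneg hx (hg0 x)
  have hupp : ∀ g : Plane → ℝ, Integrable g → (∀ x, 0 ≤ g x) → ∫ x, ρ t x * g x ≤ ∫ x, g x := by
    intro g hg hg0
    refine ContinuousOn.le_of_ae_le isOpen_Ioi (H.2 g hg) continuousOn_const ?_ t ht
    filter_upwards [h] with s hs
    refine integral_mono_ae (hInt s hs g hg) hg ?_
    filter_upwards [hs.le_one] with x hx using mul_le_of_le_one_left (hg0 x) hx
  have hon : ∀ s : Set Plane, volume s < ⊤ → IntegrableOn (ρ t) s volume := fun s hs => by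
    have : IsFiniteMeasure (volume.restrict s) := ⟨by simpa using hs⟩
    exact (hL.restrict s).integrable le_top
  have hind : ∀ s : Set Plane, MeasurableSet s → volume s < ⊤ →
      Integrable (s.indicator fun _ => (1 : ℝ)) := fun s hs hs' =>
    (integrable_indicator_iff hs).2 (integrableOn_const hs'.ne)
  have hmul : ∀ s : Set Plane, MeasurableSet s →
      ∫ x, ρ t x * s.indicator (fun _ => (1 : ℝ)) x = ∫ x in s, ρ t x := fun s hs => by
    rw [← integral_indicator hs]
    refine integral_congr_ae (Filter.Eventually.of_forall fun x => ?_)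
    by_cases hx : x ∈ s <;> simp [hx]
  have hi0 : ∀ s : Set Plane, ∀ x, 0 ≤ s.indicator (fun _ => (1 : ℝ)) x := fun s x =>
    indicator_nonneg (fun _ _ => zero_le_one) x
  refine ⟨hL.1.aemeasurable, ?_, ?_, fun n r hr => ?_⟩
  · refine ae_nonneg_of_forall_setIntegral_nonneg_of_sigmaFinite (fun s _ hs => hon s hs)
      fun s hs hs' => ?_
    rw [← hmul s hs]
    exact hlow _ (hind s hs hs') (hi0 s)
  · have := ae_nonneg_of_forall_setIntegral_nonneg_of_sigmaFinite (μ := (volume : Measure Plane))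
      (f := fun x => 1 - ρ t x)
      (fun s _ hs => (integrableOn_const hs.ne).sub (hon s hs)) fun s hs hs' => by
        have h1 := hupp _ (hind s hs hs') (hi0 s)
        rw [hmul s hs, integral_indicator hs] at h1
        rw [integral_sub (f := fun _ => (1 : ℝ)) (integrableOn_const hs'.ne :
          IntegrableOn (fun _ => (1 : ℝ)) s volume) (hon s hs')]
        linarith
    filter_upwards [this] with x hx
    exact sub_nonneg.1 hx
  · refine ContinuousOn.le_of_ae_le (f := fun t => (∫ x, ρ₀ x *
      χ (TopologicalSpace.denseSeq Plane n) r x ^ 2) - 2 * (c / r) * M * t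
          * (√(∫ x, ρ₀ x * χ (TopologicalSpace.denseSeq Plane n) r x ^ 2) + 2 * (c / r) * M * t))
      isOpen_Ioi (by fun_prop)
      (H.2 _ (hχ (TopologicalSpace.denseSeq Plane n) r (by exact_mod_cast hr)).integrable_sq) ?_ t ht
    filter_upwards [h] with s hs using hs.mass_ge n r hr

theorem IsLerayHopfSolution.exists_null_set {D : Set Plane} (hD : MeasurableSet D)
    (hfin : volume D ≠ ⊤) {u₀ : Plane → Plane} {ρ : ℝ → Plane → ℝ} {u : ℝ → Plane → Plane}
    (hu₀ : MemLp u₀ 2 volume) (H : IsLerayHopfSolution (patchDensity D) u₀ ρ u)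
    {c : ℝ} {χ : Plane → ℝ → Plane → ℝ} (hχ : ∀ q r, 0 < r → IsCutoff c q r (χ q r)) :
    ∃ N : Set ℝ, volume N = 0 ∧ (IsWeakStarContinuous ρ → N = ∅) ∧ ∀ t, 0 < t → t ∉ N →
      IsAdmissibleDensity (patchDensity D) c (momentumNorm (patchDensity D) u₀) χ t (ρ t) := by
  obtain ⟨G, HG⟩ := H
  have hae := HG.ae_isAdmissibleDensity (measurable_const.indicator hD)
    ((integrable_indicator_iff hD).2 (integrableOn_const hfin))
    (fun x => indicator_nonneg (fun _ _ => zero_le_one) x)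
    (fun x => indicator_le_self' (fun _ _ => zero_le_one) x)
    (NNReal.coe_nonneg _) (lintegral_patch_energy D u₀ hu₀) hχ
  refine ⟨{t | 0 < t ∧ ¬ IsAdmissibleDensity (patchDensity D) c
    (momentumNorm (patchDensity D) u₀) χ t (ρ t)}, ?_, fun hw => ?_, fun t ht htN => ?_⟩
  · rw [ae_restrict_iff' measurableSet_Ioi, ae_iff] at hae
    simpa only [mem_Ioi, Classical.not_imp] using hae
  · refine eq_empty_iff_forall_notMem.2 fun t ht => ht.2 ?_
    exact hw.isAdmissibleDensity hχ hae ht.1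
  · by_contra hcon
    exact htN ⟨ht, hcon⟩

/-! ### Lower bounds for the mass in balls -/

/-- A cutoff equal to one on the ball about y sees initial mass a₀ ≥ a²s², and the condition on r₀
forces the transport over time t to remove less than half of it. -/
theorem IsAdmissibleDensity.ofReal_le_lintegral_ball {D : Set Plane} (hD : MeasurableSet D)
    {c M t : ℝ} {χ : Plane → ℝ → Plane → ℝ} {f : Plane → ℝ}
    (H : IsAdmissibleDensity (patchDensity D) c M χ t f)
    (hχ : ∀ q r, 0 < r → IsCutoff c q r (χ q r)) (hc : 0 ≤ c) (hM : 0 ≤ M) (ht : 0 ≤ t)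
    {a s δ r₀ : ℝ} (hs : 0 ≤ s) (hδ : 0 < δ) {x y : Plane}
    (hy : ENNReal.ofReal (a ^ 2 * s ^ 2) ≤ volume (D ∩ Metric.ball y s))
    (hr₀ : dist x y + δ + s ≤ r₀) (hβ : 8 * c * M * t ≤ a * s * r₀) :
    ENNReal.ofReal (a ^ 2 * s ^ 2 / 2)
      ≤ ∫⁻ z in Metric.ball x (4 * r₀ + δ), ENNReal.ofReal (f z) := by
  obtain ⟨n, hn⟩ := (TopologicalSpace.denseRange_denseSeq Plane).exists_dist_lt x hδ
  set q := TopologicalSpace.denseSeq Plane n with hq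
  have hr₀0 : 0 < r₀ := by linarith [dist_nonneg (x := x) (y := y)]
  -- The centre q is within δ of x and the rational radius r lies in (r₀, 2r₀), so the cutoff is one
  -- on B(y,s) and supported in B(x, 4r₀ + δ).
  obtain ⟨r, hr1, hr2⟩ := exists_rat_btwn (show r₀ < 2 * r₀ by linarith)
  have hr : (0 : ℝ) < r := hr₀0.trans hr1
  have hcut := hχ q r hr
  have hmass := H.mass_ge n r (by exact_mod_cast hr)
  rw [← hq] at hmass
  set a₀ := ∫ x, patchDensity D x * χ q r x ^ 2 with ha₀
  have hsub : Metric.ball y s ⊆ Metric.ball q r := by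
    refine Metric.ball_subset_ball' ?_
    have := dist_triangle y x q
    rw [dist_comm y x] at this
    linarith
  have hpd : ∀ x, patchDensity D x * χ q r x ^ 2 = D.indicator (fun x => χ q r x ^ 2) x :=
    fun x => by by_cases hx : x ∈ D <;> simp [patchDensity, hx]
  have hint : Integrable fun x => patchDensity D x * χ q r x ^ 2 := by
    simp_rw [hpd]
    exact hcut.integrable_sq.indicator hD
  have hpd0 : ∀ x, 0 ≤ patchDensity D x * χ q r x ^ 2 := fun x => by
    rw [hpd]
    exact indicator_nonneg (fun x _ => sq_nonneg _) x
  have ha₀ge : (a * s) ^ 2 ≤ a₀ := by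
    rw [← ENNReal.ofReal_le_ofReal_iff (integral_nonneg hpd0), mul_pow,
      ofReal_integral_eq_lintegral_ofReal hint (Filter.Eventually.of_forall hpd0)]
    refine hy.trans ?_
    rw [← setLIntegral_one]
    refine le_trans (setLIntegral_mono' (hD.inter measurableSet_ball) fun x hx => ?_)
      (setLIntegral_le_lintegral (D ∩ Metric.ball y s) _)
    rw [hpd, indicator_of_mem hx.1, hcut.eq_one x (hsub hx.2)]
    simp
  have hsqrt : a * s ≤ √a₀ := Real.le_sqrt_of_sq_le ha₀ge
  set β := 2 * (c / r) * M * t with hβdef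
  have hβ0 : 0 ≤ β := by positivity
  have hβle : β ≤ √a₀ / 4 := by
    have h1 : 8 * c * M * t ≤ √a₀ * r :=
      hβ.trans (mul_le_mul hsqrt hr1.le hr₀0.le (Real.sqrt_nonneg _))
    rw [hβdef, show 2 * (c / r) * M * t = (8 * c * M * t) / r / 4 by ring]
    gcongr
    rwa [div_le_iff₀ hr]
  -- The loss is at most (√a₀/4)(√a₀ + √a₀/4) = 5a₀/16, which is less than a₀/2.
  have hlow : a ^ 2 * s ^ 2 / 2 ≤ ∫ x, f x * χ q r x ^ 2 := by
    have h2 := Real.sq_sqrt (integral_nonneg hpd0 : 0 ≤ a₀)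
    have h3 : β * (√a₀ + β) ≤ √a₀ / 4 * (√a₀ + √a₀ / 4) := by gcongr
    nlinarith [Real.sqrt_nonneg a₀]
  have hfint : Integrable fun x => f x * χ q r x ^ 2 :=
    hcut.integrable_sq.bdd_mul (c := 1) H.aemeasurable.aestronglyMeasurable (by
      filter_upwards [H.nonneg, H.le_one] with x h0 h1
      rwa [Real.norm_of_nonneg h0])
  refine (ENNReal.ofReal_le_ofReal hlow).trans ?_
  rw [ofReal_integral_eq_lintegral_ofReal hfint (by
    filter_upwards [H.nonneg] with x h0 using mul_nonneg h0 (sq_nonneg _)),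
    ← lintegral_indicator measurableSet_ball]
  refine lintegral_mono_ae ?_
  filter_upwards [H.nonneg] with z h0
  by_cases hz : z ∈ Metric.ball x (4 * r₀ + δ)
  · rw [indicator_of_mem hz]
    exact ENNReal.ofReal_le_ofReal (mul_le_of_le_one_right h0
      (pow_le_one₀ (hcut.nonneg z) (hcut.le_one z)))
  · rw [hcut.eq_zero z fun hz' => hz (Metric.ball_subset_ball' (by
      rw [dist_comm]; linarith) hz')]
    simp

/-! ### Weighted pointwise and Lebesgue estimates -/

section
variable {F : Type} [NormedAddCommGroup F] [NormedSpace ℝ F] [CompleteSpace F]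

/-- The mass bound gives μ|v(x)| ≤ ∫ f(x+h)|v(x)| dh. In f|v(x)| ≤ f|v(x+h) - v(x)| + f|v(x+h)| the
weight is dropped from the difference, by f ≤ 1, and kept in the last term. -/
theorem HasWeakGradient.ae_weighted_le {v : Plane → F} {G : Plane → GradVal F}
    (H : HasWeakGradient v G) (hv : StronglyMeasurable v) (hG : StronglyMeasurable G)
    {f : Plane → ℝ} (hf : Measurable f) (hf0 : ∀ x, 0 ≤ f x) (hf1 : ∀ x, f x ≤ 1)
    {S : Set Plane} {ℓ : ℝ} {μ : ℝ≥0∞}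
    (hμ : ∀ x ∈ S, μ ≤ ∫⁻ y in Metric.ball x ℓ, ENNReal.ofReal (f y)) :
    ∀ᵐ x, x ∈ S → μ * ‖v x‖ₑ
      ≤ ENNReal.ofReal ℓ * segOp ℓ G x + avgOp ℓ 1 (fun x => f x • v x) x := by
  filter_upwards [H.lintegral_ball_sub_le hv hG ℓ] with x hx hxS
  have htrans : ∫⁻ y in Metric.ball x ℓ, ENNReal.ofReal (f y)
      = ∫⁻ h in Metric.ball 0 ℓ, ENNReal.ofReal (f (x + h)) := by
    rw [← (measurePreserving_add_left volume x).setLIntegral_comp_preimage measurableSet_ball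
      hf.ennreal_ofReal]
    congr 2
    ext h
    simp [dist_eq_norm]
  have hfs : Measurable fun h => ENNReal.ofReal (f (x + h)) :=
    (hf.comp (measurable_const_add x)).ennreal_ofReal
  calc μ * ‖v x‖ₑ ≤ (∫⁻ h in Metric.ball 0 ℓ, ENNReal.ofReal (f (x + h))) * ‖v x‖ₑ := by
        rw [← htrans]
        gcongr
        exact hμ x hxS
    _ = ∫⁻ h in Metric.ball 0 ℓ, ENNReal.ofReal (f (x + h)) * ‖v x‖ₑ :=
        (lintegral_mul_const _ hfs).symm
    _ ≤ ∫⁻ h in Metric.ball 0 ℓ, (‖v (x + h) - v x‖ₑ + ‖f (x + (1 : ℝ) • h) • v (x + (1 : ℝ) • h)‖ₑ) := by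
        refine lintegral_mono fun h => ?_
        rw [one_smul, enorm_smul, Real.enorm_of_nonneg (hf0 _)]
        have h1 : ‖v x‖ₑ ≤ ‖v (x + h) - v x‖ₑ + ‖v (x + h)‖ₑ := by
          rw [add_comm]
          calc ‖v x‖ₑ = ‖v (x + h) - (v (x + h) - v x)‖ₑ := by rw [sub_sub_cancel]
            _ ≤ _ := enorm_sub_le
        calc _ ≤ ENNReal.ofReal (f (x + h)) * (‖v (x + h) - v x‖ₑ + ‖v (x + h)‖ₑ) := by gcongr
          _ = ENNReal.ofReal (f (x + h)) * ‖v (x + h) - v x‖ₑ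
              + ENNReal.ofReal (f (x + h)) * ‖v (x + h)‖ₑ := mul_add _ _ _
          _ ≤ _ := by
            gcongr
            refine mul_le_of_le_one_left zero_le ?_
            rw [ENNReal.ofReal_le_one]
            exact hf1 _
    _ = (∫⁻ h in Metric.ball 0 ℓ, ‖v (x + h) - v x‖ₑ) + avgOp ℓ 1 (fun x => f x • v x) x :=
        lintegral_add_left (((hv.comp_measurable (measurable_const_add x)).sub
          stronglyMeasurable_const).enorm) _
    _ ≤ _ := by gcongr

theorem HasWeakGradient.mul_eLpNorm_restrict_le {v : Plane → F} {G : Plane → GradVal F}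
    (H : HasWeakGradient v G) (hv : StronglyMeasurable v) (hG : StronglyMeasurable G)
    {f : Plane → ℝ} (hf : Measurable f) (hf0 : ∀ x, 0 ≤ f x) (hf1 : ∀ x, f x ≤ 1)
    {S : Set Plane} (hS : MeasurableSet S) {ℓ : ℝ} {μ : ℝ≥0∞}
    (hμ : ∀ x ∈ S, μ ≤ ∫⁻ y in Metric.ball x ℓ, ENNReal.ofReal (f y))
    {p : ℝ} (hp : 2 ≤ p) (hN : eLpNorm G 2 volume ≠ ⊤)
    (hfN : eLpNorm (fun x => f x • v x) 2 volume ≠ ⊤) :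
    μ * eLpNorm v (ENNReal.ofReal p) (volume.restrict S)
      ≤ volume (Metric.ball (0 : Plane) ℓ) ^ (1 / 2 + 1 / p)
        * (ENNReal.ofReal ℓ * ENNReal.ofReal (p - 1) ^ (1 - 1 / p) * eLpNorm G 2 volume
          + eLpNorm (fun x => f x • v x) 2 volume) := by
  have hp0 : 0 < p := by linarith
  have hfv : StronglyMeasurable fun x => f x • v x := hf.stronglyMeasurable.smul hv
  set V := volume (Metric.ball (0 : Plane) ℓ) ^ (1 / 2 + 1 / p) with hV
  have hm1 : AEMeasurable (fun x => ENNReal.ofReal ℓ * segOp ℓ G x) volume :=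
    ((measurable_segOp hG ℓ).const_mul _).aemeasurable
  have hm2 : AEMeasurable (fun x => avgOp ℓ 1 (fun x => f x • v x) x) volume :=
    ((measurable_avgOp hfv ℓ).comp measurable_prodMk_left).aemeasurable
  have hA : (∫⁻ x, avgOp ℓ 1 (fun x => f x • v x) x ^ p) ^ (1 / p)
      ≤ V * eLpNorm (fun x => f x • v x) 2 volume := by
    have h1 := lintegral_avgOp_rpow_le hfv ℓ one_pos hp hfN
    rw [Real.one_rpow, ENNReal.ofReal_one, one_mul] at h1
    calc _ ≤ _ := ENNReal.rpow_le_rpow h1 (by positivity)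
      _ = _ := by rw [← ENNReal.rpow_mul, mul_one_div_cancel hp0.ne', ENNReal.rpow_one]
  have hB : (∫⁻ x, (ENNReal.ofReal ℓ * segOp ℓ G x) ^ p) ^ (1 / p)
      ≤ ENNReal.ofReal ℓ * (ENNReal.ofReal (p - 1) ^ (1 - 1 / p) * (V * eLpNorm G 2 volume)) := by
    simp_rw [ENNReal.mul_rpow_of_nonneg _ _ hp0.le]
    rw [lintegral_const_mul _ ((measurable_segOp hG ℓ).pow_const _),
      ENNReal.mul_rpow_of_nonneg _ _ (by positivity), ← ENNReal.rpow_mul,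
      mul_one_div_cancel hp0.ne', ENNReal.rpow_one]
    gcongr
    exact lintegral_segOp_rpow_le hG ℓ hp hN
  calc μ * eLpNorm v (ENNReal.ofReal p) (volume.restrict S)
      = (∫⁻ x in S, (μ * ‖v x‖ₑ) ^ p) ^ (1 / p) := by
        rw [eLpNorm_eq_lintegral_rpow_enorm_toReal (by simpa using hp0) (by simp),
          ENNReal.toReal_ofReal hp0.le]
        simp_rw [ENNReal.mul_rpow_of_nonneg _ _ hp0.le]
        rw [lintegral_const_mul _ (hv.enorm.pow_const _),
          ENNReal.mul_rpow_of_nonneg _ _ (by positivity), ← ENNReal.rpow_mul,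
          mul_one_div_cancel hp0.ne', ENNReal.rpow_one]
    _ ≤ (∫⁻ x, (ENNReal.ofReal ℓ * segOp ℓ G x + avgOp ℓ 1 (fun x => f x • v x) x) ^ p) ^ (1 / p) := by
        refine ENNReal.rpow_le_rpow ?_ (by positivity)
        refine le_trans (lintegral_mono_ae ?_) (setLIntegral_le_lintegral S _)
        rw [ae_restrict_iff' hS]
        filter_upwards [H.ae_weighted_le hv hG hf hf0 hf1 hμ] with x hx hxS
        exact ENNReal.rpow_le_rpow (hx hxS) hp0.le
    _ ≤ _ := ENNReal.lintegral_Lp_add_le hm1 hm2 (by linarith)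
    _ ≤ _ := add_le_add hB hA
    _ = _ := by ring

theorem HasWeakGradient.mul_eLpNorm_top_restrict_le {v : Plane → F} {G : Plane → GradVal F}
    (H : HasWeakGradient v G) (hv : StronglyMeasurable v) (hG : StronglyMeasurable G)
    {f : Plane → ℝ} (hf : Measurable f) (hf0 : ∀ x, 0 ≤ f x) (hf1 : ∀ x, f x ≤ 1)
    {S : Set Plane} (hS : MeasurableSet S) {ℓ : ℝ} {μ : ℝ≥0∞}
    (hμ : ∀ x ∈ S, μ ≤ ∫⁻ y in Metric.ball x ℓ, ENNReal.ofReal (f y))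
    {q : ℝ≥0∞} (hq : 2 < q) :
    μ * eLpNorm v ⊤ (volume.restrict S)
      ≤ ENNReal.ofReal ℓ * (ENNReal.ofReal (1 / (1 - 2 * q⁻¹.toReal)) * eLpNorm G q volume
          * volume (Metric.ball (0 : Plane) ℓ) ^ (1 - q⁻¹.toReal))
        + eLpNorm (fun x => f x • v x) 2 volume
          * volume (Metric.ball (0 : Plane) ℓ) ^ (1 / 2 : ℝ) := by
  have hfv : StronglyMeasurable fun x => f x • v x := hf.stronglyMeasurable.smul hv
  rw [eLpNorm_exponent_top, eLpNormEssSup, ← ENNReal.essSup_const_mul]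
  refine essSup_le_of_ae_le _ ?_
  rw [Filter.EventuallyLE, ae_restrict_iff' hS]
  filter_upwards [H.ae_weighted_le hv hG hf hf0 hf1 hμ] with x hx hxS
  refine (hx hxS).trans (add_le_add ?_ ?_)
  · gcongr
    exact segOp_le_eLpNorm hG ℓ hq x
  · have := avgOp_le_eLpNorm hfv ℓ one_pos (q := 2) (by norm_num) x
    norm_num at this
    norm_num
    exact this

end

/-! ### Almost everywhere representatives and the infimum over weak gradients -/

section
variable {F : Type} [NormedAddCommGroup F] [NormedSpace ℝ F]

/-- Nonzero finite factors commute with the infimum. If v has no weak gradient, the infimum is empty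
and the right-hand side is infinite, as the convention demands. -/
theorem le_mul_weakGradNorm_add {v : Plane → F} {q X a b Y : ℝ≥0∞} (ha : a ≠ 0) (ha' : a ≠ ⊤)
    (hb : b ≠ 0) (hb' : b ≠ ⊤)
    (h : ∀ G, HasWeakGradient v G → X ≤ a * (b * eLpNorm G q volume + Y)) :
    X ≤ a * (b * weakGradNorm v q + Y) := by
  rw [weakGradNorm, iInf_subtype', ENNReal.mul_iInf_of_ne hb hb', ENNReal.iInf_add,
    ENNReal.mul_iInf_of_ne ha ha']
  exact le_iInf fun G => h G.1 G.2

theorem exists_measurable_unit_interval {f : Plane → ℝ} (hf : AEMeasurable f volume)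
    (hf0 : ∀ᵐ x, 0 ≤ f x) (hf1 : ∀ᵐ x, f x ≤ 1) :
    ∃ g : Plane → ℝ, Measurable g ∧ (∀ x, 0 ≤ g x) ∧ (∀ x, g x ≤ 1) ∧ f =ᵐ[volume] g := by
  refine ⟨fun x => max 0 (min 1 (hf.mk f x)),
    measurable_const.max (measurable_const.min hf.measurable_mk), fun x => le_max_left _ _,
    fun x => max_le zero_le_one (min_le_left _ _), ?_⟩
  filter_upwards [hf0, hf1, hf.ae_eq_mk] with x h0 h1 h2
  rw [← h2, min_eq_right h1, max_eq_right h0]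

variable [CompleteSpace F] [MeasurableSpace F] [BorelSpace F] [SecondCountableTopology F]

theorem mul_eLpNorm_restrict_le {v : Plane → F} (hv : AEMeasurable v volume) {f : Plane → ℝ}
    (hf : AEMeasurable f volume) (hf0 : ∀ᵐ x, 0 ≤ f x) (hf1 : ∀ᵐ x, f x ≤ 1)
    {S : Set Plane} (hS : MeasurableSet S) {ℓ : ℝ} (hℓ : 0 < ℓ) {μ : ℝ≥0∞}
    (hμ : ∀ x ∈ S, μ ≤ ∫⁻ y in Metric.ball x ℓ, ENNReal.ofReal (f y)) {p : ℝ} (hp : 2 ≤ p) :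
    μ * eLpNorm v (ENNReal.ofReal p) (volume.restrict S)
      ≤ volume (Metric.ball (0 : Plane) ℓ) ^ (1 / 2 + 1 / p)
        * (ENNReal.ofReal ℓ * ENNReal.ofReal (p - 1) ^ (1 - 1 / p) * weakGradNorm v 2
          + eLpNorm (fun x => f x • v x) 2 volume) := by
  obtain ⟨g, hg, hg0, hg1, hfg⟩ := exists_measurable_unit_interval hf hf0 hf1
  have hp0 : 0 < p := by linarith
  have hV0 : volume (Metric.ball (0 : Plane) ℓ) ≠ 0 := (Metric.measure_ball_pos volume _ hℓ).ne'
  have hVt : volume (Metric.ball (0 : Plane) ℓ) ≠ ⊤ := measure_ball_lt_top.ne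
  have ha0 : volume (Metric.ball (0 : Plane) ℓ) ^ (1 / 2 + 1 / p) ≠ 0 :=
    (ENNReal.rpow_pos (pos_iff_ne_zero.2 hV0) hVt).ne'
  have hpp : ENNReal.ofReal (p - 1) ≠ 0 := by
    rw [Ne, ENNReal.ofReal_eq_zero]
    linarith
  have h1p : 1 / p ≤ 1 := by rw [div_le_one hp0]; linarith
  have hb0 : ENNReal.ofReal ℓ * ENNReal.ofReal (p - 1) ^ (1 - 1 / p) ≠ 0 :=
    mul_ne_zero (by simpa using hℓ)
      (ENNReal.rpow_pos (pos_iff_ne_zero.2 hpp) ENNReal.ofReal_ne_top).ne'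
  refine le_mul_weakGradNorm_add ha0 (ENNReal.rpow_ne_top_of_nonneg (by positivity) hVt) hb0
    (ENNReal.mul_ne_top ENNReal.ofReal_ne_top
      (ENNReal.rpow_ne_top_of_nonneg (by linarith) ENNReal.ofReal_ne_top)) fun G H => ?_
  -- If either norm on the right is infinite, so is the right-hand side, because its coefficients
  -- are nonzero.
  by_cases hN : eLpNorm G 2 volume = ⊤
  · rw [hN, ENNReal.mul_top hb0, top_add, ENNReal.mul_top ha0]
    exact le_top
  by_cases hfN : eLpNorm (fun x => f x • v x) 2 volume = ⊤
  · rw [hfN, add_top, ENNReal.mul_top ha0]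
    exact le_top
  have hvm := hv.aestronglyMeasurable
  have hGm := H.2.1.aestronglyMeasurable
  have hfv : eLpNorm (fun x => f x • v x) 2 volume = eLpNorm (fun x => g x • hvm.mk v x) 2 volume :=
    eLpNorm_congr_ae (by filter_upwards [hfg, hvm.ae_eq_mk] with x h1 h2; rw [← h1, ← h2])
  rw [hfv] at hfN ⊢
  rw [eLpNorm_congr_ae hGm.ae_eq_mk] at hN ⊢
  rw [eLpNorm_congr_ae (ae_restrict_of_ae hvm.ae_eq_mk)]
  refine (H.congr hvm.ae_eq_mk hGm.ae_eq_mk).mul_eLpNorm_restrict_le hvm.stronglyMeasurable_mk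
    hGm.stronglyMeasurable_mk hg hg0 hg1 hS (fun x hx => (hμ x hx).trans (le_of_eq ?_)) hp hN hfN
  exact lintegral_congr_ae (ae_restrict_of_ae (hfg.mono fun x hx => congrArg ENNReal.ofReal hx))

theorem mul_eLpNorm_top_restrict_le {v : Plane → F} (hv : AEMeasurable v volume) {f : Plane → ℝ}
    (hf : AEMeasurable f volume) (hf0 : ∀ᵐ x, 0 ≤ f x) (hf1 : ∀ᵐ x, f x ≤ 1)
    {S : Set Plane} (hS : MeasurableSet S) {ℓ : ℝ} {μ : ℝ≥0∞}
    (hμ : ∀ x ∈ S, μ ≤ ∫⁻ y in Metric.ball x ℓ, ENNReal.ofReal (f y)) {q : ℝ≥0∞} (hq : 2 < q)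
    {G : Plane → GradVal F} (H : HasWeakGradient v G) :
    μ * eLpNorm v ⊤ (volume.restrict S)
      ≤ ENNReal.ofReal ℓ * (ENNReal.ofReal (1 / (1 - 2 * q⁻¹.toReal)) * eLpNorm G q volume
          * volume (Metric.ball (0 : Plane) ℓ) ^ (1 - q⁻¹.toReal))
        + eLpNorm (fun x => f x • v x) 2 volume
          * volume (Metric.ball (0 : Plane) ℓ) ^ (1 / 2 : ℝ) := by
  obtain ⟨g, hg, hg0, hg1, hfg⟩ := exists_measurable_unit_interval hf hf0 hf1
  have hvm := hv.aestronglyMeasurable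
  have hGm := H.2.1.aestronglyMeasurable
  have hfv : eLpNorm (fun x => f x • v x) 2 volume = eLpNorm (fun x => g x • hvm.mk v x) 2 volume :=
    eLpNorm_congr_ae (by filter_upwards [hfg, hvm.ae_eq_mk] with x h1 h2; rw [← h1, ← h2])
  rw [hfv, eLpNorm_congr_ae hGm.ae_eq_mk, eLpNorm_congr_ae (ae_restrict_of_ae hvm.ae_eq_mk)]
  refine (H.congr hvm.ae_eq_mk hGm.ae_eq_mk).mul_eLpNorm_top_restrict_le hvm.stronglyMeasurable_mk
    hGm.stronglyMeasurable_mk hg hg0 hg1 hS (fun x hx => (hμ x hx).trans (le_of_eq ?_)) hq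
  exact lintegral_congr_ae (ae_restrict_of_ae (hfg.mono fun x hx => congrArg ENNReal.ofReal hx))

end

/-! ### Scaling -/

theorem rpow_le_ofReal_mul {V : ℝ≥0∞} {Λ t e : ℝ} (hΛ : 1 ≤ Λ) (ht : 0 ≤ t) (he0 : 0 ≤ e)
    (he1 : e ≤ 1) (hV : V ≤ ENNReal.ofReal (Λ * t)) : V ^ e ≤ ENNReal.ofReal (Λ * t ^ e) := by
  refine (ENNReal.rpow_le_rpow hV he0).trans ?_
  rw [ENNReal.ofReal_rpow_of_nonneg (by positivity) he0, Real.mul_rpow (by linarith) ht]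
  refine ENNReal.ofReal_le_ofReal ?_
  gcongr
  calc Λ ^ e ≤ Λ ^ (1 : ℝ) := Real.rpow_le_rpow_of_exponent_le hΛ he1
    _ = Λ := Real.rpow_one _

/-- Here V is the area of a ball of radius 5L√t, and e = 1/2 + 1/p ≤ 1 gives V^e ≤ (10L)² t^e.
Dividing by bt leaves the power t^(e-1), which is moved to the left as t^(1/2-1/p); the other √t
stays with the gradient. -/
theorem scaled_le {X W Y V : ℝ≥0∞} {b L t p : ℝ} (hb : 0 < b) (hL : 1 ≤ L) (ht : 0 < t) (hp : 2 ≤ p)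
    (hV : V ≤ ENNReal.ofReal ((10 * L) ^ 2 * t))
    (h : ENNReal.ofReal (b * t) * X ≤ V ^ (1 / 2 + 1 / p)
      * (ENNReal.ofReal (5 * L * √t) * ENNReal.ofReal (p - 1) ^ (1 - 1 / p) * W + Y)) :
    ENNReal.ofReal (t ^ (1 / 2 - 1 / p)) * X
      ≤ ENNReal.ofReal p * ENNReal.ofReal (b⁻¹ * (10 * L) ^ 3)
        * (ENNReal.ofReal (t ^ (1 / 2 : ℝ)) * W + Y) := by
  have hp0 : 0 < p := by linarith
  have h1p : 1 / p ≤ 1 / 2 := one_div_le_one_div_of_le (by norm_num) hp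
  have h0p : 0 < 1 / p := by positivity
  set e := 1 / 2 + 1 / p with he
  have hVe := rpow_le_ofReal_mul (e := e) (by nlinarith : 1 ≤ (10 * L) ^ 2) ht.le
    (by positivity) (by linarith) hV
  have hpp : ENNReal.ofReal (p - 1) ^ (1 - 1 / p) ≤ ENNReal.ofReal p := by
    rw [ENNReal.ofReal_rpow_of_nonneg (by linarith) (by linarith)]
    refine ENNReal.ofReal_le_ofReal ?_
    calc (p - 1) ^ (1 - 1 / p) ≤ (p - 1) ^ (1 : ℝ) :=
          Real.rpow_le_rpow_of_exponent_le (by linarith) (by linarith)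
      _ ≤ p := by rw [Real.rpow_one]; linarith
  have hsplit : t ^ (1 / 2 - 1 / p) = (t ^ (-e) * b⁻¹) * (b * t) := by
    rw [show t ^ (-e) * b⁻¹ * (b * t) = t ^ (-e) * t ^ (1 : ℝ) by
      rw [Real.rpow_one]; field_simp, ← Real.rpow_add ht]
    congr 1
    rw [he]
    ring
  have ht' : 0 < t ^ (-e) := Real.rpow_pos_of_pos ht _
  calc _ = ENNReal.ofReal (t ^ (-e) * b⁻¹) * (ENNReal.ofReal (b * t) * X) := by
        rw [hsplit, ENNReal.ofReal_mul (by positivity), mul_assoc]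
    _ ≤ ENNReal.ofReal (t ^ (-e) * b⁻¹) * (ENNReal.ofReal ((10 * L) ^ 2 * t ^ e)
        * (ENNReal.ofReal (5 * L * √t) * ENNReal.ofReal p * W + Y)) := by
        refine mul_le_mul_right (h.trans ?_) _
        gcongr
    _ = ENNReal.ofReal (b⁻¹ * (10 * L) ^ 2)
        * (ENNReal.ofReal (5 * L * p) * (ENNReal.ofReal (t ^ (1 / 2 : ℝ)) * W) + Y) := by
        rw [← mul_assoc, ← ENNReal.ofReal_mul (by positivity), ← Real.sqrt_eq_rpow,
          ← mul_assoc (ENNReal.ofReal (5 * L * p)) _ W, ← ENNReal.ofReal_mul (by positivity),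
          ← ENNReal.ofReal_mul (by positivity)]
        have : t ^ (-e) * t ^ e = 1 := by rw [← Real.rpow_add ht]; simp
        rw [show t ^ (-e) * b⁻¹ * ((10 * L) ^ 2 * t ^ e) = b⁻¹ * (10 * L) ^ 2 by
          linear_combination (b⁻¹ * (10 * L) ^ 2) * this,
          show 5 * L * √t * p = 5 * L * p * √t by ring]
    _ ≤ ENNReal.ofReal (b⁻¹ * (10 * L) ^ 2)
        * (ENNReal.ofReal (5 * L * p) * (ENNReal.ofReal (t ^ (1 / 2 : ℝ)) * W)
          + ENNReal.ofReal (5 * L * p) * Y) := by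
        gcongr
        refine le_mul_of_one_le_left zero_le ?_
        rw [ENNReal.one_le_ofReal]
        nlinarith
    _ = ENNReal.ofReal (b⁻¹ * (10 * L) ^ 2 * (5 * L * p))
        * (ENNReal.ofReal (t ^ (1 / 2 : ℝ)) * W + Y) := by
        rw [← mul_add, ← mul_assoc, ← ENNReal.ofReal_mul (by positivity)]
    _ ≤ _ := by
        rw [← ENNReal.ofReal_mul (by positivity)]
        refine mul_le_mul_left (ENNReal.ofReal_le_ofReal ?_) _
        have : 0 ≤ b⁻¹ * L ^ 3 * p := by positivity
        nlinarith

/-- The same bookkeeping with θ = 1/q: after multiplication by 1/(b√t) the radius 5L√t loses its √t,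
the area contributes t^(1-θ) to the gradient term, and V^(1/2) loses its √t. -/
theorem scaled_top_le {X W Y V : ℝ≥0∞} {b L t k θ : ℝ} (hb : 0 < b) (hL : 1 ≤ L) (ht : 0 < t)
    (hk : 1 ≤ k) (hθ0 : 0 ≤ θ) (hθ1 : θ ≤ 1) (hV : V ≤ ENNReal.ofReal ((10 * L) ^ 2 * t))
    (h : ENNReal.ofReal (b * t) * X ≤ ENNReal.ofReal (5 * L * √t)
      * (ENNReal.ofReal k * W * V ^ (1 - θ)) + Y * V ^ (1 / 2 : ℝ)) :
    ENNReal.ofReal (t ^ (1 / 2 : ℝ)) * X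
      ≤ ENNReal.ofReal k * ENNReal.ofReal (b⁻¹ * (10 * L) ^ 3)
        * (ENNReal.ofReal (t ^ (1 - θ)) * W + Y) := by
  have hΛ : 1 ≤ (10 * L) ^ 2 := by nlinarith
  have hV1 := rpow_le_ofReal_mul (e := 1 - θ) hΛ ht.le (by linarith) (by linarith) hV
  have hV2 := rpow_le_ofReal_mul (e := 1 / 2) hΛ ht.le (by norm_num) (by norm_num) hV
  rw [← Real.sqrt_eq_rpow] at hV2 ⊢
  have hs : 0 < √t := Real.sqrt_pos.2 ht
  have hss : √t * √t = t := Real.mul_self_sqrt ht.le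
  have hsplit : √t = ((√t)⁻¹ * b⁻¹) * (b * t) := by
    field_simp
    nlinarith
  have htθ : 0 < t ^ (1 - θ) := Real.rpow_pos_of_pos ht _
  calc _ = ENNReal.ofReal ((√t)⁻¹ * b⁻¹) * (ENNReal.ofReal (b * t) * X) := by
        rw [← mul_assoc, ← ENNReal.ofReal_mul (by positivity), ← hsplit]
    _ ≤ ENNReal.ofReal ((√t)⁻¹ * b⁻¹) * (ENNReal.ofReal (5 * L * √t)
      * (ENNReal.ofReal k * W * ENNReal.ofReal ((10 * L) ^ 2 * t ^ (1 - θ)))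
        + Y * ENNReal.ofReal ((10 * L) ^ 2 * √t)) := by
        refine mul_le_mul_right (h.trans ?_) _
        gcongr
    _ = ENNReal.ofReal (((√t)⁻¹ * b⁻¹) * (5 * L * √t) * k * ((10 * L) ^ 2 * t ^ (1 - θ))) * W
        + ENNReal.ofReal (((√t)⁻¹ * b⁻¹) * ((10 * L) ^ 2 * √t)) * Y := by
        rw [ENNReal.ofReal_mul (p := (√t)⁻¹ * b⁻¹ * (5 * L * √t) * k) (by positivity),
          ENNReal.ofReal_mul (p := (√t)⁻¹ * b⁻¹ * (5 * L * √t)) (by positivity),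
          ENNReal.ofReal_mul (p := (√t)⁻¹ * b⁻¹) (by positivity),
          ENNReal.ofReal_mul (p := (√t)⁻¹ * b⁻¹) (by positivity)]
        ring
    _ ≤ ENNReal.ofReal (k * (b⁻¹ * (10 * L) ^ 3) * t ^ (1 - θ)) * W
        + ENNReal.ofReal (k * (b⁻¹ * (10 * L) ^ 3)) * Y := by
        gcongr ENNReal.ofReal ?_ * _ + ENNReal.ofReal ?_ * _
        · rw [show (√t)⁻¹ * b⁻¹ * (5 * L * √t) * k * ((10 * L) ^ 2 * t ^ (1 - θ))
            = 500 * (b⁻¹ * L ^ 3 * k * t ^ (1 - θ)) by field_simp; ring]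
          have : 0 ≤ b⁻¹ * L ^ 3 * k * t ^ (1 - θ) := by positivity
          nlinarith
        · rw [show (√t)⁻¹ * b⁻¹ * ((10 * L) ^ 2 * √t) = 1 * (b⁻¹ * (10 * L) ^ 2) by field_simp]
          refine mul_le_mul hk ?_ (by positivity) (by linarith)
          gcongr 1
          exact pow_le_pow_right₀ (by linarith) (by norm_num)
    _ = _ := by
        rw [ENNReal.ofReal_mul (p := k * (b⁻¹ * (10 * L) ^ 3)) (by positivity),
          ENNReal.ofReal_mul (p := k) (by linarith)]
        ring

/-! ### The estimates on the strip -/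

theorem IsAdmissibleDensity.ofReal_le_lintegral_ball_strip {D : Set Plane} (hD : MeasurableSet D)
    {c M t : ℝ} {χ : Plane → ℝ → Plane → ℝ} {f : Plane → ℝ}
    (H : IsAdmissibleDensity (patchDensity D) c M χ t f)
    (hχ : ∀ q r, 0 < r → IsCutoff c q r (χ q r)) (hc : 0 ≤ c) (hM : 0 ≤ M) (ht : 0 < t)
    {a s₀ κ R L : ℝ} (ha : 0 < a)
    (hdens : ∀ x ∈ D, ∀ s, 0 < s → s ≤ s₀ →
      ENNReal.ofReal (a ^ 2 * s ^ 2) ≤ volume (D ∩ Metric.ball x s))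
    (hκ : 0 < κ) (hκ1 : κ ≤ 1) (hκt : κ * √t ≤ s₀) (hL : R + 2 + 8 * c / (a * κ) * M ≤ L)
    (hR : 0 ≤ R) {x : Plane} (hx : x ∈ strip D R t) :
    ENNReal.ofReal (a ^ 2 * κ ^ 2 / 2 * t)
      ≤ ∫⁻ z in Metric.ball x (5 * L * √t), ENNReal.ofReal (f z) := by
  have hs : 0 < √t := Real.sqrt_pos.2 ht
  have hss : √t * √t = t := Real.mul_self_sqrt ht.le
  have hAM : 0 ≤ 8 * c / (a * κ) * M := by positivity
  obtain ⟨y, hy, h, hh, rfl⟩ := hx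
  have hdist : dist (y + h) y < R * √t := by simpa [dist_eq_norm] using hh
  -- All lengths are multiples of √t. In L the part R + 2 covers the distance to D, the
  -- approximation of the centre and the ball radius (κ ≤ 1), and the part proportional to M covers
  -- the transport condition; 4L + 1 ≤ 5L gives the final radius.
  have key := H.ofReal_le_lintegral_ball hD hχ hc hM ht.le (a := a) (s := κ * √t) (δ := √t)
    (r₀ := L * √t) (x := y + h) (y := y) (by positivity) hs
    (hdens y hy _ (by positivity) hκt) (by nlinarith) (by
      have h1 : 8 * c * M ≤ a * κ * L := by
        have h2 : 8 * c / (a * κ) * M ≤ L := by linarith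
        calc 8 * c * M = a * κ * (8 * c / (a * κ) * M) := by field_simp
          _ ≤ _ := by gcongr
      calc 8 * c * M * t ≤ a * κ * L * t := by gcongr
        _ = a * (κ * √t) * (L * √t) := by linear_combination (-(a * κ * L)) * hss)
  refine le_trans (le_of_eq ?_) (key.trans (lintegral_mono_set (Metric.ball_subset_ball ?_)))
  · congr 1
    linear_combination (-(a ^ 2 * κ ^ 2 / 2)) * hss
  · nlinarith

theorem mainTheorem9 (D : Set Plane) (hD : IsBoundedLipschitzDomain D) (T : ℝ) (hT : 0 < T) :
    ∃ (C₁ C₂ : ℝ≥0 × ℝ≥0 → ℝ≥0) (K₁ : ℝ → ℝ≥0) (K₂ : ℝ≥0∞ → ℝ≥0),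
      Monotone C₁ ∧ Monotone C₂ ∧
      ∀ (R : ℝ≥0), 0 < R →
      ∀ (u₀ : Plane → Plane) (ρ : ℝ → Plane → ℝ) (u : ℝ → Plane → Plane),
        IsL2Sigma u₀ → IsLerayHopfSolution (patchDensity D) u₀ ρ u →
        ∃ N : Set ℝ, volume N = 0 ∧ (IsWeakStarContinuous ρ → N = ∅) ∧
          ∀ t ∈ Ioo (0 : ℝ) T \ N,
          ∀ (m : ℕ) (v : Plane → EuclideanSpace ℝ (Fin m)), AEMeasurable v volume →
            (∀ p : ℝ, 2 ≤ p →
              ENNReal.ofReal (t ^ (1 / 2 - 1 / p))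
                  * eLpNorm v (ENNReal.ofReal p) (volume.restrict (strip D R t))
                ≤ K₁ p * C₁ (R, momentumNorm (patchDensity D) u₀)
                  * (ENNReal.ofReal (t ^ (1 / 2 : ℝ)) * weakGradNorm v 2
                    + eLpNorm (fun x => ρ t x • v x) 2 volume)) ∧
            (∀ q : ℝ≥0∞, 2 < q →
              ENNReal.ofReal (t ^ (1 / 2 : ℝ)) * eLpNorm v ⊤ (volume.restrict (strip D R t))
                ≤ K₂ q * C₂ (R, momentumNorm (patchDensity D) u₀)
                  * (ENNReal.ofReal (t ^ (1 - q⁻¹.toReal)) * weakGradNorm v q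
                    + eLpNorm (fun x => ρ t x • v x) 2 volume)) := by
  obtain ⟨c₁, s₀, hc₁, hs₀, hdens⟩ := hD.measure_density
  obtain ⟨c, hc, hcut⟩ := exists_isCutoff
  choose! χ hχ using hcut
  set a := √c₁ with ha
  have ha0 : 0 < a := Real.sqrt_pos.2 hc₁
  rw [← Real.sq_sqrt hc₁.le, ← ha] at hdens
  -- This keeps κ√t below s₀ for all t < T, so the measure density of D applies at scale κ√t; the
  -- constants depend on T only through κ.
  set κ := min 1 (s₀ / √T) with hκ
  have hsT : 0 < √T := Real.sqrt_pos.2 hT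
  have hκ0 : 0 < κ := lt_min one_pos (by positivity)
  set b := a ^ 2 * κ ^ 2 / 2 with hb
  have hb0 : 0 < b := by positivity
  have hA : 0 ≤ 8 * c / (a * κ) := by positivity
  set C : ℝ≥0 × ℝ≥0 → ℝ≥0 := fun z =>
    (b⁻¹ * (10 * (z.1 + 2 + 8 * c / (a * κ) * z.2)) ^ 3).toNNReal with hC
  have hmono : Monotone C := by
    intro z w hzw
    have h1 : (z.1 : ℝ) ≤ w.1 := hzw.1
    have h2 : (z.2 : ℝ) ≤ w.2 := hzw.2
    refine Real.toNNReal_mono ?_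
    gcongr
  -- The constants are K₁(p) = p, K₂(q) = 1/(1 - 2/q) and C₁ = C₂ = (10L)³/b, where L is affine and
  -- nondecreasing in R and M.
  refine ⟨C, C, Real.toNNReal, fun q => (1 / (1 - 2 * q⁻¹.toReal)).toNNReal, hmono, hmono,
    fun R _ u₀ ρ u hu₀ hsol => ?_⟩
  obtain ⟨N, hN0, hNw, hN⟩ := hsol.exists_null_set hD.1.measurableSet hD.2.1.measure_lt_top.ne
    hu₀.1 hχ
  refine ⟨N, hN0, hNw, fun t ht m v hv => ?_⟩
  obtain ⟨⟨ht0, htT⟩, htN⟩ := ht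
  have H := hN t ht0 htN
  set M := momentumNorm (patchDensity D) u₀ with hM
  set L : ℝ := R + 2 + 8 * c / (a * κ) * M with hL
  have hL2 : 1 ≤ L := by
    have : 0 ≤ 8 * c / (a * κ) * M := by positivity
    have := R.coe_nonneg
    linarith
  have hst : 0 < √t := Real.sqrt_pos.2 ht0
  have hκt : κ * √t ≤ s₀ := by
    calc κ * √t ≤ s₀ / √T * √T := by
          gcongr
          exact min_le_right _ _
      _ = s₀ := by field_simp
  have hS : MeasurableSet (strip D R t) := (hD.1.add_right).measurableSet
  have hμ : ∀ x ∈ strip D R t, ENNReal.ofReal (b * t)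
      ≤ ∫⁻ z in Metric.ball x (5 * L * √t), ENNReal.ofReal (ρ t z) := fun x hx =>
    H.ofReal_le_lintegral_ball_strip hD.1.measurableSet hχ hc M.coe_nonneg ht0 ha0 hdens hκ0
      (min_le_left _ _) hκt le_rfl R.coe_nonneg hx
  have hV : volume (Metric.ball (0 : Plane) (5 * L * √t)) ≤ ENNReal.ofReal ((10 * L) ^ 2 * t) := by
    refine (volume_ball_le 0 (by positivity)).trans (le_of_eq ?_)
    rw [mul_pow, Real.sq_sqrt ht0.le]
    ring_nf
  refine ⟨fun p hp => ?_, fun q hq => ?_⟩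
  · exact scaled_le hb0 hL2 ht0 hp hV
      (mul_eLpNorm_restrict_le hv H.aemeasurable H.nonneg H.le_one hS (by positivity) hμ hp)
  · have hq1 : q⁻¹.toReal < 1 / 2 := by
      have h1 : q⁻¹ < 2⁻¹ := ENNReal.inv_lt_inv.2 hq
      simpa using (ENNReal.toReal_lt_toReal h1.ne_top (by simp)).2 h1
    have hq0 : 0 ≤ q⁻¹.toReal := ENNReal.toReal_nonneg
    have hk : 1 ≤ 1 / (1 - 2 * q⁻¹.toReal) := by
      rw [le_div_iff₀ (by linarith)]
      linarith
    refine le_mul_weakGradNorm_add (mul_ne_zero ?_ ?_) (by finiteness) ?_ ENNReal.ofReal_ne_top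
      fun G hG => ?_
    · rw [Ne, ENNReal.coe_eq_zero, Real.toNNReal_eq_zero]
      linarith
    · rw [Ne, ENNReal.coe_eq_zero, Real.toNNReal_eq_zero, not_le]
      positivity
    · rw [Ne, ENNReal.ofReal_eq_zero, not_le]
      exact Real.rpow_pos_of_pos ht0 _
    · exact scaled_top_le hb0 hL2 ht0 hk hq0 (by linarith) hV
        (mul_eLpNorm_top_restrict_le hv H.aemeasurable H.nonneg H.le_one hS hμ hq hG)
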